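/- **Proposition.** The functor $\tilde H_0:\mathsf{TOF}\to\mathsf{FPinj}_2$ defined below is faithful, i.e. for all $n,m\in\mathbb N$ and all $f,g\in\mathsf{TOF}(n,m)$, $\tilde H_0(f)=\tilde H_0(g)$ implies $f=g$. *The category $\mathsf{TOF}$.* Composition is written in diagrammatic order: $f;g$ means first $f$, then $g$. $\mathsf{TOF}$ is the strict symmetric monoidal category with objects the natural numbers ($n\otimes m=n+m$, unit $0$) generated by $|1\rangle:0\to1$, $\langle1|:1\to0$ and the Toffoli gate $\mathsf{tof}:3\to3$ (controls on wires 1, 2 and target on wire 3), subject to the identities (1)–(17) below. Write $\sigma:2\to2$ for the symmetry and abbreviate $$\mathsf{cnot}=(|1\rangle\otimes1_2);\mathsf{tof};(\langle1|\otimes1_2),\quad \mathsf{not}=(|1\rangle\otimes1_1);\mathsf{cnot};(\langle1|\otimes1_1),\quad |0\rangle=|1\rangle;\mathsf{not},\quad \langle0|=\mathsf{not};\langle1|.$$ For a circuit on $N$ wires, $\mathsf{tof}_{i,j\to k}$ (resp. $\mathsf{cnot}_{i\to k}$) denotes $\mathsf{tof}$ (resp. $\mathsf{cnot}$) conjugated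 by wire permutations so that it acts with controls on wires $i,j$ (resp. control on wire $i$) and target on wire $k$, and with the identity on the other wires; for a flipped gate ($i>j>k$) the bottom wire is the first control. Wires are numbered from top to bottom, the top wire being the first tensor factor. The identities are: 1. $(|1\rangle\otimes1_2);\mathsf{tof}=|1\rangle\otimes\mathsf{cnot}$ and $\mathsf{tof};(\langle1|\otimes1_2)=\langle1|\otimes\mathsf{cnot}$; 2. $(|0\rangle\otimes1_2);\mathsf{tof}=|0\rangle\otimes1_2$ and $\mathsf{tof};(\langle0|\otimes1_2)=\langle0|\otimes1_2$; 3. $\mathsf{tof}_{1,2\to3};\mathsf{tof}_{5,4\to3}=\mathsf{tof}_{5,4\to3};\mathsf{tof}_{1,2\to3}$ on 5 wires; 4. $\mathsf{tof}_{3,2\to1};\mathsf{tof}_{3,4\to5}=\mathsf{tof}_{3,4\to5};\mathsf{tof}_{3,2\to1}$ on 5 wires; 5. $\mathsf{tof}_{3,2\to1};\mathsf{tof}_{2,3\to4}=\mathsf{tof}_{2,3\to4};\mathsf{tof}_{3,2\to1}$ on 4 wires; 6. $\mathsf{tof}_{1,3\to4};\mathsf{tof}_{2,3\to4}=\mathsf{tof}_{2,3\to4};\mathsf{tof}_{1,3\to4}$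 on 4 wires; 7. $(1_2\otimes|1\rangle);\mathsf{cnot}_{1\to3};(1_2\otimes\langle0|);(1_2\otimes|1\rangle);\mathsf{cnot}_{2\to3};(1_2\otimes\langle0|)=(1_2\otimes|1\rangle);\mathsf{tof};(1_2\otimes\langle0|)$; 8. $(|1\rangle;\langle0|)\otimes1_1=(|1\rangle;\langle0|)\otimes(\langle1|;|1\rangle)$; 9. $|1\rangle;\langle1|=1_0$; 10. $\mathsf{tof};\mathsf{tof}=1_3$; 11. $\mathsf{tof}_{2,3\to4};\mathsf{tof}_{1,2\to3};\mathsf{tof}_{2,3\to4}=\mathsf{tof}_{1,2\to4};\mathsf{tof}_{1,2\to3}$ on 4 wires; 12. $\mathsf{cnot}_{1\to2};\mathsf{tof}_{2,3\to4};\mathsf{cnot}_{1\to2}=\mathsf{tof}_{1,3\to4};\mathsf{tof}_{2,3\to4}$ on 4 wires; 13. $\mathsf{tof}_{1,2\to3};\mathsf{tof}_{2,3\to4};\mathsf{tof}_{1,2\to3}=\mathsf{tof}_{1,2\to4};\mathsf{tof}_{2,3\to4}$ on 4 wires; 14. $\mathsf{tof}_{1,2\to3};\mathsf{cnot}_{3\to4};\mathsf{tof}_{1,2\to3}=\mathsf{tof}_{1,2\to4};\mathsf{cnot}_{3\to4}$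 on 4 wires; 15. $\mathsf{cnot}_{1\to2};\mathsf{cnot}_{2\to1};\mathsf{cnot}_{1\to2}=\sigma$; 16. $\mathsf{tof}=(\sigma\otimes1_1);\mathsf{tof};(\sigma\otimes1_1)$; 17. $t=(1_1\otimes\sigma\otimes1_1);t;(1_1\otimes\sigma\otimes1_1)$, where $t=(1_2\otimes|0\rangle\otimes1_2);\mathsf{tof}_{1,2\to3};\mathsf{tof}_{3,4\to5};\mathsf{tof}_{1,2\to3};(1_2\otimes\langle0|\otimes1_2):4\to4$. Flipping circuits horizontally ($|1\rangle\leftrightarrow\langle1|$, $\mathsf{tof}\mapsto\mathsf{tof}$) gives an involution $(\_)^\circ:\mathsf{TOF}^{\mathrm{op}}\to\mathsf{TOF}$. Put $\bar f=f;f^\circ$; a map $f$ is *total* if $\bar f$ is an identity. *The category $\mathsf{FPinj}_2$* is the full subcategory of the category $\mathsf{Pinj}$ of sets and partial isomorphisms (partial injective functions) whose objects are the finite powers $\{0,1\}^n$, $n\in\mathbb N$, of the two element set. *The functor $\tilde H_0$.* The functor $H_0:\mathsf{TOF}\to\mathsf{Pinj}$ sends $n$ to the set of total maps $p:0\to n$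 and sends $f:n\to m$ to the partial injective function with $p\mapsto p;f$ if $p;f$ is total, and undefined at $p$ otherwise. The total maps $0\to n$ are exactly the kets $|b_1,\dots,b_n\rangle=|b_1\rangle\otimes\cdots\otimes|b_n\rangle$, and distinct bit strings give distinct kets; $\tilde H_0:\mathsf{TOF}\to\mathsf{FPinj}_2$ is the functor obtained from $H_0$ by identifying $H_0(n)$ with $\{0,1\}^n$ in this way. -/

import Mathlib

open CategoryTheory

/-- Circuits: formal expressions for the morphisms of the strict symmetric monoidal category
whose objects are the natural numbers (the tensor of objects being addition), generated by
`|1⟩ : 0 → 1`, `⟨1| : 1 → 0` and the Toffoli gate `3 → 3`. -/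
inductive Circuit : ℕ → ℕ → Type
  | id (n : ℕ) : Circuit n n
  | comp {a b c : ℕ} (f : Circuit a b) (g : Circuit b c) : Circuit a c
  | tensor {a b c d : ℕ} (f : Circuit a b) (g : Circuit c d) : Circuit (a + c) (b + d)
  | swap (a b : ℕ) : Circuit (a + b) (b + a)
  | ket1 : Circuit 0 1
  | bra1 : Circuit 1 0
  | tof : Circuit 3 3

namespace Circuit

/-- Composition in diagrammatic order: `f ⨾ g` is first `f`, then `g`. -/
infixr:60 " ⨾ " => Circuit.comp

/-- `f ⊠ g` is `f` drawn above `g`. -/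
notation:70 f:70 " ⊠ " g:71 => (Circuit.tensor f g :)

/-- Transport of a circuit along equalities of its numbers of wires. -/
def cast {a b a' b' : ℕ} (ha : a = a') (hb : b = b') (f : Circuit a b) : Circuit a' b' :=
  ha ▸ hb ▸ f

/-! ### Derived gates -/

/-- `cnot`, with control on the top wire. -/
def cnot : Circuit 2 2 := (ket1 ⊠ id 2) ⨾ tof ⨾ (bra1 ⊠ id 2)

def not : Circuit 1 1 := (ket1 ⊠ id 1) ⨾ cnot ⨾ (bra1 ⊠ id 1)

def ket0 : Circuit 0 1 := ket1 ⨾ not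

def bra0 : Circuit 1 0 := not ⨾ bra1

/-- The permutation of three wires that reverses their order. -/
def rev3 : Circuit 3 3 := (swap 1 1 ⊠ id 1) ⨾ (id 1 ⊠ swap 1 1) ⨾ (swap 1 1 ⊠ id 1)

/-- The flipped Toffoli gate: target on the top wire, controls on the two others. -/
def tofFlip : Circuit 3 3 := rev3 ⨾ tof ⨾ rev3

/-- The flipped `cnot` gate: target on the top wire. -/
def cnotFlip : Circuit 2 2 := swap 1 1 ⨾ cnot ⨾ swap 1 1

/-- `cnot` on three wires with control on wire 1 and target on wire 3. -/
def cnot13 : Circuit 3 3 := (id 1 ⊠ swap 1 1) ⨾ (cnot ⊠ id 1) ⨾ (id 1 ⊠ swap 1 1)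

/-- The Toffoli gate on four wires with controls on wires 1, 3 and target on wire 4. -/
def tof134 : Circuit 4 4 := (swap 1 1 ⊠ id 2) ⨾ (id 1 ⊠ tof) ⨾ (swap 1 1 ⊠ id 2)

/-- The Toffoli gate on four wires with controls on wires 1, 2 and target on wire 4. -/
def tof124 : Circuit 4 4 := (id 2 ⊠ swap 1 1) ⨾ (tof ⊠ id 1) ⨾ (id 2 ⊠ swap 1 1)

/-- The not gate with three controls (wires 1, 2, 3) and target wire 4,
built from Toffoli gates by means of an auxiliary wire in state `0` between wires 2 and 3. -/
def cnot3 : Circuit 4 4 :=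
  (id 2 ⊠ ket0 ⊠ id 2) ⨾ (tof ⊠ id 2) ⨾ (id 2 ⊠ tof) ⨾ (tof ⊠ id 2) ⨾ (id 2 ⊠ bra0 ⊠ id 2)

/-- The defining identities of the category `TOF` (the 17 generating identities; `tof1`, `tof1'`
and `tof2`, `tof2'` are the two halves of the first and of the second identity). Circuits are
read from left to right, and the topmost wire is the first tensor factor. -/
inductive Identity : {n m : ℕ} → Circuit n m → Circuit n m → Prop
  | tof1 : Identity ((ket1 ⊠ id 2) ⨾ tof) (ket1 ⊠ cnot)
  | tof1' : Identity (tof ⨾ (bra1 ⊠ id 2)) (bra1 ⊠ cnot)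
  | tof2 : Identity ((ket0 ⊠ id 2) ⨾ tof) (ket0 ⊠ id 2)
  | tof2' : Identity (tof ⨾ (bra0 ⊠ id 2)) (bra0 ⊠ id 2)
  | tof3 : Identity ((tof ⊠ id 2) ⨾ (id 2 ⊠ tofFlip)) ((id 2 ⊠ tofFlip) ⨾ (tof ⊠ id 2))
  | tof4 : Identity ((tofFlip ⊠ id 2) ⨾ (id 2 ⊠ tof)) ((id 2 ⊠ tof) ⨾ (tofFlip ⊠ id 2))
  | tof5 : Identity ((tofFlip ⊠ id 1) ⨾ (id 1 ⊠ tof)) ((id 1 ⊠ tof) ⨾ (tofFlip ⊠ id 1))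
  | tof6 : Identity (tof134 ⨾ (id 1 ⊠ tof)) ((id 1 ⊠ tof) ⨾ tof134)
  | tof7 : Identity
      (((id 2 ⊠ ket1) ⨾ cnot13 ⨾ (id 2 ⊠ bra0)) ⨾
        ((id 2 ⊠ ket1) ⨾ (id 1 ⊠ cnot) ⨾ (id 2 ⊠ bra0)))
      ((id 2 ⊠ ket1) ⨾ tof ⨾ (id 2 ⊠ bra0))
  | tof8 : Identity ((ket1 ⨾ bra0) ⊠ id 1) ((ket1 ⨾ bra0) ⊠ (bra1 ⨾ ket1))
  | tof9 : Identity (ket1 ⨾ bra1) (id 0)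
  | tof10 : Identity (tof ⨾ tof) (id 3)
  | tof11 : Identity ((id 1 ⊠ tof) ⨾ (tof ⊠ id 1) ⨾ (id 1 ⊠ tof)) (tof124 ⨾ (tof ⊠ id 1))
  | tof12 : Identity ((cnot ⊠ id 2) ⨾ (id 1 ⊠ tof) ⨾ (cnot ⊠ id 2)) (tof134 ⨾ (id 1 ⊠ tof))
  | tof13 : Identity ((tof ⊠ id 1) ⨾ (id 1 ⊠ tof) ⨾ (tof ⊠ id 1)) (tof124 ⨾ (id 1 ⊠ tof))
  | tof14 : Identity ((tof ⊠ id 1) ⨾ (id 2 ⊠ cnot) ⨾ (tof ⊠ id 1)) (tof124 ⨾ (id 2 ⊠ cnot))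
  | tof15 : Identity (cnot ⨾ cnotFlip ⨾ cnot) (swap 1 1)
  | tof16 : Identity tof ((swap 1 1 ⊠ id 1) ⨾ tof ⨾ (swap 1 1 ⊠ id 1))
  | tof17 : Identity cnot3 ((id 1 ⊠ swap 1 1 ⊠ id 1) ⨾ cnot3 ⨾ (id 1 ⊠ swap 1 1 ⊠ id 1))

/-- The congruence on circuits generated by the laws of strict symmetric monoidal categories
and by the defining identities of `TOF`. -/
inductive Equiv : {n m : ℕ} → Circuit n m → Circuit n m → Prop
  -- congruence
  | refl {a b : ℕ} (f : Circuit a b) : Equiv f f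
  | symm {a b : ℕ} {f g : Circuit a b} : Equiv f g → Equiv g f
  | trans {a b : ℕ} {f g h : Circuit a b} : Equiv f g → Equiv g h → Equiv f h
  | comp_congr {a b c : ℕ} {f f' : Circuit a b} {g g' : Circuit b c} :
      Equiv f f' → Equiv g g' → Equiv (f ⨾ g) (f' ⨾ g')
  | tensor_congr {a b c d : ℕ} {f f' : Circuit a b} {g g' : Circuit c d} :
      Equiv f f' → Equiv g g' → Equiv (f ⊠ g) (f' ⊠ g')
  -- category
  | id_comp {a b : ℕ} (f : Circuit a b) : Equiv (id a ⨾ f) f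
  | comp_id {a b : ℕ} (f : Circuit a b) : Equiv (f ⨾ id b) f
  | assoc {a b c d : ℕ} (f : Circuit a b) (g : Circuit b c) (h : Circuit c d) :
      Equiv ((f ⨾ g) ⨾ h) (f ⨾ (g ⨾ h))
  -- the tensor is a functor
  | id_tensor (a b : ℕ) : Equiv (id a ⊠ id b) (id (a + b))
  | interchange {a b c a' b' c' : ℕ} (f : Circuit a b) (g : Circuit b c)
      (f' : Circuit a' b') (g' : Circuit b' c') :
      Equiv ((f ⨾ g) ⊠ (f' ⨾ g')) ((f ⊠ f') ⨾ (g ⊠ g'))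
  -- the tensor is strictly associative and unital
  | tensor_assoc {a b c a' b' c' : ℕ} (f : Circuit a a') (g : Circuit b b') (h : Circuit c c') :
      Equiv (cast (Nat.add_assoc a b c) (Nat.add_assoc a' b' c') (f ⊠ g ⊠ h)) (f ⊠ (g ⊠ h))
  | unit_tensor {a b : ℕ} (f : Circuit a b) :
      Equiv (cast (Nat.zero_add a) (Nat.zero_add b) (id 0 ⊠ f)) f
  | tensor_unit {a b : ℕ} (f : Circuit a b) :
      Equiv (cast (Nat.add_zero a) (Nat.add_zero b) (f ⊠ id 0)) f
  -- symmetry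
  | swap_natural {a b c d : ℕ} (f : Circuit a b) (g : Circuit c d) :
      Equiv ((f ⊠ g) ⨾ swap b d) (swap a c ⨾ (g ⊠ f))
  | swap_swap (a b : ℕ) : Equiv (swap a b ⨾ swap b a) (id (a + b))
  | hexagon (a b c : ℕ) :
      Equiv (swap a (b + c))
        (cast (Nat.add_assoc a b c) (Nat.add_assoc b c a).symm
          ((swap a b ⊠ id c) ⨾
            cast (Nat.add_assoc b a c).symm rfl (id b ⊠ swap a c)))
  -- the identities of `TOF`
  | identity {a b : ℕ} {f g : Circuit a b} : Identity f g → Equiv f g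

/-- The horizontal flip of a circuit. -/
def dagger : {n m : ℕ} → Circuit n m → Circuit m n
  | _, _, id n => id n
  | _, _, comp f g => g.dagger ⨾ f.dagger
  | _, _, tensor f g => f.dagger ⊠ g.dagger
  | _, _, swap a b => swap b a
  | _, _, ket1 => bra1
  | _, _, bra1 => ket1
  | _, _, tof => tof

/-! ### Evaluation on bit strings

This evaluation is only used to prove that the functor `H₀` below is well defined. -/

/-- Evaluation of a circuit on a bit string (of the right length); `none` means undefined. -/
def eval : {n m : ℕ} → Circuit n m → List Bool → Option (List Bool)
  | _, _, id _, l => some l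
  | _, _, comp f g, l => (f.eval l).bind g.eval
  | _, _, @tensor a _ _ _ f g, l =>
      (f.eval (l.take a)).bind fun x => (g.eval (l.drop a)).map fun y => x ++ y
  | _, _, swap a _, l => some (l.drop a ++ l.take a)
  | _, _, ket1, _ => some [true]
  | _, _, bra1, l => if l = [true] then some [] else none
  | _, _, tof, [x, y, z] => some [x, y, xor z (x && y)]
  | _, _, tof, _ => none

theorem eval_length {n m : ℕ} (f : Circuit n m) : ∀ {l k : List Bool}, l.length = n →
    f.eval l = some k → k.length = m := by
  induction f with
  | id n => intro l k h e; simp [eval] at e; subst e; exact h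
  | comp f g ihf ihg =>
    intro l k h e
    simp only [eval, Option.bind_eq_some_iff] at e
    obtain ⟨x, hx, hk⟩ := e
    exact ihg (ihf h hx) hk
  | tensor f g ihf ihg =>
    intro l k h e
    simp only [eval, Option.bind_eq_some_iff, Option.map_eq_some_iff] at e
    obtain ⟨x, hx, y, hy, rfl⟩ := e
    rw [List.length_append, ihf (by simp [h]) hx, ihg (by simp [h]) hy]
  | swap a b => intro l k h e; simp [eval] at e; subst e; simp [h]
  | ket1 => intro l k h e; simp [eval] at e; subst e; rfl
  | bra1 => intro l k h e; simp [eval] at e; obtain ⟨_, rfl⟩ := e; rfl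
  | tof =>
    intro l k h e
    match l, h with
    | [x, y, z], _ => simp [eval] at e; subst e; rfl

theorem eval_cast {a b a' b' : ℕ} (ha : a = a') (hb : b = b') (f : Circuit a b) (l : List Bool) :
    (cast ha hb f).eval l = f.eval l := by
  subst ha hb; rfl

theorem eval_append {a b c d : ℕ} (f : Circuit a b) (g : Circuit c d) {l k : List Bool}
    (h : l.length = a) :
    (f ⊠ g).eval (l ++ k) = (f.eval l).bind fun x => (g.eval k).map fun y => x ++ y := by
  simp [eval, ← h]

theorem eval_dagger {n m : ℕ} (f : Circuit n m) : ∀ {l k : List Bool}, l.length = n →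
    f.eval l = some k → f.dagger.eval k = some l := by
  induction f with
  | id n => intro l k h e; simp [eval] at e; subst e; rfl
  | comp f g ihf ihg =>
    intro l k h e
    simp only [eval, Option.bind_eq_some_iff] at e
    obtain ⟨x, hx, hk⟩ := e
    simp [dagger, eval, ihg (eval_length f h hx) hk, ihf h hx]
  | tensor f g ihf ihg =>
    intro l k h e
    simp only [eval, Option.bind_eq_some_iff, Option.map_eq_some_iff] at e
    obtain ⟨x, hx, y, hy, rfl⟩ := e
    rw [dagger, eval_append _ _ (eval_length f (by simp [h]) hx), ihf (by simp [h]) hx,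
      ihg (by simp [h]) hy]
    simp
  | swap a b =>
    intro l k h e; simp [eval] at e; subst e
    have : b = (l.drop a).length := by simp [h]
    simp only [dagger, eval, Option.some.injEq]
    have hd : (l.drop a ++ l.take a).drop b = l.take a := List.drop_left' this.symm
    have ht : (l.drop a ++ l.take a).take b = l.drop a := List.take_left' this.symm
    rw [hd, ht, List.take_append_drop]
  | ket1 =>
    intro l k h e; simp [eval] at e; subst e
    simp [List.length_eq_zero_iff] at h; subst h; rfl
  | bra1 => intro l k h e; simp [eval] at e; obtain ⟨rfl, rfl⟩ := e; rfl
  | tof =>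
    intro l k h e
    match l, h with
    | [x, y, z], _ => simp [eval] at e; subst e; simp [dagger, eval]

theorem forall_length_four {P : List Bool → Prop} (h : ∀ x y z w, P [x, y, z, w]) :
    ∀ l : List Bool, l.length = 4 → P l
  | [x, y, z, w], _ => h x y z w

theorem forall_length_five {P : List Bool → Prop} (h : ∀ x y z w v, P [x, y, z, w, v]) :
    ∀ l : List Bool, l.length = 5 → P l
  | [x, y, z, w, v], _ => h x y z w v

theorem eval_identity {n m : ℕ} {f g : Circuit n m} (h : Identity f g) :
    ∀ {l : List Bool}, l.length = n → f.eval l = g.eval l := by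
  cases h <;> intro l hl
  all_goals
    first
    | (obtain rfl := List.length_eq_zero_iff.1 hl; decide)
    | (obtain ⟨x, rfl⟩ := List.length_eq_one_iff.1 hl; revert x; decide)
    | (obtain ⟨x, y, rfl⟩ := List.length_eq_two.1 hl; revert x y; decide)
    | (obtain ⟨x, y, z, rfl⟩ := List.length_eq_three.1 hl; revert x y z; decide)
    | (refine forall_length_four (P := fun l => eval _ l = eval _ l) ?_ l hl; decide)
    | (refine forall_length_five (P := fun l => eval _ l = eval _ l) ?_ l hl; decide)

theorem eval_equiv {n m : ℕ} {f g : Circuit n m} (h : Equiv f g) :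
    ∀ {l : List Bool}, l.length = n → f.eval l = g.eval l := by
  induction h with
  | refl => intros; rfl
  | symm _ ih => intro l hl; exact (ih hl).symm
  | trans _ _ ih ih' => intro l hl; exact (ih hl).trans (ih' hl)
  | @comp_congr a b c f f' g g' _ _ ih ih' =>
    intro l hl
    simp only [eval, ← ih hl]
    cases e : f.eval l with
    | none => rfl
    | some x => exact ih' (eval_length _ hl e)
  | tensor_congr _ _ ih ih' =>
    intro l hl
    simp only [eval]
    rw [ih (by simp [hl]), ih' (by simp [hl])]
  | id_comp => intros; rfl
  | comp_id => intros; simp [eval]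
  | assoc => intros; simp [eval, Option.bind_assoc]
  | id_tensor => intros; simp [eval]
  | interchange f g f' g' =>
    intro l hl
    simp only [eval]
    cases e : f.eval (l.take _) with
    | none => rfl
    | some x =>
      have hx := eval_length _ (by simp [hl]) e
      cases e' : f'.eval (l.drop _) with
      | none => simp
      | some y => simp [← hx]
  | tensor_assoc f g h =>
    intro l hl
    rw [eval_cast]
    simp only [eval, List.take_take, List.drop_take, List.drop_drop]
    simp [Option.bind_assoc, Option.map_eq_bind]
  | unit_tensor f =>
    intro l hl
    rw [eval_cast]
    simp [eval]
  | tensor_unit f =>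
    intro l hl
    rw [eval_cast]
    simp [eval, ← hl]
  | swap_natural f g =>
    intro l hl
    simp only [eval]
    rename_i a b c d
    have hd : (l.drop a).length = c := by simp [hl]
    simp only [Option.bind_some]
    rw [List.take_left' hd, List.drop_left' hd]
    cases e : f.eval (l.take a) with
    | none => cases g.eval (l.drop a) <;> simp
    | some x =>
      have hx := eval_length _ (by simp [hl]) e
      cases e' : g.eval (l.drop a) with
      | none => simp
      | some y => simp [← hx]
  | swap_swap a b => intro l hl; simp [eval, hl]
  | hexagon a b c =>
    intro l hl
    rw [eval_cast]
    simp only [eval, eval_cast, Option.bind_some, Option.map_some]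
    have hb : ((l.take (a + b)).drop a).length = b := by simp [hl]
    have hab : ((l.take (a + b)).drop a ++ (l.take (a + b)).take a).length = b + a := by
      simp [hl]
    simp only [List.append_assoc]
    rw [List.take_left' hb, List.drop_left' hb]
    have ha : ((l.take (a + b)).take a).length = a := by simp [hl]
    rw [List.take_left' ha, List.drop_left' ha]
    simp [List.take_take, List.drop_take, ← List.append_assoc]
  | identity h => intro l hl; exact eval_identity h hl

end Circuit
/-! ### Morphisms: circuits modulo the identities -/

namespace Circuit

instance setoid (n m : ℕ) : Setoid (Circuit n m) :=
  ⟨Equiv, Equiv.refl, Equiv.symm, Equiv.trans⟩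

/-- Circuits with `n` inputs and `m` outputs modulo the identities. -/
def Mor (n m : ℕ) : Type := Quotient (setoid n m)

namespace Mor

def mk {n m : ℕ} (f : Circuit n m) : Mor n m := Quotient.mk _ f

theorem mk_eq {n m : ℕ} {f g : Circuit n m} : mk f = mk g ↔ Equiv f g :=
  ⟨Quotient.exact, fun h => Quotient.sound h⟩

def comp {a b c : ℕ} : Mor a b → Mor b c → Mor a c :=
  Quotient.map₂ Circuit.comp fun _ _ h _ _ h' => Equiv.comp_congr h h'

def tensor {a b c d : ℕ} : Mor a b → Mor c d → Mor (a + c) (b + d) :=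
  Quotient.map₂ Circuit.tensor fun _ _ h _ _ h' => Equiv.tensor_congr h h'

def cast {a b a' b' : ℕ} (ha : a = a') (hb : b = b') (f : Mor a b) : Mor a' b' :=
  ha ▸ hb ▸ f

infixr:60 " ∘> " => Mor.comp

notation:70 f:70 " ⊗> " g:71 => (Mor.tensor f g :)

theorem mk_comp {a b c : ℕ} (f : Circuit a b) (g : Circuit b c) : mk (f ⨾ g) = mk f ∘> mk g := rfl

theorem mk_tensor {a b c d : ℕ} (f : Circuit a b) (g : Circuit c d) :
    mk (f ⊠ g) = mk f ⊗> mk g := rfl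

theorem mk_cast {a b a' b' : ℕ} (ha : a = a') (hb : b = b') (f : Circuit a b) :
    mk (f.cast ha hb) = (mk f).cast ha hb := by
  subst ha hb; rfl

/-- The identity on `n` wires. -/
abbrev one (n : ℕ) : Mor n n := mk (id n)

/-! The following equations, up to the definition of `dagger`, serve to prove that the horizontal
flip is well defined on morphisms, and that the total points are the kets. -/

theorem one_comp {a b : ℕ} (f : Mor a b) : one a ∘> f = f :=
  Quotient.inductionOn f fun f => mk_eq.2 (Equiv.id_comp f)

theorem comp_one {a b : ℕ} (f : Mor a b) : f ∘> one b = f :=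
  Quotient.inductionOn f fun f => mk_eq.2 (Equiv.comp_id f)

theorem assoc {a b c d : ℕ} (f : Mor a b) (g : Mor b c) (h : Mor c d) :
    (f ∘> g) ∘> h = f ∘> g ∘> h :=
  Quotient.inductionOn₃ f g h fun f g h => mk_eq.2 (Equiv.assoc f g h)

theorem one_tensor (a b : ℕ) : one a ⊗> one b = one (a + b) := mk_eq.2 (Equiv.id_tensor a b)

theorem tensor_comp {a b c a' b' c' : ℕ} (f : Mor a b) (g : Mor b c) (f' : Mor a' b')
    (g' : Mor b' c') : (f ⊗> f') ∘> (g ⊗> g') = (f ∘> g) ⊗> (f' ∘> g') := by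
  revert f' g'
  refine Quotient.inductionOn₂ f g fun f g f' g' => ?_
  exact Quotient.inductionOn₂ f' g' fun f' g' => mk_eq.2 (Equiv.symm (Equiv.interchange f g f' g'))

theorem tensor_assoc {a b c a' b' c' : ℕ} (f : Mor a a') (g : Mor b b') (h : Mor c c') :
    cast (Nat.add_assoc a b c) (Nat.add_assoc a' b' c') (f ⊗> g ⊗> h) = f ⊗> (g ⊗> h) :=
  Quotient.inductionOn₃ f g h fun f g h =>
    (mk_cast _ _ _).symm.trans (mk_eq.2 (Equiv.tensor_assoc f g h))

theorem unit_tensor {a b : ℕ} (f : Mor a b) :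
    cast (Nat.zero_add a) (Nat.zero_add b) (one 0 ⊗> f) = f :=
  Quotient.inductionOn f fun f => (mk_cast _ _ _).symm.trans (mk_eq.2 (Equiv.unit_tensor f))

theorem tensor_unit {a b : ℕ} (f : Mor a b) : f ⊗> one 0 = f :=
  Quotient.inductionOn f fun f => mk_eq.2 (Equiv.tensor_unit f)

theorem swap_natural {a b c d : ℕ} (f : Mor a b) (g : Mor c d) :
    (f ⊗> g) ∘> mk (swap b d) = mk (swap a c) ∘> (g ⊗> f) :=
  Quotient.inductionOn₂ f g fun f g => mk_eq.2 (Equiv.swap_natural f g)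

theorem swap_swap (a b : ℕ) : mk (swap a b) ∘> mk (swap b a) = one (a + b) :=
  mk_eq.2 (Equiv.swap_swap a b)

theorem identity {a b : ℕ} {f g : Circuit a b} (h : Identity f g) : mk f = mk g :=
  mk_eq.2 (Equiv.identity h)

abbrev K : Mor 0 1 := mk ket1
abbrev B : Mor 1 0 := mk bra1
abbrev T : Mor 3 3 := mk tof
abbrev C : Mor 2 2 := mk cnot
abbrev N : Mor 1 1 := mk not
abbrev S : Mor 2 2 := mk (swap 1 1)

theorem K_B : K ∘> B = one 0 := identity .tof9
theorem T_T : T ∘> T = one 3 := identity .tof10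
theorem K_T : (K ⊗> one 2) ∘> T = K ⊗> C := identity .tof1
theorem T_B : T ∘> (B ⊗> one 2) = B ⊗> C := identity .tof1'
theorem C_def : C = (K ⊗> one 2) ∘> T ∘> (B ⊗> one 2) := rfl
theorem N_def : N = (K ⊗> one 1) ∘> C ∘> (B ⊗> one 1) := rfl


theorem T_swap : T = (S ⊗> one 1) ∘> T ∘> (S ⊗> one 1) := identity .tof16


theorem eq_one_of_idem {a : ℕ} {f g : Mor a a} (h : g ∘> f = one a) (h' : f = f ∘> f) :
    f = one a := by
  have h2 : g ∘> f = g ∘> f ∘> f := congrArg (fun x => g ∘> x) h'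
  rw [← assoc, h, one_comp] at h2
  exact h2.symm

theorem swap_zero_zero : mk (swap 0 0) = one 0 := by
  refine eq_one_of_idem (swap_swap 0 0) ?_
  have h : mk (swap 0 0) = (mk (swap 0 0) ⊗> one 0) ∘> (one 0 ⊗> mk (swap 0 0)) :=
    mk_eq.2 (Equiv.hexagon 0 0 0)
  have h' : one 0 ⊗> mk (swap 0 0) = mk (swap 0 0) := @unit_tensor 0 0 (mk (swap 0 0))
  rw [h', tensor_unit] at h
  exact h

theorem swap_one_zero : mk (swap 1 0) = one 1 := by
  refine @eq_one_of_idem 1 (mk (swap 1 0)) (mk (swap 0 1)) (swap_swap 0 1) ?_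
  have h : mk (swap 1 0) = (mk (swap 1 0) ⊗> one 0) ∘> (one 0 ⊗> mk (swap 1 0)) :=
    mk_eq.2 (Equiv.hexagon 1 0 0)
  have h' : one 0 ⊗> mk (swap 1 0) = mk (swap 1 0) := @unit_tensor 1 1 (mk (swap 1 0))
  rw [h', tensor_unit] at h
  exact h

theorem swap_zero_one : mk (swap 0 1) = one 1 := by
  have h : mk (swap 0 1) ∘> mk (swap 1 0) = one 1 := swap_swap 0 1
  rw [swap_one_zero] at h
  exact (comp_one _).symm.trans h

theorem slide {a b c d : ℕ} (f : Mor a b) (g : Mor c d) :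
    (f ⊗> one c) ∘> (one b ⊗> g) = f ⊗> g := by
  rw [tensor_comp, comp_one, one_comp]

theorem slide' {a b c d : ℕ} (f : Mor a b) (g : Mor c d) :
    (one a ⊗> g) ∘> (f ⊗> one d) = f ⊗> g := by
  rw [tensor_comp, comp_one, one_comp]

theorem unit22 (f : Mor 2 2) : one 0 ⊗> f = f := unit_tensor f
theorem unit21 (f : Mor 2 1) : one 0 ⊗> f = f := unit_tensor f
theorem unit12 (f : Mor 1 2) : one 0 ⊗> f = f := unit_tensor f
theorem unit11 (f : Mor 1 1) : one 0 ⊗> f = f := unit_tensor f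
theorem unit00 (f : Mor 0 0) : one 0 ⊗> f = f := unit_tensor f
theorem unit01 (f : Mor 0 1) : one 0 ⊗> f = f := unit_tensor f
theorem unit10 (f : Mor 1 0) : one 0 ⊗> f = f := unit_tensor f

theorem effect22 (b : Mor 1 0) (f : Mor 2 2) : (b ⊗> one 2) ∘> f = b ⊗> f := by
  have h := slide b f
  rwa [unit22] at h

theorem effect21 (b : Mor 1 0) (f : Mor 2 1) : (b ⊗> one 2) ∘> f = b ⊗> f := by
  have h := slide b f
  rwa [unit21] at h

theorem effect11 (b : Mor 1 0) (f : Mor 1 1) : (b ⊗> one 1) ∘> f = b ⊗> f := by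
  have h := slide b f
  rwa [unit11] at h

theorem state12 (k : Mor 0 1) (f : Mor 1 2) : f ∘> (k ⊗> one 2) = k ⊗> f := by
  have h := slide' k f
  rwa [unit12] at h

theorem state22 (k : Mor 0 1) (f : Mor 2 2) : f ∘> (k ⊗> one 2) = k ⊗> f := by
  have h := slide' k f
  rwa [unit22] at h

theorem state11 (k : Mor 0 1) (f : Mor 1 1) : f ∘> (k ⊗> one 1) = k ⊗> f := by
  have h := slide' k f
  rwa [unit11] at h

theorem C_C : C ∘> C = one 2 := by
  calc C ∘> C = (K ⊗> one 2) ∘> (T ∘> (B ⊗> one 2)) ∘> C := by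
        conv_lhs => arg 1; rw [C_def]
        rw [assoc]
    _ = (K ⊗> one 2) ∘> T ∘> T ∘> (B ⊗> one 2) := by rw [assoc, effect22, T_B]
    _ = (K ⊗> one 2) ∘> (B ⊗> one 2) := by rw [← assoc T, T_T, one_comp]
    _ = one 2 := by rw [tensor_comp, K_B, one_comp, one_tensor]


theorem S_S : S ∘> S = one 2 := swap_swap 1 1

/-- Sliding past a state on the first of two wires. -/
theorem state_S (k : Mor 0 1) : (k ⊗> one 1) ∘> S = one 1 ⊗> k := by
  have h := swap_natural k (one 1)
  rw [swap_zero_one] at h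
  exact h.trans (one_comp _)

theorem state_S' (k : Mor 0 1) : (one 1 ⊗> k) ∘> S = k ⊗> one 1 := by
  have h := swap_natural (one 1) k
  rw [swap_one_zero] at h
  exact h.trans (one_comp _)

theorem S_effect (b : Mor 1 0) : S ∘> (b ⊗> one 1) = one 1 ⊗> b := by
  have h := swap_natural (one 1) b
  rw [swap_one_zero] at h
  exact h.symm.trans (comp_one _)

theorem S_effect' (b : Mor 1 0) : S ∘> (one 1 ⊗> b) = b ⊗> one 1 := by
  have h := swap_natural b (one 1)
  rw [swap_zero_one] at h
  exact h.symm.trans (comp_one _)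


theorem S1_effect (b : Mor 1 0) : (S ⊗> one 1) ∘> (b ⊗> one 2) = one 1 ⊗> (b ⊗> one 1) := by
  have h : b ⊗> one 2 = (b ⊗> one 1) ⊗> one 1 := by
    rw [← one_tensor 1 1]; exact (tensor_assoc b (one 1) (one 1)).symm
  have h' : (one 1 ⊗> b) ⊗> one 1 = one 1 ⊗> (b ⊗> one 1) := tensor_assoc (one 1) b (one 1)
  have := tensor_comp S (b ⊗> one 1) (one 1) (one 1)
  rw [S_effect, one_comp, h'] at this
  rw [h]
  exact this

theorem S1_effect' (b : Mor 1 0) : (S ⊗> one 1) ∘> (one 1 ⊗> (b ⊗> one 1)) = b ⊗> one 2 := by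
  rw [← S1_effect, ← assoc, tensor_comp, S_S, one_comp, one_tensor]
  exact one_comp _

theorem state_S1 (k : Mor 0 1) : (k ⊗> one 2) ∘> (S ⊗> one 1) = one 1 ⊗> (k ⊗> one 1) := by
  have h : k ⊗> one 2 = (k ⊗> one 1) ⊗> one 1 := by
    rw [← one_tensor 1 1]; exact (tensor_assoc k (one 1) (one 1)).symm
  have h' : (one 1 ⊗> k) ⊗> one 1 = one 1 ⊗> (k ⊗> one 1) := tensor_assoc (one 1) k (one 1)
  have := tensor_comp (k ⊗> one 1) S (one 1) (one 1)
  rw [state_S, one_comp, h'] at this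
  rw [h]
  exact this

theorem state_S1' (k : Mor 0 1) : (one 1 ⊗> (k ⊗> one 1)) ∘> (S ⊗> one 1) = k ⊗> one 2 := by
  rw [← state_S1, assoc, tensor_comp, S_S, one_comp, one_tensor]
  exact comp_one _

/-- Two effects on the first two wires commute with the swap. -/
theorem S1_BB (b : Mor 1 0) : (S ⊗> one 1) ∘> (b ⊗> (b ⊗> one 1)) = b ⊗> (b ⊗> one 1) := by
  have e : b ⊗> (b ⊗> one 1) = (b ⊗> one 2) ∘> (b ⊗> one 1) := (effect21 b _).symm
  have e' : b ⊗> (b ⊗> one 1) = (one 1 ⊗> (b ⊗> one 1)) ∘> (b ⊗> one 1) := by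
    have h := slide' b (b ⊗> one 1)
    exact h.symm
  conv_lhs => rw [e]
  rw [e', ← assoc, S1_effect]

theorem KK_S1 (k : Mor 0 1) : (k ⊗> (k ⊗> one 1)) ∘> (S ⊗> one 1) = k ⊗> (k ⊗> one 1) := by
  have e : k ⊗> (k ⊗> one 1) = (k ⊗> one 1) ∘> (k ⊗> one 2) := (state12 k _).symm
  have e' : k ⊗> (k ⊗> one 1) = (k ⊗> one 1) ∘> (one 1 ⊗> (k ⊗> one 1)) := by
    have h := slide k (k ⊗> one 1)
    exact h.symm
  conv_lhs => rw [e]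
  rw [e', assoc, state_S1]

theorem S1_S1 : (S ⊗> one 1) ∘> (S ⊗> one 1) = one 3 := by
  rw [tensor_comp, S_S, one_comp, one_tensor]

theorem S1_T : (S ⊗> one 1) ∘> T = T ∘> (S ⊗> one 1) := by
  conv_lhs => rw [T_swap, ← assoc, S1_S1]
  exact one_comp _

theorem C_B : C ∘> (B ⊗> one 1) = B ⊗> N := by
  have h1 : T ∘> (B ⊗> (B ⊗> one 1)) = B ⊗> (C ∘> (B ⊗> one 1)) := by
    rw [← effect21 B (B ⊗> one 1), ← assoc, T_B, ← effect22 B C, assoc]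
    exact effect21 B _
  have h2 : (S ⊗> one 1) ∘> (B ⊗> (C ∘> (B ⊗> one 1))) = B ⊗> (C ∘> (B ⊗> one 1)) := by
    rw [← h1]
    rw [← assoc, S1_T, assoc, S1_BB]
  have h3 := congrArg (fun x => (one 1 ⊗> (K ⊗> one 1)) ∘> x) h2
  simp only [← assoc, state_S1'] at h3
  have h5 : (one 1 ⊗> (K ⊗> one 1)) ∘> (B ⊗> (C ∘> (B ⊗> one 1))) = B ⊗> N := by
    rw [tensor_comp, one_comp]; rfl
  rw [h5] at h3
  have h4 : (K ⊗> one 2) ∘> (B ⊗> (C ∘> (B ⊗> one 1))) = C ∘> (B ⊗> one 1) := by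
    rw [tensor_comp, K_B]
    exact (unit21 _).trans (one_comp _)
  rw [h4] at h3
  exact h3

theorem K_C : (K ⊗> one 1) ∘> C = K ⊗> N := by
  have h1 : (K ⊗> (K ⊗> one 1)) ∘> T = K ⊗> ((K ⊗> one 1) ∘> C) := by
    rw [← state12 K (K ⊗> one 1), assoc, K_T, ← state22 K C, ← assoc]
    exact state12 K _
  have h2 : (K ⊗> ((K ⊗> one 1) ∘> C)) ∘> (S ⊗> one 1) = K ⊗> ((K ⊗> one 1) ∘> C) := by
    rw [← h1]
    rw [assoc, ← S1_T, ← assoc, KK_S1]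
  have h3 := congrArg (fun x => x ∘> (one 1 ⊗> (B ⊗> one 1))) h2
  simp only [assoc, S1_effect'] at h3
  have h5 : (K ⊗> ((K ⊗> one 1) ∘> C)) ∘> (one 1 ⊗> (B ⊗> one 1)) = K ⊗> N := by
    rw [tensor_comp, comp_one, assoc]; rfl
  rw [h5] at h3
  have h4 : (K ⊗> ((K ⊗> one 1) ∘> C)) ∘> (B ⊗> one 2) = (K ⊗> one 1) ∘> C := by
    rw [tensor_comp, K_B]
    exact (unit12 _).trans (comp_one _)
  rw [h4] at h3
  exact h3

theorem N_N : N ∘> N = one 1 := by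
  calc N ∘> N = (K ⊗> one 1) ∘> (C ∘> (B ⊗> one 1)) ∘> N := by
        conv_lhs => arg 1; rw [N_def]
        rw [assoc]
    _ = (K ⊗> one 1) ∘> C ∘> C ∘> (B ⊗> one 1) := by rw [assoc, effect11, C_B]
    _ = (K ⊗> one 1) ∘> (B ⊗> one 1) := by rw [← assoc C, C_C, one_comp]
    _ = one 1 := by rw [tensor_comp, K_B, one_comp, one_tensor]

abbrev K' : Mor 0 1 := mk ket0
abbrev B' : Mor 1 0 := mk bra0

theorem K'_def : K' = K ∘> N := rfl
theorem B'_def : B' = N ∘> B := rfl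
theorem K_N : K ∘> N = K' := rfl
theorem K'_N : K' ∘> N = K := by rw [K'_def, assoc, N_N, comp_one]
theorem K'_B' : K' ∘> B' = one 0 := by rw [B'_def, ← assoc, K'_N, K_B]
theorem K'_B : K' ∘> B = K ∘> B' := by rw [K'_def, B'_def, assoc]

theorem K'_T : (K' ⊗> one 2) ∘> T = K' ⊗> one 2 := identity .tof2

theorem K'_C : (K' ⊗> one 1) ∘> C = K' ⊗> one 1 := by
  have h : (K' ⊗> one 1) ∘> (K ⊗> one 2) = (K ⊗> one 1) ∘> (one 1 ⊗> (K' ⊗> one 1)) := by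
    rw [state12, slide K (K' ⊗> one 1)]
  calc (K' ⊗> one 1) ∘> C = ((K' ⊗> one 1) ∘> (K ⊗> one 2)) ∘> T ∘> (B ⊗> one 2) := by
        rw [C_def, assoc]
    _ = (K ⊗> one 1) ∘> (((one 1 ⊗> (K' ⊗> one 1)) ∘> (S ⊗> one 1)) ∘> T) ∘> (S ⊗> one 1) ∘>
          (B ⊗> one 2) := by
        rw [h, assoc, assoc, assoc]; conv_lhs => rw [T_swap]
        simp only [assoc]
    _ = (K ⊗> one 1) ∘> ((K' ⊗> one 2) ∘> (S ⊗> one 1)) ∘> (B ⊗> one 2) := by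
        rw [state_S1', K'_T, assoc]
    _ = ((K ⊗> one 1) ∘> (one 1 ⊗> (K' ⊗> one 1))) ∘> (B ⊗> one 2) := by
        rw [state_S1, assoc]
    _ = K' ⊗> one 1 := by
        rw [slide K (K' ⊗> one 1)]
        refine (tensor_comp K B (K' ⊗> one 1) (one 2)).trans ?_
        rw [K_B]
        exact (unit12 _).trans (comp_one _)

/-! ### Negations commute with the targets of Toffoli gates -/

theorem unit33 (f : Mor 3 3) : one 0 ⊗> f = f := unit_tensor f
theorem unit34 (f : Mor 3 4) : one 0 ⊗> f = f := unit_tensor f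

theorem state33 (k : Mor 0 1) (f : Mor 3 3) : f ∘> (k ⊗> one 3) = k ⊗> f := by
  have h := slide' k f
  rwa [unit33] at h

theorem state34 (k : Mor 0 1) (f : Mor 3 4) : f ∘> (k ⊗> one 4) = k ⊗> f := by
  have h := slide' k f
  rwa [unit34] at h

theorem KK_T : (K ⊗> (K ⊗> one 1)) ∘> T = K ⊗> (K ⊗> N) := by
  rw [← state12 K (K ⊗> one 1), assoc, K_T, ← state22 K C, ← assoc, K_C]
  exact state12 K _

theorem N_KK : N ∘> (K ⊗> (K ⊗> one 1)) = K ⊗> (K ⊗> N) := by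
  rw [← state12 K (K ⊗> one 1), ← assoc]
  conv_lhs => arg 1; rw [state11]
  exact state12 K _

abbrev F : Mor 3 3 := mk tofFlip
abbrev R : Mor 3 3 := mk rev3

/-- Two auxiliary wires in state `1` above three wires. -/
abbrev P : Mor 3 5 := K ⊗> (K ⊗> one 1) ⊗> one 2

theorem P_eq : P = K ⊗> (K ⊗> one 3) := by
  have h1 : (K ⊗> (K ⊗> one 1)) ⊗> one 2 = K ⊗> ((K ⊗> one 1) ⊗> one 2) :=
    tensor_assoc K (K ⊗> one 1) (one 2)
  have h2 : (K ⊗> one 1) ⊗> one 2 = K ⊗> (one 1 ⊗> one 2) := tensor_assoc K (one 1) (one 2)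
  rw [h2, one_tensor] at h1
  exact h1

theorem P_F : P ∘> (one 2 ⊗> F) = F ∘> P := by
  have h : one 2 ⊗> F = one 1 ⊗> (one 1 ⊗> F) := by
    rw [← one_tensor 1 1]; exact tensor_assoc (one 1) (one 1) F
  have h2 : P = (K ⊗> one 3) ∘> (K ⊗> one 4) := by rw [P_eq]; exact (state34 K _).symm
  have h3 : F ∘> P = K ⊗> (K ⊗> F) := by
    rw [h2, ← assoc]
    conv_lhs => arg 1; rw [state33]
    exact state34 K _
  rw [h3, P_eq, h]
  rw [tensor_comp, comp_one]
  have h4 : (K ⊗> one 3) ∘> (one 1 ⊗> F) = K ⊗> F := by rw [tensor_comp, comp_one, one_comp]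
  exact congrArg (fun x => K ⊗> x) h4

theorem P_T : P ∘> (T ⊗> one 2) = (N ⊗> one 2) ∘> P := by
  rw [tensor_comp, tensor_comp, KK_T]
  conv_rhs => rw [N_KK]

theorem P_cancel : P ∘> ((B ⊗> (B ⊗> one 1)) ⊗> one 2) = one 3 := by
  have h : (K ⊗> (K ⊗> one 1)) ∘> (B ⊗> (B ⊗> one 1)) = one 1 := by
    rw [tensor_comp, tensor_comp, K_B, one_comp, one_tensor, one_tensor]
  rw [tensor_comp, h, one_comp, one_tensor]

theorem N_F : (N ⊗> one 2) ∘> F = F ∘> (N ⊗> one 2) := by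
  have h : (T ⊗> one 2) ∘> (one 2 ⊗> F) = (one 2 ⊗> F) ∘> (T ⊗> one 2) := identity .tof3
  have h1 := congrArg (fun x => (P ∘> x) ∘> ((B ⊗> (B ⊗> one 1)) ⊗> one 2)) h
  beta_reduce at h1
  rw [← assoc P, ← assoc P, P_T, P_F, assoc (N ⊗> one 2), P_F, assoc F P, P_T] at h1
  simp only [assoc] at h1
  rw [P_cancel, comp_one] at h1
  exact h1.trans (by rw [comp_one])

theorem N1_S1 : (N ⊗> one 2) ∘> (S ⊗> one 1) = (S ⊗> one 1) ∘> (one 1 ⊗> (N ⊗> one 1)) := by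
  have h1 : N ⊗> one 2 = (N ⊗> one 1) ⊗> one 1 := by
    rw [← one_tensor 1 1]; exact (tensor_assoc N (one 1) (one 1)).symm
  have h2 : one 1 ⊗> (N ⊗> one 1) = (one 1 ⊗> N) ⊗> one 1 := (tensor_assoc (one 1) N (one 1)).symm
  rw [h1, h2]
  refine (tensor_comp (N ⊗> one 1) S (one 1) (one 1)).trans ?_
  refine Eq.trans ?_ (tensor_comp S (one 1 ⊗> N) (one 1) (one 1)).symm
  rw [swap_natural]

theorem N2_S2 : (one 1 ⊗> (N ⊗> one 1)) ∘> (one 1 ⊗> S) = (one 1 ⊗> S) ∘> (one 2 ⊗> N) := by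
  have h1 : one 2 ⊗> N = one 1 ⊗> (one 1 ⊗> N) := by
    rw [← one_tensor 1 1]; exact (tensor_assoc (one 1) (one 1) N)
  rw [h1, tensor_comp, swap_natural]
  exact (tensor_comp (one 1) (one 1) S (one 1 ⊗> N)).symm

theorem N3_S1 : (one 2 ⊗> N) ∘> (S ⊗> one 1) = (S ⊗> one 1) ∘> (one 2 ⊗> N) := by
  rw [slide' S N]
  exact (slide S N).symm

theorem R_def : R = (S ⊗> one 1) ∘> (one 1 ⊗> S) ∘> (S ⊗> one 1) := rfl

theorem S2_S2 : (one 1 ⊗> S) ∘> (one 1 ⊗> S) = one 3 := by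
  rw [tensor_comp, S_S, one_comp, one_tensor]

theorem R_R : R ∘> R = one 3 := by
  rw [R_def]
  simp only [assoc]
  rw [← assoc (S ⊗> one 1) (S ⊗> one 1), S1_S1]
  have h : one 3 ∘> (one 1 ⊗> S) ∘> (S ⊗> one 1) = (one 1 ⊗> S) ∘> (S ⊗> one 1) := one_comp _
  rw [h, ← assoc (one 1 ⊗> S) (one 1 ⊗> S), S2_S2]
  have h : one 3 ∘> (S ⊗> one 1) = S ⊗> one 1 := one_comp _
  rw [h, S1_S1]

theorem N1_R : (N ⊗> one 2) ∘> R = R ∘> (one 2 ⊗> N) := by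
  rw [R_def, ← assoc, N1_S1, assoc, ← assoc (one 1 ⊗> (N ⊗> one 1)), N2_S2, assoc, N3_S1]
  simp only [assoc]

theorem R_N1 : R ∘> (N ⊗> one 2) = (one 2 ⊗> N) ∘> R := by
  have h := congrArg (fun x => R ∘> x ∘> R) N1_R
  simp only [assoc] at h
  rw [R_R, ← assoc R R, R_R, one_comp, comp_one] at h
  exact h

theorem N_T : (one 2 ⊗> N) ∘> T = T ∘> (one 2 ⊗> N) := by
  have hF : F = R ∘> T ∘> R := rfl
  have h := congrArg (fun x => R ∘> x ∘> R) N_F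
  simp only [hF, assoc] at h
  rw [R_R, comp_one, ← assoc R R, R_R, one_comp, ← assoc R (N ⊗> one 2), R_N1, assoc,
    ← assoc R R, R_R, one_comp, N1_R, ← assoc R R, R_R, one_comp] at h
  exact h

theorem N_C : (one 1 ⊗> N) ∘> C = C ∘> (one 1 ⊗> N) := by
  have h1 : one 2 ⊗> N = one 1 ⊗> (one 1 ⊗> N) := by
    rw [← one_tensor 1 1]; exact (tensor_assoc (one 1) (one 1) N)
  have h2 : (one 1 ⊗> N) ∘> (K ⊗> one 2) = (K ⊗> one 2) ∘> (one 2 ⊗> N) := by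
    rw [state22, h1]; exact (slide K (one 1 ⊗> N)).symm
  have h3 : (B ⊗> one 2) ∘> (one 1 ⊗> N) = (one 2 ⊗> N) ∘> (B ⊗> one 2) := by
    rw [effect22, h1]; exact (slide' B (one 1 ⊗> N)).symm
  calc (one 1 ⊗> N) ∘> C = ((one 1 ⊗> N) ∘> (K ⊗> one 2)) ∘> T ∘> (B ⊗> one 2) := by
        rw [C_def, assoc]
    _ = (K ⊗> one 2) ∘> ((one 2 ⊗> N) ∘> T) ∘> (B ⊗> one 2) := by rw [h2]; simp only [assoc]
    _ = (K ⊗> one 2) ∘> T ∘> (B ⊗> one 2) ∘> (one 1 ⊗> N) := by rw [N_T, assoc, h3]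
    _ = C ∘> (one 1 ⊗> N) := by rw [C_def]; simp only [assoc]

/-- The endomorphism of one wire given by a `cnot` whose target is prepared and measured. -/
def probe (k : Mor 0 1) (b : Mor 1 0) : Mor 1 1 := (one 1 ⊗> k) ∘> C ∘> (one 1 ⊗> b)

theorem probe1 (k : Mor 0 1) (b : Mor 1 0) :
    (one 2 ⊗> k) ∘> mk cnot13 ∘> (one 2 ⊗> b) = probe k b ⊗> one 1 := by
  have hk : (one 2 ⊗> k) ∘> (one 1 ⊗> S) = (one 1 ⊗> k) ⊗> one 1 := by
    have h1 : one 2 ⊗> k = one 1 ⊗> (one 1 ⊗> k) := by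
      rw [← one_tensor 1 1]; exact (tensor_assoc (one 1) (one 1) k)
    have h2 : (one 1 ⊗> k) ⊗> one 1 = one 1 ⊗> (k ⊗> one 1) := tensor_assoc (one 1) k (one 1)
    rw [h1, h2, ← state_S']
    exact (tensor_comp (one 1) (one 1) (one 1 ⊗> k) S).trans (by rw [one_comp])
  have hb : (one 1 ⊗> S) ∘> (one 2 ⊗> b) = (one 1 ⊗> b) ⊗> one 1 := by
    have h1 : one 2 ⊗> b = one 1 ⊗> (one 1 ⊗> b) := by
      rw [← one_tensor 1 1]; exact (tensor_assoc (one 1) (one 1) b)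
    have h2 : (one 1 ⊗> b) ⊗> one 1 = one 1 ⊗> (b ⊗> one 1) := tensor_assoc (one 1) b (one 1)
    rw [h1, h2, ← S_effect']
    exact (tensor_comp (one 1) (one 1) S (one 1 ⊗> b)).trans (by rw [one_comp])
  have h : mk cnot13 = (one 1 ⊗> S) ∘> (C ⊗> one 1) ∘> (one 1 ⊗> S) := rfl
  rw [h, assoc, assoc, hb, ← assoc, hk, probe]
  have h3 := tensor_comp C (one 1 ⊗> b) (one 1) (one 1)
  rw [one_comp] at h3
  have h4 := tensor_comp (one 1 ⊗> k) (C ∘> (one 1 ⊗> b)) (one 1) (one 1)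
  rw [one_comp] at h4
  exact (congrArg (fun x => ((one 1 ⊗> k) ⊗> one 1) ∘> x) h3).trans h4

theorem probe2 (k : Mor 0 1) (b : Mor 1 0) :
    (one 2 ⊗> k) ∘> (one 1 ⊗> C) ∘> (one 2 ⊗> b) = one 1 ⊗> probe k b := by
  have h1 : one 2 ⊗> k = one 1 ⊗> (one 1 ⊗> k) := by
    rw [← one_tensor 1 1]; exact (tensor_assoc (one 1) (one 1) k)
  have h2 : one 2 ⊗> b = one 1 ⊗> (one 1 ⊗> b) := by
    rw [← one_tensor 1 1]; exact (tensor_assoc (one 1) (one 1) b)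
  rw [h1, h2, probe]
  have h3 := tensor_comp (one 1) (one 1) C (one 1 ⊗> b)
  rw [one_comp] at h3
  have h4 := tensor_comp (one 1) (one 1) (one 1 ⊗> k) (C ∘> (one 1 ⊗> b))
  rw [one_comp] at h4
  exact (congrArg (fun x => (one 1 ⊗> (one 1 ⊗> k)) ∘> x) h3).trans h4

theorem probe_flip : probe K' B = probe K B' := by
  have h1 : one 1 ⊗> K' = (one 1 ⊗> K) ∘> (one 1 ⊗> N) := by rw [tensor_comp, one_comp]; rfl
  have h2 : one 1 ⊗> B' = (one 1 ⊗> N) ∘> (one 1 ⊗> B) := by rw [tensor_comp, one_comp]; rfl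
  rw [probe, probe, h1, h2, assoc, ← assoc (one 1 ⊗> N), N_C, assoc]

theorem T_flip : (one 2 ⊗> K') ∘> T ∘> (one 2 ⊗> B) = (one 2 ⊗> K) ∘> T ∘> (one 2 ⊗> B') := by
  have h1 : one 2 ⊗> K' = (one 2 ⊗> K) ∘> (one 2 ⊗> N) := by rw [tensor_comp, one_comp]; rfl
  have h2 : one 2 ⊗> B' = (one 2 ⊗> N) ∘> (one 2 ⊗> B) := by rw [tensor_comp, one_comp]; rfl
  rw [h1, h2, assoc, ← assoc (one 2 ⊗> N), N_T, assoc]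

/-! ### The horizontal flip respects the identities -/

theorem dagger_cast {a b a' b' : ℕ} (ha : a = a') (hb : b = b') (f : Circuit a b) :
    (f.cast ha hb).dagger = f.dagger.cast hb ha := by
  subst ha hb; rfl

/-- The flip of `f` is inverse to `f`. -/
def Rev {n m : ℕ} (f : Circuit n m) : Prop :=
  mk f ∘> mk f.dagger = one n ∧ mk f.dagger ∘> mk f = one m

theorem Rev.comp {a b c : ℕ} {f : Circuit a b} {g : Circuit b c} (hf : Rev f) (hg : Rev g) :
    Rev (f ⨾ g) := by
  constructor
  · show (mk f ∘> mk g) ∘> (mk g.dagger ∘> mk f.dagger) = _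
    rw [assoc, ← assoc (mk g), hg.1, one_comp, hf.1]
  · show (mk g.dagger ∘> mk f.dagger) ∘> (mk f ∘> mk g) = _
    rw [assoc, ← assoc _ (mk f), hf.2, one_comp, hg.2]

theorem Rev.tensor {a b c d : ℕ} {f : Circuit a b} {g : Circuit c d} (hf : Rev f) (hg : Rev g) :
    Rev (f ⊠ g) := by
  constructor
  · show (mk f ⊗> mk g) ∘> (mk f.dagger ⊗> mk g.dagger) = _
    rw [tensor_comp, hf.1, hg.1, one_tensor]
  · show (mk f.dagger ⊗> mk g.dagger) ∘> (mk f ⊗> mk g) = _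
    rw [tensor_comp, hf.2, hg.2, one_tensor]

theorem Rev.cast {a b a' b' : ℕ} (ha : a = a') (hb : b = b') {f : Circuit a b} (hf : Rev f) :
    Rev (f.cast ha hb) := by
  subst ha hb; exact hf

theorem rev_id (n : ℕ) : Rev (id n) := ⟨one_comp _, one_comp _⟩
theorem rev_swap (a b : ℕ) : Rev (swap a b) := ⟨swap_swap a b, swap_swap b a⟩
theorem rev_tof : Rev tof := ⟨T_T, T_T⟩

theorem cnot_dagger : mk cnot.dagger = C := assoc (K ⊗> one 2) T (B ⊗> one 2)

theorem not_dagger : mk not.dagger = N := by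
  show ((K ⊗> one 1) ∘> mk cnot.dagger) ∘> (B ⊗> one 1) = N
  rw [cnot_dagger, assoc]; rfl

theorem ket0_dagger : mk ket0.dagger = B' := by
  show mk not.dagger ∘> B = B'
  rw [not_dagger]; rfl

theorem bra0_dagger : mk bra0.dagger = K' := by
  show K ∘> mk not.dagger = K'
  rw [not_dagger]; rfl

theorem rev_cnot : Rev cnot := by
  unfold Rev; rw [cnot_dagger]; exact ⟨C_C, C_C⟩

theorem Rev.dagger_eq {n m : ℕ} {f g : Circuit n m} (hf : Rev f) (hg : Rev g) (h : Equiv f g) :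
    Equiv f.dagger g.dagger := by
  have h' : mk f = mk g := mk_eq.2 h
  refine mk_eq.1 ?_
  rw [← comp_one (mk f.dagger), ← hg.1, ← assoc, ← h', hf.2, one_comp]

theorem rev_rev3 : Rev rev3 :=
  .comp (.tensor (rev_swap 1 1) (rev_id 1)) (.comp (.tensor (rev_id 1) (rev_swap 1 1))
    (.tensor (rev_swap 1 1) (rev_id 1)))

theorem rev_tofFlip : Rev tofFlip := .comp rev_rev3 (.comp rev_tof rev_rev3)

theorem rev_cnotFlip : Rev cnotFlip := .comp (rev_swap 1 1) (.comp rev_cnot (rev_swap 1 1))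

theorem rev_tof134 : Rev tof134 :=
  .comp (.tensor (rev_swap 1 1) (rev_id 2)) (.comp (.tensor (rev_id 1) rev_tof)
    (.tensor (rev_swap 1 1) (rev_id 2)))

theorem rev_tof124 : Rev tof124 :=
  .comp (.tensor (rev_id 2) (rev_swap 1 1)) (.comp (.tensor rev_tof (rev_id 1))
    (.tensor (rev_id 2) (rev_swap 1 1)))

theorem cnot13_dagger : mk cnot13.dagger = mk cnot13 := by
  show ((one 1 ⊗> S) ∘> (mk cnot.dagger ⊗> one 1)) ∘> (one 1 ⊗> S) = _
  rw [cnot_dagger, assoc]; rfl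

theorem cnot3_dagger : mk cnot3.dagger = mk cnot3 := by
  show (((((one 2 ⊗> mk bra0.dagger) ⊗> one 2) ∘> (T ⊗> one 2)) ∘> (one 2 ⊗> T)) ∘>
    (T ⊗> one 2)) ∘> ((one 2 ⊗> mk ket0.dagger) ⊗> one 2) = _
  rw [bra0_dagger, ket0_dagger]
  simp only [assoc]
  rfl

theorem dagger_identity {n m : ℕ} {f g : Circuit n m} (h : Identity f g) :
    Equiv f.dagger g.dagger := by
  have he := Equiv.identity h
  cases h with
  | tof1 => exact mk_eq.1 (T_B.trans (by rw [← cnot_dagger]; rfl))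
  | tof1' => exact mk_eq.1 (K_T.trans (by rw [← cnot_dagger]; rfl))
  | tof2 =>
    refine mk_eq.1 ?_
    show T ∘> (mk ket0.dagger ⊗> one 2) = mk ket0.dagger ⊗> one 2
    rw [ket0_dagger]; exact identity .tof2'
  | tof2' =>
    refine mk_eq.1 ?_
    show (mk bra0.dagger ⊗> one 2) ∘> T = mk bra0.dagger ⊗> one 2
    rw [bra0_dagger]; exact identity .tof2
  | tof3 =>
    exact Rev.dagger_eq (.comp (.tensor rev_tof (rev_id 2)) (.tensor (rev_id 2) rev_tofFlip))
      (.comp (.tensor (rev_id 2) rev_tofFlip) (.tensor rev_tof (rev_id 2))) he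
  | tof4 =>
    exact Rev.dagger_eq (.comp (.tensor rev_tofFlip (rev_id 2)) (.tensor (rev_id 2) rev_tof))
      (.comp (.tensor (rev_id 2) rev_tof) (.tensor rev_tofFlip (rev_id 2))) he
  | tof5 =>
    exact Rev.dagger_eq (.comp (.tensor rev_tofFlip (rev_id 1)) (.tensor (rev_id 1) rev_tof))
      (.comp (.tensor (rev_id 1) rev_tof) (.tensor rev_tofFlip (rev_id 1))) he
  | tof6 =>
    exact Rev.dagger_eq (.comp rev_tof134 (.tensor (rev_id 1) rev_tof))
      (.comp (.tensor (rev_id 1) rev_tof) rev_tof134) he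
  | tof7 =>
    refine mk_eq.1 ?_
    show (((one 2 ⊗> mk bra0.dagger) ∘> (one 1 ⊗> mk cnot.dagger)) ∘> (one 2 ⊗> B)) ∘>
      (((one 2 ⊗> mk bra0.dagger) ∘> mk cnot13.dagger) ∘> (one 2 ⊗> B)) =
      ((one 2 ⊗> mk bra0.dagger) ∘> T) ∘> (one 2 ⊗> B)
    have h : ((one 2 ⊗> K) ∘> mk cnot13 ∘> (one 2 ⊗> B')) ∘>
        ((one 2 ⊗> K) ∘> (one 1 ⊗> C) ∘> (one 2 ⊗> B')) =
        (one 2 ⊗> K) ∘> T ∘> (one 2 ⊗> B') := mk_eq.2 he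
    rw [bra0_dagger, cnot_dagger, cnot13_dagger, assoc (one 2 ⊗> K') (one 1 ⊗> C) (one 2 ⊗> B),
      assoc (one 2 ⊗> K') (mk cnot13) (one 2 ⊗> B), assoc (one 2 ⊗> K') T (one 2 ⊗> B), T_flip, ← h, probe1, probe2, probe1, probe2, probe_flip]
    exact (slide' (probe K B') (probe K B')).trans (slide (probe K B') (probe K B')).symm
  | tof8 =>
    refine mk_eq.1 ?_
    show (mk bra0.dagger ∘> B) ⊗> one 1 = (mk bra0.dagger ∘> B) ⊗> (B ∘> K)
    rw [bra0_dagger, K'_B]; exact mk_eq.2 he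
  | tof9 => exact mk_eq.1 K_B
  | tof10 => exact mk_eq.1 T_T
  | tof11 =>
    exact Rev.dagger_eq (.comp (.tensor (rev_id 1) rev_tof) (.comp (.tensor rev_tof (rev_id 1))
      (.tensor (rev_id 1) rev_tof))) (.comp rev_tof124 (.tensor rev_tof (rev_id 1))) he
  | tof12 =>
    exact Rev.dagger_eq (.comp (.tensor rev_cnot (rev_id 2)) (.comp (.tensor (rev_id 1) rev_tof)
      (.tensor rev_cnot (rev_id 2)))) (.comp rev_tof134 (.tensor (rev_id 1) rev_tof)) he
  | tof13 =>
    exact Rev.dagger_eq (.comp (.tensor rev_tof (rev_id 1)) (.comp (.tensor (rev_id 1) rev_tof)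
      (.tensor rev_tof (rev_id 1)))) (.comp rev_tof124 (.tensor (rev_id 1) rev_tof)) he
  | tof14 =>
    exact Rev.dagger_eq (.comp (.tensor rev_tof (rev_id 1)) (.comp (.tensor (rev_id 2) rev_cnot)
      (.tensor rev_tof (rev_id 1)))) (.comp rev_tof124 (.tensor (rev_id 2) rev_cnot)) he
  | tof15 =>
    exact Rev.dagger_eq (.comp rev_cnot (.comp rev_cnotFlip rev_cnot)) (rev_swap 1 1) he
  | tof16 =>
    exact Rev.dagger_eq rev_tof (.comp (.tensor (rev_swap 1 1) (rev_id 1)) (.comp rev_tof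
      (.tensor (rev_swap 1 1) (rev_id 1)))) he
  | tof17 =>
    refine mk_eq.1 ?_
    show mk cnot3.dagger = (((one 1 ⊗> S) ⊗> one 1) ∘> mk cnot3.dagger) ∘>
      ((one 1 ⊗> S) ⊗> one 1)
    rw [cnot3_dagger, assoc]
    exact mk_eq.2 he

theorem dagger_equiv {n m : ℕ} {f g : Circuit n m} (h : Equiv f g) :
    Equiv f.dagger g.dagger := by
  induction h with
  | refl f => exact .refl _
  | symm _ ih => exact .symm ih
  | trans _ _ ih ih' => exact .trans ih ih'
  | comp_congr _ _ ih ih' => exact .comp_congr ih' ih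
  | tensor_congr _ _ ih ih' => exact .tensor_congr ih ih'
  | id_comp f => exact .comp_id _
  | comp_id f => exact .id_comp _
  | assoc f g h => exact .symm (.assoc _ _ _)
  | id_tensor a b => exact .id_tensor a b
  | interchange f g f' g' => exact .interchange _ _ _ _
  | tensor_assoc f g h => rw [dagger_cast]; exact .tensor_assoc _ _ _
  | unit_tensor f => rw [dagger_cast]; exact .unit_tensor _
  | tensor_unit f => rw [dagger_cast]; exact .tensor_unit _
  | swap_natural f g => exact .symm (.swap_natural _ _)
  | swap_swap a b => exact .swap_swap a b
  | hexagon a b c =>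
    exact Rev.dagger_eq (rev_swap _ _) (.cast _ _ (.comp (.tensor (rev_swap a b) (rev_id c))
      (.cast _ _ (.tensor (rev_id b) (rev_swap a c))))) (.hexagon a b c)
  | identity h => exact dagger_identity h

/-- The horizontal flip of morphisms. -/
def dagger {n m : ℕ} : Mor n m → Mor m n :=
  Quotient.map Circuit.dagger fun _ _ h => dagger_equiv h

/-! ### Points -/

end Mor

/-- The one-bit kets `|0⟩` and `|1⟩`. -/
def ketBit (x : Bool) : Circuit 0 1 := if x then ket1 else ket0

/-- The ket `|b₁, …, bₙ⟩`, an iterated tensor of one-bit kets. -/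
def ket : (n : ℕ) → (Fin n → Bool) → Circuit 0 n
  | 0, _ => id 0
  | n + 1, b => ket n (Fin.init b) ⊠ ketBit (b (Fin.last n))

theorem eval_ketBit (x : Bool) : (ketBit x).eval [] = some [x] := by
  revert x; decide

theorem eval_ket (n : ℕ) (b : Fin n → Bool) : (ket n b).eval [] = some (List.ofFn b) := by
  induction n with
  | zero => simp [ket, eval]
  | succ n ih =>
    simp only [ket, eval, List.take_nil, List.drop_nil, ih, eval_ketBit]
    rw [List.ofFn_succ', List.concat_eq_append]
    rfl

theorem dagger_dagger {n m : ℕ} (f : Circuit n m) : f.dagger.dagger = f := by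
  induction f <;> simp_all [dagger]

namespace Mor

/-- The scalar `⟨0| ∘ |1⟩`. -/
abbrev W : Mor 0 0 := K ∘> B'

theorem W_K (p : Mor 0 1) : W ∘> p = W ⊗> p := by
  have h := slide W p
  rw [tensor_unit, unit01] at h
  exact h

theorem K_W (p : Mor 0 1) : W ∘> p = p ⊗> W := by
  have h := slide' p W
  rw [tensor_unit, unit00] at h
  exact h

theorem W_W : W ∘> W = W := by
  have h : ((one 2 ⊗> K) ∘> mk cnot13 ∘> (one 2 ⊗> B')) ∘>
      ((one 2 ⊗> K) ∘> (one 1 ⊗> C) ∘> (one 2 ⊗> B')) =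
      (one 2 ⊗> K) ∘> T ∘> (one 2 ⊗> B') := identity .tof7
  rw [probe1, probe2] at h
  have hq : K' ∘> probe K B' = W ∘> K' := by
    have h1 : K' ∘> (one 1 ⊗> K) = K ∘> (K' ⊗> one 1) := by
      have e1 : K' ∘> (one 1 ⊗> K) = K' ⊗> K := by
        have := slide K' K
        rw [tensor_unit] at this
        exact this
      have e2 : K ∘> (K' ⊗> one 1) = K' ⊗> K := by
        have := slide' K' K
        rw [unit01] at this
        exact this
      rw [e1, e2]
    have h2 : (K' ⊗> one 1) ∘> (one 1 ⊗> B') = B' ∘> K' := by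
      have e1 := slide K' B'
      have e2 := slide' K' B'
      rw [unit10, tensor_unit] at e2
      exact e1.trans e2.symm
    rw [probe, ← assoc, h1, assoc, ← assoc (K' ⊗> one 1), K'_C, h2, assoc]
  have h1 := congrArg (fun x => (K' ⊗> K') ∘> x ∘> (B' ⊗> B')) h
  beta_reduce at h1
  have hl : (K' ⊗> K') ∘> ((probe K B' ⊗> one 1) ∘> (one 1 ⊗> probe K B')) ∘> (B' ⊗> B') =
      W ∘> W := by
    have e1 : (probe K B' ⊗> one 1) ∘> (one 1 ⊗> probe K B') = probe K B' ⊗> probe K B' :=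
      slide _ _
    have e2 : (W ∘> K') ∘> B' = W := by rw [assoc, K'_B', comp_one]
    have e3 : W ∘> W = W ⊗> W := by
      have := slide W W
      rw [tensor_unit, unit00] at this
      exact this
    rw [e1, ← assoc, tensor_comp, tensor_comp, hq, e2, e3]
  have hr : (K' ⊗> K') ∘> ((one 2 ⊗> K) ∘> T ∘> (one 2 ⊗> B')) ∘> (B' ⊗> B') = W := by
    have e1 : (K' ⊗> K') ∘> (one 2 ⊗> K) = K' ⊗> (K' ⊗> K) := by
      have := slide (K' ⊗> K') K
      rw [tensor_unit] at this
      exact this.trans (tensor_assoc K' K' K)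
    have e2 : K' ⊗> (K' ⊗> K) = (K' ⊗> K) ∘> (K' ⊗> one 2) := by
      have := slide' K' (K' ⊗> K)
      rw [show one 0 ⊗> (K' ⊗> K) = K' ⊗> K from @unit_tensor 0 2 (K' ⊗> K)] at this
      exact this.symm
    have e3 : (K' ⊗> (K' ⊗> K)) ∘> T = (K' ⊗> K') ⊗> K := by
      rw [e2, assoc, K'_T, ← e2]
      exact (tensor_assoc K' K' K).symm
    have e4 : ((K' ⊗> K') ⊗> K) ∘> (one 2 ⊗> B') = (K' ⊗> K') ⊗> W := by
      rw [tensor_comp]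
      exact congrArg (fun x => x ⊗> W) (comp_one (K' ⊗> K'))
    have e5 : ((K' ⊗> K') ⊗> W) ∘> (B' ⊗> B') = W := by
      have := tensor_comp (K' ⊗> K') (B' ⊗> B') W (one 0)
      rw [tensor_unit, tensor_comp, K'_B', comp_one] at this
      refine this.trans ?_
      have e : one 0 ⊗> one 0 = one 0 := one_tensor 0 0
      rw [e]
      exact unit00 W
    rw [assoc, ← assoc, e1, assoc, ← assoc, e3, ← assoc, e4, e5]
  rw [hl, hr] at h1
  exact h1

theorem W_K' : W ∘> K' = W ∘> K := by
  have h : W ⊗> one 1 = W ⊗> (B ∘> K) := identity .tof8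
  have h1 := congrArg (fun x => (one 0 ⊗> K') ∘> x) h
  beta_reduce at h1
  rw [slide' W K', tensor_comp, one_comp, ← assoc K', K'_B, ← W_K, ← W_K, ← assoc, W_W] at h1
  exact h1

theorem W_ketBit (x : Bool) : W ∘> mk (ketBit x) = W ∘> K := by
  cases x
  · exact W_K'
  · rfl

theorem mk_ket_succ (n : ℕ) (b : Fin (n + 1) → Bool) :
    mk (ket (n + 1) b) = mk (ket n (Fin.init b)) ⊗> mk (ketBit (b (Fin.last n))) := rfl

theorem W_tensor {n m : ℕ} (p : Mor 0 n) (k : Mor 0 m) : W ∘> (p ⊗> k) = (W ∘> p) ⊗> k := by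
  have h := tensor_comp W p (one 0) k
  rw [tensor_unit, one_comp] at h
  exact h

theorem W_tensor' {n m : ℕ} (p : Mor 0 n) (k : Mor 0 m) : W ∘> (p ⊗> k) = p ⊗> (W ∘> k) := by
  have h := tensor_comp (one 0) p W k
  rw [unit00, one_comp] at h
  exact h

/-- The point that is nowhere defined. -/
def dead (n : ℕ) : Mor 0 n := W ∘> mk (ket n fun _ => true)

theorem W_ket (n : ℕ) (b : Fin n → Bool) : W ∘> mk (ket n b) = dead n := by
  induction n with
  | zero => rfl
  | succ n ih =>
    rw [dead, mk_ket_succ, mk_ket_succ, W_tensor, ih, dead, ← W_tensor, W_tensor', W_tensor',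
      W_ketBit, W_ketBit]
    rfl

theorem W_dead (n : ℕ) : W ∘> dead n = dead n := by rw [dead, ← assoc, W_W]

theorem ket_add (n m : ℕ) (b : Fin (n + m) → Bool) : mk (ket (n + m) b) =
    mk (ket n fun i => b (Fin.castAdd m i)) ⊗> mk (ket m fun i => b (Fin.natAdd n i)) := by
  induction m with
  | zero => exact (tensor_unit _).symm
  | succ m ih =>
    have h := mk_ket_succ (n + m) b
    rw [ih] at h
    exact h.trans (tensor_assoc (mk (ket n fun i => b (Fin.castAdd (m + 1) i)))
      (mk (ket m fun i => b (Fin.natAdd n i.castSucc))) (mk (ketBit (b (Fin.last (n + m))))))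

theorem ket_append {n m : ℕ} (b : Fin n → Bool) (c : Fin m → Bool) :
    mk (ket n b) ⊗> mk (ket m c) = mk (ket (n + m) (Fin.append b c)) := by
  rw [ket_add]; simp

/-- Every ket is mapped to a ket or to the nowhere defined point. -/
def Stable {n m : ℕ} (f : Mor n m) : Prop :=
  ∀ b, (∃ c, mk (ket n b) ∘> f = mk (ket m c)) ∨ mk (ket n b) ∘> f = dead m

theorem Stable.dead_comp {n m : ℕ} {f : Mor n m} (hf : Stable f) : dead n ∘> f = dead m := by
  rw [dead, assoc]
  rcases hf fun _ => true with ⟨c, h⟩ | h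
  · rw [h, W_ket]
  · rw [h, W_dead]

theorem mk_ket_one (b : Fin 1 → Bool) : mk (ket 1 b) = mk (ketBit (b 0)) :=
  unit01 (mk (ketBit (b 0)))

theorem ketBit_T (x y z : Bool) : (mk (ketBit x) ⊗> (mk (ketBit y) ⊗> mk (ketBit z))) ∘> T =
    mk (ketBit x) ⊗> (mk (ketBit y) ⊗> mk (ketBit (xor z (x && y)))) := by
  have split3 (k : Mor 0 1) (p : Mor 0 2) : k ⊗> p = p ∘> (k ⊗> one 2) := by
    have := slide' k p
    rw [show one 0 ⊗> p = p from unit_tensor p] at this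
    exact this.symm
  have split2 (k p : Mor 0 1) : k ⊗> p = p ∘> (k ⊗> one 1) := by
    have := slide' k p
    rw [unit01] at this
    exact this.symm
  cases x with
  | false =>
    simp only [Bool.false_and, Bool.xor_false]
    rw [split3, assoc]
    exact congrArg _ K'_T
  | true =>
    have h : (mk (ketBit true) ⊗> (mk (ketBit y) ⊗> mk (ketBit z))) ∘> T =
        mk (ketBit true) ⊗> ((mk (ketBit y) ⊗> mk (ketBit z)) ∘> C) := by
      rw [split3, assoc]
      refine (congrArg _ K_T).trans ?_
      rw [← state22, ← assoc, split3]
      rfl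
    rw [h]
    cases y with
    | false =>
      simp only [Bool.and_false, Bool.xor_false]
      rw [split2, assoc]
      exact congrArg (fun x => _ ⊗> (_ ∘> x)) K'_C
    | true =>
      have h : (mk (ketBit true) ⊗> mk (ketBit z)) ∘> C =
          mk (ketBit true) ⊗> (mk (ketBit z) ∘> N) := by
        rw [split2, assoc]
        refine (congrArg _ K_C).trans ?_
        rw [← state11, ← assoc, split2]
        rfl
      rw [h]
      cases z
      · exact congrArg (fun x => _ ⊗> (_ ⊗> x)) K'_N
      · rfl

theorem mk_ket_three (b : Fin 3 → Bool) :
    mk (ket 3 b) = mk (ketBit (b 0)) ⊗> (mk (ketBit (b 1)) ⊗> mk (ketBit (b 2))) := by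
  have h : mk (ket 3 b) =
      ((one 0 ⊗> mk (ketBit (b 0))) ⊗> mk (ketBit (b 1))) ⊗> mk (ketBit (b 2)) := rfl
  rw [unit01] at h
  exact h.trans (tensor_assoc (mk (ketBit (b 0))) (mk (ketBit (b 1))) (mk (ketBit (b 2))))

theorem stable {n m : ℕ} (f : Circuit n m) : Stable (mk f) := by
  induction f with
  | id n => exact fun b => .inl ⟨b, comp_one _⟩
  | comp f g ihf ihg =>
    intro b
    rw [mk_comp, ← assoc]
    rcases ihf b with ⟨c, h⟩ | h
    · rw [h]; exact ihg c
    · rw [h]; exact .inr ihg.dead_comp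
  | @tensor n₁ _ n₂ _ f g ihf ihg =>
    intro b
    have e : mk (ket _ b) ∘> mk (f ⊠ g) =
        (mk (ket n₁ fun i => b (Fin.castAdd n₂ i)) ∘> mk f) ⊗>
          (mk (ket n₂ fun i => b (Fin.natAdd n₁ i)) ∘> mk g) := by
      rw [ket_add]
      exact tensor_comp (mk (ket n₁ _)) (mk f) (mk (ket n₂ _)) (mk g)
    rcases ihf fun i => b (Fin.castAdd _ i) with ⟨c, h⟩ | h
    · rcases ihg fun i => b (Fin.natAdd _ i) with ⟨d, h'⟩ | h'
      · rw [h, h', ket_append] at e; exact .inl ⟨_, e⟩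
      · rw [h, h', dead, ← W_tensor', ket_append, W_ket] at e; exact .inr e
    · rcases ihg fun i => b (Fin.natAdd _ i) with ⟨d, h'⟩ | h'
      · rw [h, h', dead, ← W_tensor, ket_append, W_ket] at e; exact .inr e
      · rw [h, h', dead, ← W_tensor, dead, ← W_tensor', ket_append, W_ket, W_dead] at e
        exact .inr e
  | swap n m =>
    intro b
    have h := swap_natural (mk (ket n fun i => b (Fin.castAdd m i)))
      (mk (ket m fun i => b (Fin.natAdd n i)))
    rw [← ket_add, swap_zero_zero, ket_append] at h
    exact .inl ⟨_, h.trans (one_comp _)⟩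
  | ket1 =>
    refine fun b => .inl ⟨fun _ => true, ?_⟩
    rw [mk_ket_one]
    exact one_comp _
  | bra1 =>
    intro b
    rw [mk_ket_one]
    cases b 0
    · exact .inr ((comp_one _).symm.trans (congrArg (fun x => x ∘> one 0) K'_B))
    · exact .inl ⟨Fin.elim0, K_B⟩
  | tof =>
    refine fun b => .inl ⟨![b 0, b 1, xor (b 2) (b 0 && b 1)], ?_⟩
    rw [mk_ket_three, mk_ket_three]
    exact ketBit_T _ _ _

theorem eval_eq_of_mk_eq {n : ℕ} {f g : Circuit 0 n} (h : mk f = mk g) : f.eval [] = g.eval [] :=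
  eval_equiv (mk_eq.1 h) rfl

theorem ket_comp_eq_iff {n m : ℕ} (f : Circuit n m) (b : Fin n → Bool) (c : Fin m → Bool) :
    mk (ket n b) ∘> mk f = mk (ket m c) ↔ f.eval (List.ofFn b) = some (List.ofFn c) := by
  have key : ∀ c, mk (ket n b) ∘> mk f = mk (ket m c) →
      f.eval (List.ofFn b) = some (List.ofFn c) := fun c h => by
    have := eval_eq_of_mk_eq (f := ket n b ⨾ f) h
    simpa [eval, eval_ket] using this
  refine ⟨key c, fun h => ?_⟩
  rcases stable f b with ⟨c', h'⟩ | h'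
  · rw [h']
    have e := key c' h'
    rw [h] at e
    rw [List.ofFn_injective (Option.some.inj e)]
  · have e := eval_eq_of_mk_eq (f := ket n b ⨾ f)
      (g := (ket1 ⨾ bra0) ⨾ ket m fun _ => true) h'
    have e0 : (ket1 ⨾ bra0).eval [] = none := by decide
    rw [eval, eval_ket, eval, e0] at e
    simp [h] at e

end Mor

end Circuit

/-! ### The category `TOF` -/

/-- The objects of `TOF` are the natural numbers. -/
structure TOF : Type where
  wires : ℕ

namespace TOF

open Circuit

instance : Category TOF where
  Hom A B := Mor A.wires B.wires
  id A := Mor.one A.wires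
  comp f g := Mor.comp f g
  id_comp f := Mor.one_comp f
  comp_id f := Mor.comp_one f
  assoc f g h := Mor.assoc f g h

/-- The morphism of `TOF` represented by a circuit. -/
def ofCircuit {n m : ℕ} (f : Circuit n m) : (⟨n⟩ : TOF) ⟶ ⟨m⟩ := Mor.mk f

/-- The contravariant involution `f ↦ f°` which flips circuits horizontally. -/
def dagger {A B : TOF} (f : A ⟶ B) : B ⟶ A := Mor.dagger f

/-- The restriction `f f°` of `f` (composition in diagrammatic order). -/
def restriction {A B : TOF} (f : A ⟶ B) : A ⟶ A := f ≫ dagger f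

def IsTotal {A B : TOF} (f : A ⟶ B) : Prop := restriction f = 𝟙 A

/-- The set `H₀(A)` of total points of `A`, i.e. of total maps `0 ⟶ A`. -/
abbrev TotalPoint (A : TOF) : Type := {p : (⟨0⟩ : TOF) ⟶ A // IsTotal p}

/-- The ket `|b₁, …, bₙ⟩` as a morphism of `TOF`. -/
def ket {A : TOF} (b : Fin A.wires → Bool) : (⟨0⟩ : TOF) ⟶ A := ofCircuit (Circuit.ket A.wires b)

theorem exists_circuit {A B : TOF} (f : A ⟶ B) : ∃ c : Circuit A.wires B.wires, f = ofCircuit c :=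
  Quotient.inductionOn f fun c => ⟨c, rfl⟩

theorem ket_injective {A : TOF} : Function.Injective (ket (A := A)) := fun b c h => by
  have := Mor.eval_eq_of_mk_eq h
  rw [eval_ket, eval_ket] at this
  exact List.ofFn_injective (Option.some.inj this)

theorem ket_comp_eq_iff {A B : TOF} (f : Circuit A.wires B.wires) (b : Fin A.wires → Bool)
    (c : Fin B.wires → Bool) :
    ket b ≫ ofCircuit f = ket c ↔ f.eval (List.ofFn b) = some (List.ofFn c) :=
  Mor.ket_comp_eq_iff f b c

theorem ket_comp_dagger {A B : TOF} (f : A ⟶ B) (b : Fin A.wires → Bool)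
    (c : Fin B.wires → Bool) : ket c ≫ dagger f = ket b ↔ ket b ≫ f = ket c := by
  obtain ⟨f, rfl⟩ := exists_circuit f
  rw [ket_comp_eq_iff]
  refine (Mor.ket_comp_eq_iff f.dagger c b).trans ⟨fun h => ?_, fun h => ?_⟩
  · have := eval_dagger _ (by simp) h
    rwa [dagger_dagger] at this
  · exact eval_dagger _ (by simp) h

theorem isTotal_ofCircuit_iff {A : TOF} (f : Circuit 0 A.wires) :
    IsTotal (ofCircuit f : (⟨0⟩ : TOF) ⟶ A) ↔ (Circuit.eval f []).isSome := by
  constructor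
  · intro h
    have e : (f ⨾ f.dagger).eval [] = (Circuit.id 0).eval [] := Mor.eval_eq_of_mk_eq h
    cases e' : Circuit.eval f [] with
    | none => simp [Circuit.eval, e'] at e
    | some l => rfl
  · intro h
    obtain ⟨l, hl⟩ := Option.isSome_iff_exists.1 h
    have e : (f ⨾ f.dagger).eval [] = some [] := by
      simp [Circuit.eval, hl, eval_dagger f rfl hl]
    exact (Mor.one_comp _).symm.trans ((Mor.ket_comp_eq_iff _ Fin.elim0 Fin.elim0).2 e)

theorem isTotal_iff {A : TOF} (p : (⟨0⟩ : TOF) ⟶ A) : IsTotal p ↔ ∃ b, ket b = p := by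
  obtain ⟨f, rfl⟩ := exists_circuit p
  rw [isTotal_ofCircuit_iff]
  constructor
  · intro h
    obtain ⟨l, hl⟩ := Option.isSome_iff_exists.1 h
    obtain ⟨n⟩ := A
    obtain rfl := eval_length f rfl hl
    have := (Mor.ket_comp_eq_iff f Fin.elim0 l.get).2 (by rw [List.ofFn_get]; exact hl)
    exact ⟨l.get, this.symm.trans (Mor.one_comp _)⟩
  · rintro ⟨b, h⟩
    rw [← Mor.eval_eq_of_mk_eq h, eval_ket]
    rfl

theorem isTotal_ket {A : TOF} (b : Fin A.wires → Bool) : IsTotal (ket b) := (isTotal_iff _).2 ⟨b, rfl⟩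

/-- The total points of `A` are the kets. -/
noncomputable def ketEquiv (A : TOF) : (Fin A.wires → Bool) ≃ TotalPoint A :=
  Equiv.ofBijective (fun b => ⟨ket b, isTotal_ket b⟩)
    ⟨fun _ _ h => ket_injective (congrArg Subtype.val h),
      fun p => ((isTotal_iff p.1).1 p.2).imp fun _ h => Subtype.ext h⟩

theorem IsTotal.of_comp {A B : TOF} {p : (⟨0⟩ : TOF) ⟶ A} {f : A ⟶ B} (h : IsTotal (p ≫ f)) :
    IsTotal p := by
  obtain ⟨g, rfl⟩ := exists_circuit p
  obtain ⟨f, rfl⟩ := exists_circuit f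
  have h' := (isTotal_ofCircuit_iff (g ⨾ f)).1 h
  rw [isTotal_ofCircuit_iff]
  cases e : Circuit.eval g [] with
  | none => simp [Circuit.eval, e] at h'
  | some l => rfl

open Classical in
/-- The value of `h₀(f)` at the total point `p`: the point `p f` if it is total,
and undefined otherwise. -/
noncomputable def evalPoint {A B : TOF} (f : A ⟶ B) (p : TotalPoint A) : Option (TotalPoint B) :=
  if h : IsTotal (p.1 ≫ f) then some ⟨p.1 ≫ f, h⟩ else none

theorem evalPoint_eq_some {A B : TOF} {f : A ⟶ B} {p : TotalPoint A} {q : TotalPoint B} :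
    evalPoint f p = some q ↔ p.1 ≫ f = q.1 := by
  unfold evalPoint
  split
  · rename_i h
    simp [Subtype.ext_iff]
  · rename_i h
    simp only [reduceCtorEq, false_iff]
    exact fun e => h (e ▸ q.2)

theorem evalPoint_dagger {A B : TOF} (f : A ⟶ B) (p : TotalPoint A) (q : TotalPoint B) :
    evalPoint (dagger f) q = some p ↔ evalPoint f p = some q := by
  obtain ⟨b, rfl⟩ := (ketEquiv A).surjective p
  obtain ⟨c, rfl⟩ := (ketEquiv B).surjective q
  rw [evalPoint_eq_some, evalPoint_eq_some]
  exact ket_comp_dagger f b c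

end TOF

/-! ### Sets and partial isomorphisms -/

/-- The category of sets and partial isomorphisms (partial injective functions). -/
structure Pinj : Type 1 where
  carrier : Type

instance : Category Pinj where
  Hom X Y := X.carrier ≃. Y.carrier
  id X := PEquiv.refl X.carrier
  comp f g := f.trans g
  id_comp f := PEquiv.refl_trans f
  comp_id f := PEquiv.trans_refl f
  assoc f g h := PEquiv.trans_assoc f g h

/-- The full subcategory of `Pinj` on the finite powers of the two element set. -/
abbrev FPinj₂ : Type 1 :=
  ObjectProperty.FullSubcategory fun X : Pinj => ∃ n : ℕ, X = ⟨Fin n → Bool⟩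

namespace TOF

/-- The functor `H₀ : TOF ⥤ Pinj` which evaluates circuits on total points; the inverse of the
partial isomorphism `H₀(f)` is given by evaluation of `f°`. -/
noncomputable def H₀ : TOF ⥤ Pinj where
  obj A := ⟨TotalPoint A⟩
  map f :=
    { toFun := evalPoint f
      invFun := evalPoint (dagger f)
      inv := fun p q => evalPoint_dagger f p q }
  map_id A := by
    refine PEquiv.ext fun p => ?_
    exact evalPoint_eq_some.2 (Category.comp_id _)
  map_comp {A B C} f g := by
    refine PEquiv.ext fun p => Option.ext fun q => ?_
    refine Iff.trans evalPoint_eq_some (Iff.trans ?_ (PEquiv.mem_trans _ _ p q).symm)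
    constructor
    · intro h
      have ht : IsTotal (p.1 ≫ f) := .of_comp (f := g) (by rw [Category.assoc, h]; exact q.2)
      exact ⟨⟨p.1 ≫ f, ht⟩, evalPoint_eq_some.2 rfl,
        evalPoint_eq_some.2 (by rw [← h, Category.assoc])⟩
    · rintro ⟨r, h1, h2⟩
      rw [← Category.assoc, evalPoint_eq_some.1 h1, evalPoint_eq_some.1 h2]

/-- The isomorphism in `Pinj` between the set of total points of `n` and the `n`-th power of the
two element set, given by the kets. -/
noncomputable def pointsIso (A : TOF) : H₀.obj A ≅ (⟨Fin A.wires → Bool⟩ : Pinj) where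
  hom := (ketEquiv A).symm.toPEquiv
  inv := (ketEquiv A).toPEquiv
  hom_inv_id := by
    refine ((ketEquiv A).symm.toPEquiv_trans (ketEquiv A)).symm.trans ?_
    rw [Equiv.symm_trans_self]
    exact Equiv.toPEquiv_refl
  inv_hom_id := by
    refine ((ketEquiv A).toPEquiv_trans (ketEquiv A).symm).symm.trans ?_
    rw [Equiv.self_trans_symm]
    exact Equiv.toPEquiv_refl

/-- The functor `H̃₀ : TOF ⥤ FPinj₂`: this is `H₀`, where the set of total points of `n` is
identified, by means of the kets, with the `n`-th power of the two element set. -/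
noncomputable def H₀tilde : TOF ⥤ FPinj₂ :=
  ObjectProperty.lift _ (H₀.copyObj (fun A => ⟨Fin A.wires → Bool⟩) pointsIso)
    fun A => ⟨A.wires, rfl⟩

end TOF

/-! A product of gates and projections computes a partial injection on bit strings. The identities
suffice to rewrite it as a projection to its domain followed by a reversible word, and to show that
both parts are determined by the partial injection. `GateSystem` isolates what this needs: gates on
labelled wires, with an unlimited supply of fresh wires that can be prepared in a fixed state and
cancelled afterwards.

Negations with many controls, `ctrl S t`, are commutators of smaller ones formed through an
auxiliary wire; by `commutator_eq` the auxiliary wire is irrelevant, and by `ctrlList_swap` so is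
the order of the controls. A product of such gates with common target, `oracle l t`, adds a
polynomial over the two element field to wire `t`, and by uniqueness of the algebraic normal form it
depends only on the Boolean function (`oracle_ext`). Conjugating an oracle by a word substitutes the
computed permutation into the polynomial (`ctrl_ctrl_ctrl`, `run_conj_oracle`). With an ancilla `t`
in state `0`, the element `Z t * oracle l t * Z t` projects to the zeros of the polynomial, and
every product of gates and projections is, next to the ancilla, such a projection followed by a
reversible word (`Computes.exists_normalForm`).

Two normal forms of the same map have equal projections `ε` and differ by a word `U` which is
trivial on the domain. The heart of the proof is `domain_run`: then `ε * U = ε`. Let `A` copy all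
wires to fresh wires in state `0`. On the domain, copying before or after `U` is the same, so `ε * U
* A = ε * A * U`. On the other hand `U * A = A * U' * U`, where `U'` is `U` on the copies; hence `ε
* A * U' = ε * A`. After `A`, originals and copies may be exchanged, so `ε * A * U = ε * A`. Thus `ε
* U * A = ε * A`, and `A` can be cancelled. This yields `Computes.unique`.

For `TOF`, the monoid consists of germs of circuits on infinitely many wires. Gates on arbitrary
wires are conjugates of the standard ones by wire permutations, which is legitimate because a
permutation circuit fixing the first `k` wires can be written with transpositions of the others
(`mem_permutations`). A circuit from `n` to `m` wires need not be a product of gates, but it becomes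
one after padding with `collapse r s` for large `r` (`generated_mk`), and it can be recovered from
the padded circuit. Since `H₀` records the values at all kets, hence at all bit strings,
faithfulness follows. -/

/-! ### Gate systems: identities between gates on labelled wires -/

/-- Labelled gates in a monoid: `T i j k` is the Toffoli gate with controls `i`, `j` and target `k`,
`C i j` the `cnot` gate with control `i` and target `j`, `N i` the negation of wire `i`, `E i` the
projection of wire `i` to the state `1`, `swap i j` the exchange of two wires, and `free c` consists
of the elements which do not touch wire `c`. -/
structure GateSystem (M : Type*) [Monoid M] where
  T : ℕ → ℕ → ℕ → M
  C : ℕ → ℕ → M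
  N : ℕ → M
  E : ℕ → M
  swap : ℕ → ℕ → M
  free : ℕ → Submonoid M
  T_symm {i j k : ℕ} : i ≠ j → i ≠ k → j ≠ k → T i j k = T j i k
  T_sq {i j k : ℕ} : i ≠ j → i ≠ k → j ≠ k → T i j k * T i j k = 1
  T_comm {i j k a b c : ℕ} : i ≠ j → i ≠ k → j ≠ k → a ≠ b → a ≠ c → b ≠ c →
    k ≠ a → k ≠ b → c ≠ i → c ≠ j → Commute (T i j k) (T a b c)
  C_T_C {a b c d : ℕ} : a ≠ b → a ≠ c → a ≠ d → b ≠ c → b ≠ d → c ≠ d →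
    C a b * T b c d * C a b = T a c d * T b c d
  T_T_T {a b c d : ℕ} : a ≠ b → a ≠ c → a ≠ d → b ≠ c → b ≠ d → c ≠ d →
    T a b c * T b c d * T a b c = T a b d * T b c d
  T_C_T {a b c d : ℕ} : a ≠ b → a ≠ c → a ≠ d → b ≠ c → b ≠ d → c ≠ d →
    T a b c * C c d * T a b c = T a b d * C c d
  -- `N c * E c * N c` projects wire `c` to `0`. Between two such projections the three Toffoli
  -- gates negate `e` under the controls `a`, `b`, `d`; the identity exchanges `b` and `d`.
  triple_symm {a b c d e : ℕ} : a ≠ b → a ≠ c → a ≠ d → a ≠ e → b ≠ c → b ≠ d → b ≠ e →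
    c ≠ d → c ≠ e → d ≠ e →
    N c * E c * N c * T a b c * T c d e * T a b c * (N c * E c * N c) =
      N c * E c * N c * T a d c * T c b e * T a d c * (N c * E c * N c)
  E_E (i : ℕ) : E i * E i = E i
  E_T {i j k : ℕ} : i ≠ j → i ≠ k → j ≠ k → E i * T i j k = E i * C j k
  T_E {i j k : ℕ} : i ≠ j → i ≠ k → j ≠ k → T i j k * E i = E i * C j k
  E_C {i j : ℕ} : i ≠ j → E i * C i j = E i * N j
  N_N (i : ℕ) : N i * N i = 1
  Z_T {i j k : ℕ} : i ≠ j → i ≠ k → j ≠ k → N i * E i * N i * T i j k = N i * E i * N i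
  T_Z {i j k : ℕ} : i ≠ j → i ≠ k → j ≠ k → T i j k * (N i * E i * N i) = N i * E i * N i
  -- Wire `k` is put in state `0`, negated, and required to be `0` again after the Toffoli gate:
  -- this forces both controls to be `1`.
  both {i j k : ℕ} : i ≠ j → i ≠ k → j ≠ k →
    N k * E k * N k * N k * T i j k * (N k * E k * N k) = E i * E j * (N k * E k * N k)
  T_mem {i j k c : ℕ} : i ≠ j → i ≠ k → j ≠ k → c ≠ i → c ≠ j → c ≠ k → T i j k ∈ free c
  C_mem {i j c : ℕ} : i ≠ j → c ≠ i → c ≠ j → C i j ∈ free c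
  N_mem {i c : ℕ} : c ≠ i → N i ∈ free c
  E_mem {i c : ℕ} : c ≠ i → E i ∈ free c
  free_E {x : M} {c : ℕ} : x ∈ free c → Commute x (E c)
  free_N {x : M} {c : ℕ} : x ∈ free c → Commute x (N c)
  -- Ancillas can be removed: fixing the state of a wire loses no information about elements which
  -- do not touch it.
  cancel {x y : M} {c : ℕ} : x ∈ free c → y ∈ free c → E c * x = E c * y → x = y
  swap_eq {i j : ℕ} : i ≠ j → swap i j = C i j * C j i * C i j
  swap_T {i j a b c : ℕ} : i ≠ j → a ≠ b → a ≠ c → b ≠ c →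
    swap i j * T a b c = T (_root_.Equiv.swap i j a) (_root_.Equiv.swap i j b) (_root_.Equiv.swap i j c) * swap i j

namespace GateSystem

theorem exists_fresh (s : Finset ℕ) : ∃ c, c ∉ s := Infinite.exists_notMem_finset s

variable {M : Type*} [Monoid M] (g : GateSystem M)

/-- The projection of wire `i` to the state `0`. -/
def Z (i : ℕ) : M := g.N i * g.E i * g.N i

variable {g}

/-! ### Gates with fewer controls -/

/-- Setting a fresh wire `x` to `1` strips a control: it turns a Toffoli gate into a `cnot`, and a
`cnot` into a negation. As the projection can be cancelled next to elements free of `x`, identities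
between gates descend to gates with one control less. -/
theorem eq_of_semiconj {x : ℕ} {a b b' : M} (h : SemiconjBy (g.E x) a b)
    (h' : SemiconjBy (g.E x) a b') (m : b ∈ g.free x) (m' : b' ∈ g.free x) : b = b' :=
  g.cancel m m' (by rw [← (g.free_E m).eq, ← (g.free_E m').eq, ← h.eq, ← h'.eq])

theorem semiconj_T {x i j : ℕ} (hi : x ≠ i) (hj : x ≠ j) (h : i ≠ j) :
    SemiconjBy (g.E x) (g.T x i j) (g.C i j) :=
  (g.E_T hi hj h).trans (g.free_E (g.C_mem h hi hj)).eq.symm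

theorem semiconj_C {x i : ℕ} (h : x ≠ i) : SemiconjBy (g.E x) (g.C x i) (g.N i) :=
  (g.E_C h).trans (g.free_E (g.N_mem h)).eq.symm

theorem semiconj_self {x : ℕ} {a : M} (h : a ∈ g.free x) : SemiconjBy (g.E x) a a :=
  (g.free_E h).symm

theorem C_sq {i j : ℕ} (h : i ≠ j) : g.C i j * g.C i j = 1 := by
  obtain ⟨x, hx⟩ := exists_fresh {i, j}
  simp only [Finset.mem_insert, Finset.mem_singleton, not_or] at hx
  have m := g.C_mem h hx.1 hx.2
  have l := semiconj_T (g := g) hx.1 hx.2 h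
  refine eq_of_semiconj (l.mul_right l) ?_ (mul_mem m m) (one_mem _)
  rw [g.T_sq hx.1 hx.2 h]
  exact semiconj_self (one_mem _)

theorem commute_strip {x : ℕ} {a b c : M} (h : Commute a c) (l : SemiconjBy (g.E x) a b)
    (m : b ∈ g.free x) (m' : c ∈ g.free x) : Commute b c := by
  refine eq_of_semiconj (l.mul_right (semiconj_self m')) ?_ (mul_mem m m') (mul_mem m' m)
  rw [h.eq]
  exact (semiconj_self m').mul_right l

theorem C_comm_T {i j a b c : ℕ} (hij : i ≠ j) (hab : a ≠ b) (hac : a ≠ c) (hbc : b ≠ c)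
    (hja : j ≠ a) (hjb : j ≠ b) (hci : c ≠ i) : Commute (g.C i j) (g.T a b c) := by
  obtain ⟨x, hx⟩ := exists_fresh {i, j, a, b, c}
  simp only [Finset.mem_insert, Finset.mem_singleton, not_or] at hx
  obtain ⟨h1, h2, h3, h4, h5⟩ := hx
  exact commute_strip (g.T_comm h1 h2 hij hab hac hbc hja hjb (Ne.symm h5) hci)
    (semiconj_T h1 h2 hij) (g.C_mem hij h1 h2) (g.T_mem hab hac hbc h3 h4 h5)

theorem C_comm_C {i j a b : ℕ} (hij : i ≠ j) (hab : a ≠ b)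
    (hja : j ≠ a) (hbi : b ≠ i) : Commute (g.C i j) (g.C a b) := by
  obtain ⟨x, hx⟩ := exists_fresh {i, j, a, b}
  simp only [Finset.mem_insert, Finset.mem_singleton, not_or] at hx
  obtain ⟨h1, h2, h3, h4⟩ := hx
  exact (commute_strip (C_comm_T hij h3 h4 hab (Ne.symm h2) hja hbi).symm
    (semiconj_T h3 h4 hab) (g.C_mem hab h3 h4) (g.C_mem hij h1 h2)).symm

theorem N_comm_T {j a b c : ℕ} (hab : a ≠ b) (hac : a ≠ c) (hbc : b ≠ c)
    (hja : j ≠ a) (hjb : j ≠ b) : Commute (g.N j) (g.T a b c) := by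
  obtain ⟨x, hx⟩ := exists_fresh {j, a, b, c}
  simp only [Finset.mem_insert, Finset.mem_singleton, not_or] at hx
  obtain ⟨h1, h2, h3, h4⟩ := hx
  exact commute_strip (C_comm_T h1 hab hac hbc hja hjb (Ne.symm h4))
    (semiconj_C h1) (g.N_mem h1) (g.T_mem hab hac hbc h2 h3 h4)

theorem N_comm_C {j a b : ℕ} (hab : a ≠ b) (hja : j ≠ a) : Commute (g.N j) (g.C a b) := by
  obtain ⟨x, hx⟩ := exists_fresh {j, a, b}
  simp only [Finset.mem_insert, Finset.mem_singleton, not_or] at hx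
  obtain ⟨h1, h2, h3⟩ := hx
  exact commute_strip (C_comm_C h1 hab hja (Ne.symm h3))
    (semiconj_C h1) (g.N_mem h1) (g.C_mem hab h2 h3)

theorem N_comm_N (i j : ℕ) : Commute (g.N i) (g.N j) := by
  obtain ⟨x, hx⟩ := exists_fresh {i, j}
  simp only [Finset.mem_insert, Finset.mem_singleton, not_or] at hx
  obtain ⟨h1, h2⟩ := hx
  exact (commute_strip (N_comm_C h2 (Ne.symm h1)).symm
    (semiconj_C h2) (g.N_mem h2) (g.N_mem h1)).symm

/-- Conjugation of a Toffoli gate by the negation of a control. -/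
theorem N_T_N {b c d : ℕ} (hbc : b ≠ c) (hbd : b ≠ d) (hcd : c ≠ d) :
    g.N b * g.T b c d * g.N b = g.C c d * g.T b c d := by
  obtain ⟨x, hx⟩ := exists_fresh {b, c, d}
  simp only [Finset.mem_insert, Finset.mem_singleton, not_or] at hx
  obtain ⟨h1, h2, h3⟩ := hx
  have m := g.T_mem hbc hbd hcd h1 h2 h3
  have n := g.N_mem h1
  refine eq_of_semiconj (((semiconj_C h1).mul_right (semiconj_self m)).mul_right (semiconj_C h1))
    ?_ (mul_mem (mul_mem n m) n) (mul_mem (g.C_mem hcd h2 h3) m)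
  rw [g.C_T_C h1 h2 h3 hbc hbd hcd]
  exact (semiconj_T h2 h3 hcd).mul_right (semiconj_self m)

/-- `T_C_T` with one control of the outer gates stripped; stripping the other one gives `N_C_N`. -/
theorem C_C_C {b c d : ℕ} (hbc : b ≠ c) (hbd : b ≠ d) (hcd : c ≠ d) :
    g.C b c * g.C c d * g.C b c = g.C b d * g.C c d := by
  obtain ⟨x, hx⟩ := exists_fresh {b, c, d}
  simp only [Finset.mem_insert, Finset.mem_singleton, not_or] at hx
  obtain ⟨h1, h2, h3⟩ := hx
  have m := g.C_mem hcd h2 h3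
  have n := g.C_mem hbc h1 h2
  refine eq_of_semiconj (((semiconj_T h1 h2 hbc).mul_right (semiconj_self m)).mul_right
    (semiconj_T h1 h2 hbc)) ?_ (mul_mem (mul_mem n m) n) (mul_mem (g.C_mem hbd h1 h3) m)
  rw [g.T_C_T h1 h2 h3 hbc hbd hcd]
  exact (semiconj_T h1 h3 hbd).mul_right (semiconj_self m)

theorem N_C_N {c d : ℕ} (hcd : c ≠ d) :
    g.N c * g.C c d * g.N c = g.N d * g.C c d := by
  obtain ⟨x, hx⟩ := exists_fresh {c, d}
  simp only [Finset.mem_insert, Finset.mem_singleton, not_or] at hx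
  obtain ⟨h1, h2⟩ := hx
  have m := g.C_mem hcd h1 h2
  have n := g.N_mem h1
  refine eq_of_semiconj (((semiconj_C h1).mul_right (semiconj_self m)).mul_right
    (semiconj_C h1)) ?_ (mul_mem (mul_mem n m) n) (mul_mem (g.N_mem h2) m)
  rw [C_C_C h1 h2 hcd]
  exact (semiconj_C h2).mul_right (semiconj_self m)

theorem swap_mem {i j c : ℕ} (h : i ≠ j) (hi : c ≠ i) (hj : c ≠ j) : g.swap i j ∈ g.free c := by
  rw [g.swap_eq h]
  exact mul_mem (mul_mem (g.C_mem h hi hj) (g.C_mem h.symm hj hi)) (g.C_mem h hi hj)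

theorem swap_sq {i j : ℕ} (h : i ≠ j) : g.swap i j * g.swap i j = 1 := by
  rw [g.swap_eq h]
  have h1 := C_sq (g := g) h
  have h2 := C_sq (g := g) h.symm
  calc _ = g.C i j * (g.C j i * (g.C i j * g.C i j) * g.C j i) * g.C i j := by simp only [mul_assoc]
    _ = 1 := by rw [h1, mul_one, h2, mul_one, h1]

theorem swap_C {i j b c : ℕ} (h : i ≠ j) (hbc : b ≠ c) : g.swap i j * g.C b c =
    g.C (_root_.Equiv.swap i j b) (_root_.Equiv.swap i j c) * g.swap i j := by
  obtain ⟨x, hx⟩ := exists_fresh {i, j, b, c, _root_.Equiv.swap i j b, _root_.Equiv.swap i j c}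
  simp only [Finset.mem_insert, Finset.mem_singleton, not_or] at hx
  obtain ⟨h1, h2, h3, h4, h5, h6⟩ := hx
  have m := swap_mem (g := g) h h1 h2
  have hbc' : _root_.Equiv.swap i j b ≠ _root_.Equiv.swap i j c := fun e => hbc ((_root_.Equiv.swap i j).injective e)
  refine eq_of_semiconj ((semiconj_self m).mul_right (semiconj_T h3 h4 hbc)) ?_
    (mul_mem m (g.C_mem hbc h3 h4)) (mul_mem (g.C_mem hbc' h5 h6) m)
  rw [g.swap_T h h3 h4 hbc, _root_.Equiv.swap_apply_of_ne_of_ne h1 h2]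
  exact (semiconj_T h5 h6 hbc').mul_right (semiconj_self m)

theorem swap_N {i j c : ℕ} (h : i ≠ j) : g.swap i j * g.N c =
    g.N (_root_.Equiv.swap i j c) * g.swap i j := by
  obtain ⟨x, hx⟩ := exists_fresh {i, j, c, _root_.Equiv.swap i j c}
  simp only [Finset.mem_insert, Finset.mem_singleton, not_or] at hx
  obtain ⟨h1, h2, h4, h6⟩ := hx
  have m := swap_mem (g := g) h h1 h2
  refine eq_of_semiconj ((semiconj_self m).mul_right (semiconj_C h4)) ?_
    (mul_mem m (g.N_mem h4)) (mul_mem (g.N_mem h6) m)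
  rw [swap_C h h4, _root_.Equiv.swap_apply_of_ne_of_ne h1 h2]
  exact (semiconj_C h6).mul_right (semiconj_self m)

/-! ### Projections to the state `0` -/

theorem Z_mem {i c : ℕ} (h : c ≠ i) : g.Z i ∈ g.free c :=
  mul_mem (mul_mem (g.N_mem h) (g.E_mem h)) (g.N_mem h)

theorem free_Z {x : M} {c : ℕ} (h : x ∈ g.free c) : Commute x (g.Z c) :=
  ((g.free_N h).mul_right (g.free_E h)).mul_right (g.free_N h)

theorem N_Z (i : ℕ) : g.N i * g.Z i = g.E i * g.N i := by
  rw [Z, ← mul_assoc, ← mul_assoc, g.N_N, one_mul]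

/-- Negating wire `c` turns the projection to `0` into the projection to `1`, and commutes with the
elements free of `c`. -/
theorem cancel_Z {x y : M} {c : ℕ} (hx : x ∈ g.free c) (hy : y ∈ g.free c)
    (h : g.Z c * x = g.Z c * y) : x = y := by
  refine g.cancel hx hy ?_
  have h1 := congrArg (fun z => g.N c * z * g.N c) h
  simp only [← mul_assoc, N_Z] at h1
  rw [mul_assoc (_ * _), mul_assoc (_ * _), g.free_N hx, g.free_N hy] at h1
  simpa only [mul_assoc, ← mul_assoc (g.N c) (g.N c), g.N_N, one_mul] using h1

theorem Z_Z (i : ℕ) : g.Z i * g.Z i = g.Z i := by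
  calc _ = g.N i * (g.E i * (g.N i * g.N i) * g.E i) * g.N i := by simp only [Z, mul_assoc]
    _ = g.Z i := by rw [g.N_N, mul_one, g.E_E, Z]

theorem Z_comm_Z (i j : ℕ) : Commute (g.Z i) (g.Z j) := by
  rcases eq_or_ne i j with rfl | h
  · exact Commute.refl _
  · exact free_Z (Z_mem h.symm)

theorem Z_C {i j : ℕ} (h : i ≠ j) : g.Z i * g.C i j = g.Z i := by
  obtain ⟨x, hx⟩ := exists_fresh {i, j}
  simp only [Finset.mem_insert, Finset.mem_singleton, not_or] at hx
  obtain ⟨h1, h2⟩ := hx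
  have m := Z_mem (g := g) h1
  refine eq_of_semiconj ((semiconj_self m).mul_right (semiconj_T h1 h2 h)) ?_
    (mul_mem m (g.C_mem h h1 h2)) m
  rw [g.T_symm h1 h2 h, Z, g.Z_T (Ne.symm h1) h h2]
  exact semiconj_self m

theorem E_comm_T {i j k : ℕ} (hi : i ≠ j) (hj : i ≠ k) (h : j ≠ k) :
    Commute (g.E i) (g.T i j k) := (g.E_T hi hj h).trans (g.T_E hi hj h).symm

theorem Z_comm_T {i j k : ℕ} (hi : i ≠ j) (hj : i ≠ k) (h : j ≠ k) :
    Commute (g.Z i) (g.T i j k) := (g.Z_T hi hj h).trans (g.T_Z hi hj h).symm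

end GateSystem


/-! ### Negations with arbitrarily many controls -/

namespace GateSystem

variable {M : Type*} [Monoid M] (g : GateSystem M)

/-- The negation of wire `t` controlled by the wires of the list `l`. -/
def ctrlList : List ℕ → ℕ → M
  | [], t => g.N t
  | i :: l, t =>
    -- The auxiliary wire `l.sum + i + t + 1` exceeds `i`, `t` and all members of `l`. Its initial
    -- state does not matter: the two Toffoli gates add the product of `i` and the change of the
    -- auxiliary wire to `t`.
    ctrlList l (l.sum + i + t + 1) * g.T (l.sum + i + t + 1) i t *
      (ctrlList l (l.sum + i + t + 1) * g.T (l.sum + i + t + 1) i t)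

/-- `x` commutes with the gates whose target is not in `F` and whose controls are not in `K`. -/
structure Acts (x : M) (F K : Finset ℕ) : Prop where
  comm_T {a b s : ℕ} : a ≠ b → a ≠ s → b ≠ s → s ∉ F → a ∉ K → b ∉ K → Commute x (g.T a b s)
  comm_N {s : ℕ} : s ∉ F → Commute x (g.N s)

variable {g}

/-- In `Acts` the first set contains the wires that are read, hence may not be targets of the other
gate; the second contains the wires that are changed, hence may not be its controls. -/
theorem acts_T {i j k : ℕ} (hij : i ≠ j) (hik : i ≠ k) (hjk : j ≠ k) :
    g.Acts (g.T i j k) {i, j} {k} where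
  comm_T h1 h2 h3 h4 h5 h6 := by
    simp only [Finset.mem_insert, Finset.mem_singleton, not_or] at h4 h5 h6
    exact g.T_comm hij hik hjk h1 h2 h3 (Ne.symm h5) (Ne.symm h6) h4.1 h4.2
  comm_N h := by
    simp only [Finset.mem_insert, Finset.mem_singleton, not_or] at h
    exact (N_comm_T hij hik hjk h.1 h.2).symm

theorem acts_C {i k : ℕ} (hik : i ≠ k) : g.Acts (g.C i k) {i} {k} where
  comm_T h1 h2 h3 h4 h5 h6 := by
    simp only [Finset.mem_singleton] at h4 h5 h6
    exact C_comm_T hik h1 h2 h3 (Ne.symm h5) (Ne.symm h6) h4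
  comm_N h := by
    simp only [Finset.mem_singleton] at h
    exact (N_comm_C hik h).symm

theorem acts_N (k : ℕ) : g.Acts (g.N k) ∅ {k} where
  comm_T h1 h2 h3 h4 h5 h6 := by
    simp only [Finset.mem_singleton] at h5 h6
    exact N_comm_T h1 h2 h3 (Ne.symm h5) (Ne.symm h6)
  comm_N _ := N_comm_N _ _

theorem acts_E (i : ℕ) : g.Acts (g.E i) {i} ∅ where
  comm_T {a b s} h1 h2 h3 h4 h5 h6 := by
    simp only [Finset.mem_singleton] at h4
    by_cases ha : a = i
    · subst ha; exact E_comm_T h1 h2 h3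
    by_cases hb : b = i
    · subst hb; rw [g.T_symm h1 h2 h3]; exact E_comm_T h1.symm h3 h2
    exact (g.free_E (g.T_mem h1 h2 h3 (Ne.symm ha) (Ne.symm hb) (Ne.symm h4))).symm
  comm_N h := by
    simp only [Finset.mem_singleton] at h
    exact (g.free_E (g.N_mem (Ne.symm h))).symm

theorem acts_Z (i : ℕ) : g.Acts (g.Z i) {i} ∅ where
  comm_T {a b s} h1 h2 h3 h4 h5 h6 := by
    simp only [Finset.mem_singleton] at h4
    by_cases ha : a = i
    · subst ha; exact Z_comm_T h1 h2 h3
    by_cases hb : b = i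
    · subst hb; rw [g.T_symm h1 h2 h3]; exact Z_comm_T h1.symm h3 h2
    exact (free_Z (g.T_mem h1 h2 h3 (Ne.symm ha) (Ne.symm hb) (Ne.symm h4))).symm
  comm_N h := by
    simp only [Finset.mem_singleton] at h
    exact (free_Z (g.N_mem (Ne.symm h))).symm

/-- Think of `u`, `v` as the same controlled negation on two auxiliary wires, of `c` as the `cnot`
from the first wire to the second, and of `s`, `r` as the Toffoli gates controlled by these wires.
Conjugating `s * r = c * r * c` by `u` in two ways, directly and by pushing `u` through `c`, gives
`u * s * u * r = s * (v * r * v)`; finally `s` commutes with `v * r * v * r`. -/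
theorem commutator_eq {u v c s r : M} (h : u * c * u = v * c) (hu : u * u = 1) (hv : v * v = 1)
    (hc : c * c = 1) (hs : s * s = 1) (hr : r * r = 1) (hcr : c * r * c = s * r)
    (ur : Commute u r) (vs : Commute v s) (sr : Commute s r) :
    u * s * (u * s) = v * r * (v * r) := by
  have hvc : v * c = c * v := by
    have h1 : v * c * (v * c) = 1 := by
      rw [← h]
      calc _ = u * (c * (u * u) * c) * u := by simp only [mul_assoc]
        _ = 1 := by rw [hu, mul_one, hc, mul_one, hu]
    calc v * c = (v * c) * (v * (c * c) * v) := by rw [hc, mul_one, hv, mul_one]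
      _ = (v * c * (v * c)) * (c * v) := by simp only [mul_assoc]
      _ = c * v := by rw [h1, one_mul]
  have uc : u * c = v * c * u := by rw [← h, mul_assoc _ u, hu, mul_one]
  have cu : c * u = u * c * v := by
    rw [mul_assoc, ← hvc, ← h, ← mul_assoc, ← mul_assoc, hu, one_mul]
  have key : u * s * u * r = s * (v * r * v) := by
    calc u * s * u * r = u * (s * r) * u := by rw [mul_assoc _ u, ur.eq]; simp only [mul_assoc]
      _ = (u * c) * r * (c * u) := by rw [← hcr]; simp only [mul_assoc]
      _ = v * c * (u * r * u) * c * v := by rw [uc, cu]; simp only [mul_assoc]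
      _ = v * (c * r * c) * v := by rw [ur.eq, mul_assoc r, hu, mul_one]; simp only [mul_assoc]
      _ = s * (v * r * v) := by rw [hcr, ← mul_assoc v, vs.eq]; simp only [mul_assoc]
  have e : Commute s (v * r * v * r) := ((vs.symm.mul_right sr).mul_right vs.symm).mul_right sr
  calc u * s * (u * s) = u * s * u * (r * r) * s := by rw [hr]; simp only [mul_assoc, mul_one]
    _ = (s * (v * r * v * r)) * s := by rw [← mul_assoc, key]; simp only [mul_assoc]
    _ = v * r * (v * r) := by rw [e.eq, mul_assoc _ s, hs, mul_one]; simp only [mul_assoc]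

variable (g) in
/-- The basic properties of the negation controlled by `l`. -/
structure Good (l : List ℕ) : Prop where
  sq {t : ℕ} : t ∉ l → g.ctrlList l t * g.ctrlList l t = 1
  copy {a t : ℕ} : a ∉ l → t ∉ l → a ≠ t →
    g.ctrlList l a * g.C a t * g.ctrlList l a = g.ctrlList l t * g.C a t
  comm {x : M} {F K : Finset ℕ} {t : ℕ} : g.Acts x F K → t ∉ F → t ∉ l → (∀ k ∈ K, k ∉ l) →
    Commute x (g.ctrlList l t)

/-- The particular auxiliary wire of the definition is immaterial: `commutator_eq`, applied with the
`cnot` from that wire `d` to `c`, permits any fresh wire in its place. -/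
theorem Good.step {l : List ℕ} (h : g.Good l) {i t c : ℕ} (ht : t ∉ l) (hc : c ∉ l)
    (hit : i ≠ t) (hci : c ≠ i) (hct : c ≠ t) :
    g.ctrlList (i :: l) t = g.ctrlList l c * g.T c i t * (g.ctrlList l c * g.T c i t) := by
  rw [ctrlList]
  set d := l.sum + i + t + 1 with hd
  have hdl : d ∉ l := fun h => by have := List.le_sum_of_mem h; omega
  rcases eq_or_ne d c with e | hdc
  · rw [e]
  have hdi : d ≠ i := by omega
  have hdt : d ≠ t := by omega
  refine commutator_eq (h.copy hdl hc hdc) (h.sq hdl) (h.sq hc) (C_sq hdc) (g.T_sq hdi hdt hit)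
    (g.T_sq hci hct hit) (g.C_T_C hdc hdi hdt hci hct hit) ?_ ?_ ?_
  · refine (h.comm (acts_T hci hct hit) ?_ hdl ?_).symm
    · simp [hdc, hdi]
    · simpa using ht
  · refine (h.comm (acts_T hdi hdt hit) ?_ hc ?_).symm
    · simp [hdc.symm, hci]
    · simpa using ht
  · exact g.T_comm hdi hdt hit hci hct hit hct.symm hit.symm hdt.symm hit.symm

theorem Good.conj {l : List ℕ} (h : g.Good l) {i t c : ℕ} (ht : t ∉ l) (hc : c ∉ l)
    (hit : i ≠ t) (hci : c ≠ i) (hct : c ≠ t) :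
    g.ctrlList l c * g.T c i t * g.ctrlList l c = g.ctrlList (i :: l) t * g.T c i t := by
  rw [h.step ht hc hit hci hct, mul_assoc _ _ (g.T c i t), mul_assoc _ _ (g.T c i t),
    g.T_sq hci hct hit, mul_one]

theorem good_nil : g.Good [] where
  sq _ := g.N_N _
  copy _ _ h := N_C_N h
  comm h ht _ _ := h.comm_N ht

theorem Good.acts {l : List ℕ} (h : g.Good l) {t : ℕ} (ht : t ∉ l) :
    g.Acts (g.ctrlList l t) l.toFinset {t} where
  comm_T {a b s} h1 h2 h3 h4 h5 h6 := by
    simp only [List.mem_toFinset, Finset.mem_singleton] at h4 h5 h6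
    refine (h.comm (acts_T h1 h2 h3) ?_ ht ?_).symm
    · simp [Ne.symm h5, Ne.symm h6]
    · simpa using h4
  comm_N {s} hs := by
    refine (h.comm (acts_N s) (by simp) ht ?_).symm
    simpa using hs

/-- The three properties are proved together since each step of the induction uses all of them:
`Good.step` rests on `sq`, `copy` and `comm` for the shorter list. -/
theorem Good.cons {l : List ℕ} (h : g.Good l) (i : ℕ) : g.Good (i :: l) := by
  have comm : ∀ {x : M} {F K : Finset ℕ} {t : ℕ}, g.Acts x F K → t ∉ F → t ∉ i :: l →
      (∀ k ∈ K, k ∉ i :: l) → Commute x (g.ctrlList (i :: l) t) := by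
    intro x F K t hx htF htl hK
    -- The auxiliary wire is also kept away from the wires which `x` reads or changes, so that `x`
    -- commutes with each factor of the commutator.
    obtain ⟨c, hc⟩ := exists_fresh (F ∪ K ∪ l.toFinset ∪ {i, t})
    simp only [Finset.mem_union, List.mem_toFinset, Finset.mem_insert, Finset.mem_singleton,
      not_or] at hc
    obtain ⟨⟨⟨c1, c2⟩, c3⟩, c4, c5⟩ := hc
    simp only [List.mem_cons, not_or] at htl
    rw [h.step htl.2 c3 (Ne.symm htl.1) c4 c5]
    have e1 := h.comm hx c1 c3 fun k hk => fun h => hK k hk (List.mem_cons_of_mem _ h)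
    have e2 := hx.comm_T c4 c5 (Ne.symm htl.1) htF c2 fun hk => hK i hk List.mem_cons_self
    exact (e1.mul_right e2).mul_right (e1.mul_right e2)
  have sq : ∀ {t}, t ∉ i :: l → g.ctrlList (i :: l) t * g.ctrlList (i :: l) t = 1 := by
    intro t ht
    obtain ⟨c, hc⟩ := exists_fresh (l.toFinset ∪ {i, t})
    simp only [Finset.mem_union, List.mem_toFinset, Finset.mem_insert, Finset.mem_singleton,
      not_or] at hc
    obtain ⟨c1, c2, c3⟩ := hc
    have ht' := ht
    simp only [List.mem_cons, not_or] at ht'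
    have hit := Ne.symm ht'.1
    -- With `w` the new gate, `w * T` is conjugate to the involution `T`. Hence `w` is an involution
    -- as soon as it commutes with `T`.
    have e : Commute (g.T c i t) (g.ctrlList (i :: l) t) := by
      refine comm (acts_T c2 c3 hit) ?_ ht ?_
      · simp [Ne.symm c3, hit.symm]
      · simpa using ht'
    have e1 := h.conj ht'.2 c1 hit c2 c3
    have hT := g.T_sq c2 c3 hit
    have hv := h.sq c1
    set w := g.ctrlList (i :: l) t
    set T := g.T c i t
    set v := g.ctrlList l c
    calc w * w = w * w * (T * T) := by rw [hT, mul_one]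
      _ = w * T * (w * T) := by rw [mul_assoc w T, ← mul_assoc T w, e.eq]; simp only [mul_assoc]
      _ = v * (T * (v * v) * T) * v := by rw [← e1]; simp only [mul_assoc]
      _ = 1 := by rw [hv, mul_one, hT, mul_one, hv]
  refine ⟨sq, ?_, comm⟩
  intro a t ha ht hat
  obtain ⟨e, he⟩ := exists_fresh (l.toFinset ∪ {i, t, a})
  simp only [Finset.mem_union, List.mem_toFinset, Finset.mem_insert, Finset.mem_singleton,
    not_or] at he
  obtain ⟨e1, e2, e3, e4⟩ := he
  have ha' := ha
  have ht' := ht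
  simp only [List.mem_cons, not_or] at ha' ht'
  have hia := Ne.symm ha'.1
  have hit := Ne.symm ht'.1
  have hv := h.sq e1
  have hT := g.T_sq e2 e4 hia
  have hT' := g.T_sq e2 e3 hit
  have hTT' : Commute (g.T e i t) (g.T e i a) :=
    g.T_comm e2 e3 hit e2 e4 hia (Ne.symm e3) hit.symm (Ne.symm e4) hia.symm
  have hTC : g.T e i a * g.C a t * g.T e i a = g.T e i t * g.C a t :=
    g.T_C_T e2 e4 e3 hia hit hat
  have hw := h.step ha'.2 e1 hia e2 e4
  have hw' := sq ha
  have hs := h.conj ht'.2 e1 hit e2 e3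
  have hvC : Commute (g.ctrlList l e) (g.C a t) := by
    refine (h.comm (acts_C hat) ?_ e1 ?_).symm
    · simpa using e4
    · simpa using ht'.2
  have hTw : Commute (g.T e i a) (g.ctrlList (i :: l) t) := by
    refine comm (acts_T e2 e4 hia) ?_ ht ?_
    · simp [Ne.symm e3, hit.symm]
    · simpa using ha'
  have hvw : Commute (g.ctrlList l e) (g.ctrlList (i :: l) t) := by
    refine comm (h.acts e1) ?_ ht ?_
    · simpa using ht'.2
    · simp [e1, e2]
  set w := g.ctrlList (i :: l) t
  set wa := g.ctrlList (i :: l) a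
  set T := g.T e i a
  set T' := g.T e i t
  set v := g.ctrlList l e
  set C := g.C a t
  have hCT : C * T = T * T' * C := by
    rw [mul_assoc, ← hTC]; simp only [← mul_assoc, hT, one_mul]
  -- The factor `wa` to the left of `C` is expanded as the commutator and the one to the right as
  -- its inverse, so that the Toffoli gates meet at `C` and `tof14`, in the form `hTC`, applies.
  have hwa : wa = T * v * (T * v) := by
    have : wa * (T * v * (T * v)) = 1 := by
      rw [hw]
      calc _ = v * (T * (v * (T * T) * v) * T) * v := by simp only [mul_assoc]
        _ = 1 := by rw [hT, mul_one, hv, mul_one, hT, mul_one, hv]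
    calc wa = wa * (wa * (T * v * (T * v))) := by rw [this, mul_one]
      _ = _ := by rw [← mul_assoc, hw', one_mul]
  calc wa * C * wa = (v * T * (v * T)) * C * (T * v * (T * v)) := by rw [← hwa, ← hw]
    _ = v * T * v * (T * C * T) * v * T * v := by simp only [mul_assoc]
    _ = v * T * v * T' * (C * v) * T * v := by rw [hTC]; simp only [mul_assoc]
    _ = v * T * (v * T' * v) * (C * T) * v := by rw [← hvC.eq]; simp only [mul_assoc]
    _ = v * T * w * (T' * T) * T' * (C * v) := by rw [hs, hCT]; simp only [mul_assoc]
    _ = v * (T * w) * T * (T' * T') * (v * C) := by rw [hTT'.eq, hvC.eq]; simp only [mul_assoc]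
    _ = v * w * (T * T) * v * C := by rw [hT', hTw.eq]; simp only [mul_assoc, mul_one]
    _ = w * C := by rw [hT, mul_one, hvw.eq, mul_assoc w, hv, mul_one]

theorem good (l : List ℕ) : g.Good l := by
  induction l with
  | nil => exact good_nil
  | cons i l ih => exact ih.cons i

end GateSystem


/-! ### Independence of the order of the controls -/

namespace GateSystem

variable {M : Type*} [Monoid M] {g : GateSystem M}

theorem ctrlList_one {i t : ℕ} (h : i ≠ t) : g.ctrlList [i] t = g.C i t := by
  obtain ⟨c, hc⟩ := exists_fresh {i, t}
  simp only [Finset.mem_insert, Finset.mem_singleton, not_or] at hc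
  rw [good_nil.step (by simp) (by simp) h hc.1 hc.2, ← mul_assoc]
  change g.N c * g.T c i t * g.N c * g.T c i t = _
  rw [N_T_N hc.1 hc.2 h, mul_assoc, g.T_sq hc.1 hc.2 h, mul_one]

/-- The commutator of a `cnot` with a Toffoli gate is evaluated by `C_T_C`. -/
theorem ctrlList_two {i j t : ℕ} (hij : i ≠ j) (hi : i ≠ t) (hj : j ≠ t) :
    g.ctrlList [i, j] t = g.T j i t := by
  obtain ⟨c, hc⟩ := exists_fresh {i, j, t}
  simp only [Finset.mem_insert, Finset.mem_singleton, not_or] at hc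
  obtain ⟨h1, h2, h3⟩ := hc
  rw [(good (g := g) [j]).step (by simpa using hj.symm) (by simpa using h2) hi h1 h3,
    ← mul_assoc, ctrlList_one (Ne.symm h2),
    g.C_T_C (Ne.symm h2) hij.symm hj h1 h3 hi, mul_assoc, g.T_sq h1 h3 hi, mul_one]

theorem ctrlList_mem {l : List ℕ} (hl : l.Nodup) {t x : ℕ} (ht : t ∉ l) (hx : x ∉ l)
    (hxt : x ≠ t) : g.ctrlList l t ∈ g.free x := by
  induction l generalizing t with
  | nil => exact g.N_mem hxt
  | cons i l ih =>
    obtain ⟨c, hc⟩ := exists_fresh (l.toFinset ∪ {i, t, x})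
    simp only [Finset.mem_union, List.mem_toFinset, Finset.mem_insert, Finset.mem_singleton,
      not_or] at hc
    obtain ⟨h1, h2, h3, h4⟩ := hc
    rw [List.nodup_cons] at hl
    simp only [List.mem_cons, not_or] at ht hx
    rw [(good l).step ht.2 h1 (Ne.symm ht.1) h2 h3]
    have m1 := ih hl.2 h1 hx.2 (Ne.symm h4)
    have m2 := g.T_mem h2 h3 (Ne.symm ht.1) (Ne.symm h4) hx.1 hxt
    exact mul_mem (mul_mem m1 m2) (mul_mem m1 m2)

/-- If the auxiliary wire `c` is in state `0`, the last Toffoli gate of the commutator does nothing,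
and what is left is the three-gate product of `triple_symm`. This is the only use of that identity,
and so of `tof17`; the ancilla is then cancelled. -/
theorem ctrlList_three {i j d t : ℕ} (hij : i ≠ j) (hid : i ≠ d) (hit : i ≠ t) (hjd : j ≠ d)
    (hjt : j ≠ t) (hdt : d ≠ t) : g.ctrlList [i, j, d] t = g.ctrlList [j, i, d] t := by
  obtain ⟨c, hc⟩ := exists_fresh {i, j, d, t}
  simp only [Finset.mem_insert, Finset.mem_singleton, not_or] at hc
  obtain ⟨h1, h2, h3, h4⟩ := hc
  have m1 : g.ctrlList [i, j, d] t ∈ g.free c :=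
    ctrlList_mem (by simp [*]) (by simp [Ne.symm, *]) (by simp [*]) h4
  have m2 : g.ctrlList [j, i, d] t ∈ g.free c :=
    ctrlList_mem (by simp [Ne.symm, *]) (by simp [Ne.symm, *]) (by simp [*]) h4
  have key : ∀ {i j : ℕ}, i ≠ j → i ≠ d → i ≠ t → j ≠ d → j ≠ t → c ≠ i → c ≠ j →
      g.ctrlList [i, j, d] t ∈ g.free c → 
      g.Z c * g.T d j c * g.T c i t * g.T d j c * g.Z c = g.Z c * g.ctrlList [i, j, d] t := by
    intro i j hij hid hit hjd hjt h1 h2 m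
    have e := (good (g := g) [j, d]).conj (i := i) (t := t) (c := c)
      (by simp [Ne.symm, *]) (by simp [*]) hit h1 h4
    rw [ctrlList_two hjd (Ne.symm h2) (Ne.symm h3)] at e
    have hz : g.Z c * g.T c i t = g.Z c := g.Z_T h1 h4 hit
    calc _ = g.Z c * (g.T d j c * g.T c i t * g.T d j c) * g.Z c := by simp only [mul_assoc]
      _ = (g.Z c * g.ctrlList [i, j, d] t) * (g.T c i t * g.Z c) := by
        rw [e]; simp only [mul_assoc]
      _ = g.Z c * g.ctrlList [i, j, d] t := by
        rw [(Z_comm_T h1 h4 hit).symm.eq, hz, mul_assoc, (free_Z m).eq, ← mul_assoc, Z_Z]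
  refine cancel_Z m1 m2 ?_
  rw [← key hij hid hit hjd hjt h1 h2 m1, ← key hij.symm hjd hjt hid hit h2 h1 m2]
  exact g.triple_symm hjd.symm (Ne.symm h3) hid.symm hdt (Ne.symm h2) hij.symm hjt h1 h4 hit

/-- The common tail `l` is replaced by a single auxiliary wire `d`, which reduces the exchange of
`i` and `j` to three controls. -/
theorem ctrlList_swap {i j t : ℕ} {l : List ℕ} (hi : i ∉ l) (hj : j ∉ l)
    (ht : t ∉ l) (hij : i ≠ j) (hit : i ≠ t) (hjt : j ≠ t) :
    g.ctrlList (i :: j :: l) t = g.ctrlList (j :: i :: l) t := by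
  obtain ⟨d, hd⟩ := exists_fresh (l.toFinset ∪ {i, j, t})
  simp only [Finset.mem_union, List.mem_toFinset, Finset.mem_insert, Finset.mem_singleton,
    not_or] at hd
  obtain ⟨d1, d2, d3, d4⟩ := hd
  have key : ∀ {i j : ℕ}, i ∉ l → j ∉ l → i ≠ j → i ≠ t → j ≠ t → d ≠ i → d ≠ j →
      g.ctrlList (i :: j :: l) t = g.ctrlList [i, j, d] t * g.ctrlList l d *
        (g.ctrlList [i, j, d] t * g.ctrlList l d) := by
    clear! i j
    intro i j hi hj hij hit hjt d2 d3
    obtain ⟨c, hc⟩ := exists_fresh (l.toFinset ∪ {i, j, t, d})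
    simp only [Finset.mem_union, List.mem_toFinset, Finset.mem_insert, Finset.mem_singleton,
      not_or] at hc
    obtain ⟨c1, c2, c3, c4, c5⟩ := hc
    -- A second auxiliary wire: when `v * X * v` is expanded through `b` in place of `c`, it visibly
    -- commutes with `τ`, whose target is `c`. This is `hQ`.
    obtain ⟨b, hb⟩ := exists_fresh (l.toFinset ∪ {i, j, t, d, c})
    simp only [Finset.mem_union, List.mem_toFinset, Finset.mem_insert, Finset.mem_singleton,
      not_or] at hb
    obtain ⟨b1, b2, b3, b4, b5, b6⟩ := hb
    have g2 : g.Good [j, d] := good _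
    have hv := (good (g := g) l).sq d1
    have hT := g.T_sq c2 c4 hit
    have e1 := (good (g := g) (j :: l)).step (i := i) (t := t) (c := c) (by simp [Ne.symm, *])
      (by simp [*]) hit c2 c4
    have e2 := (good (g := g) l).step (i := j) (t := c) (c := d) c1 d1 (Ne.symm c3) d3 (Ne.symm c5)
    have e2b := (good (g := g) l).conj (i := j) (t := b) (c := d) b1 d1 (Ne.symm b3) d3 (Ne.symm b5)
    have e2s := (good (g := g) (j :: l)).sq (t := c) (by simp [*])
    have e3 := g2.conj (i := i) (t := t) (c := c)
      (by simp [Ne.symm, *]) (by simp [*]) hit c2 c4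
    have e3b := g2.step (i := i) (t := t) (c := b)
      (by simp [Ne.symm, *]) (by simp [*]) hit b2 b4
    rw [ctrlList_two (Ne.symm d3) (Ne.symm c3) (Ne.symm c5)] at e3
    rw [ctrlList_two (Ne.symm d3) (Ne.symm b3) (Ne.symm b5)] at e3b
    have vT : ∀ {c}, c ∉ l → c ≠ i → c ≠ t → c ≠ d → Commute (g.T c i t) (g.ctrlList l d) := by
      intro c c1 c2 c4 c5
      refine (good l).comm (acts_T c2 c4 hit) ?_ d1 ?_
      · simp [Ne.symm c5, d2]
      · simpa using ht
    have vTc := vT c1 c2 c4 c5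
    have vTb := vT b1 b2 b4 b5
    have tw : Commute (g.T d j c) (g.ctrlList (j :: l) b) := by
      refine (good (j :: l)).comm (acts_T d3 (Ne.symm c5) (Ne.symm c3)) ?_ ?_ ?_
      · simp [b5, b3]
      · simp [b3, b1]
      · simp [c3, c1]
    have tt : Commute (g.T d j c) (g.T d j b) :=
      g.T_comm d3 (Ne.symm c5) (Ne.symm c3) d3 (Ne.symm b5) (Ne.symm b3) c5 c3 b5 b3
    have tT : Commute (g.T d j c) (g.T b i t) :=
      g.T_comm d3 (Ne.symm c5) (Ne.symm c3) b2 b4 hit (Ne.symm b6) c2 (Ne.symm d4) hjt.symm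
    set w := g.ctrlList (j :: l) c
    set v := g.ctrlList l d
    set τ := g.T d j c
    set T := g.T c i t
    set X := g.ctrlList [i, j, d] t
    have hτ : τ * τ = 1 := g.T_sq d3 (Ne.symm c5) (Ne.symm c3)
    have hw : w = τ * v * (τ * v) := by
      have : w * (τ * v * (τ * v)) = 1 := by
        rw [e2]
        calc _ = v * (τ * (v * (τ * τ) * v) * τ) * v := by simp only [mul_assoc]
          _ = 1 := by rw [hτ, mul_one, hv, mul_one, hτ, mul_one, hv]
      calc w = w * (w * (τ * v * (τ * v))) := by rw [this, mul_one]
        _ = _ := by rw [← mul_assoc, e2s, one_mul]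
    have hQ : Commute τ (v * X * v) := by
      have : v * X * v = (g.ctrlList (j :: l) b * g.T d j b) * g.T b i t *
          (g.ctrlList (j :: l) b * g.T d j b) * g.T b i t := by
        rw [← e2b, e3b]
        calc _ = v * g.T d j b * (1 * g.T b i t) * g.T d j b * (g.T b i t * v) := by
              simp only [mul_assoc, one_mul]
          _ = v * g.T d j b * v * (v * g.T b i t) * g.T d j b * v * g.T b i t := by
              rw [← hv, vTb.eq]; simp only [mul_assoc]
          _ = _ := by rw [← vTb.eq]; simp only [mul_assoc]
      rw [this]
      exact (((tw.mul_right tt).mul_right tT).mul_right (tw.mul_right tt)).mul_right tT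
    calc g.ctrlList (i :: j :: l) t = w * T * w * T := by rw [e1]; simp only [mul_assoc]
      _ = v * τ * (v * (τ * T * τ)) * v * τ * v * T := by
          conv_lhs => arg 1; arg 2; rw [hw]
          rw [e2]; simp only [mul_assoc]
      _ = v * τ * (v * X) * (T * v) * τ * v * T := by rw [e3]; simp only [mul_assoc]
      _ = v * (τ * (v * X * v)) * T * τ * v * T := by rw [vTc.eq]; simp only [mul_assoc]
      _ = v * v * X * v * (τ * T * τ) * v * T := by rw [hQ.eq]; simp only [mul_assoc]
      _ = X * v * X * (T * v) * T := by rw [e3, hv, one_mul]; simp only [mul_assoc]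
      _ = X * v * (X * v) * (T * T) := by rw [vTc.eq]; simp only [mul_assoc]
      _ = X * v * (X * v) := by rw [hT, mul_one]
  rw [key hi hj hij hit hjt d2 d3, key hj hi hij.symm hjt hit d3 d2,
    ctrlList_three hij (Ne.symm d2) hit (Ne.symm d3) hjt d4]

theorem ctrlList_perm {l l' : List ℕ} (h : l.Perm l') (hl : l.Nodup) {t : ℕ} (ht : t ∉ l) :
    g.ctrlList l t = g.ctrlList l' t := by
  induction h generalizing t with
  | nil => rfl
  | @cons i l l' h ih =>
    rw [List.nodup_cons] at hl
    simp only [List.mem_cons, not_or] at ht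
    obtain ⟨c, hc⟩ := exists_fresh (l.toFinset ∪ {i, t})
    simp only [Finset.mem_union, List.mem_toFinset, Finset.mem_insert, Finset.mem_singleton,
      not_or] at hc
    obtain ⟨c1, c2, c3⟩ := hc
    rw [(good l).step ht.2 c1 (Ne.symm ht.1) c2 c3, (good l').step
      (fun e => ht.2 (h.mem_iff.2 e)) (fun e => c1 (h.mem_iff.2 e)) (Ne.symm ht.1) c2 c3, ih hl.2 c1]
  | swap i j l =>
    simp only [List.nodup_cons, List.mem_cons, not_or] at hl ht
    exact ctrlList_swap hl.1.2 hl.2.1 ht.2.2 hl.1.1 (Ne.symm ht.1) (Ne.symm ht.2.1)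
  | trans h h' ih ih' =>
    exact (ih hl ht).trans (ih' (h.nodup_iff.1 hl) fun e => ht (h.mem_iff.2 e))

end GateSystem


/-! ### Finite sets of controls, and conjugation of controlled negations -/

namespace GateSystem

variable {M : Type*} [Monoid M] (g : GateSystem M)

/-- The negation of wire `t` controlled by the wires in `S`. -/
noncomputable def ctrl (S : Finset ℕ) (t : ℕ) : M := g.ctrlList S.toList t

variable {g} {S S' L : Finset ℕ} {t i j c s : ℕ}

theorem ctrl_eq_ctrlList {l : List ℕ} (hl : l.Nodup) (ht : t ∉ l) (h : l.toFinset = S) :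
    g.ctrl S t = g.ctrlList l t := by
  subst h
  refine (ctrlList_perm ?_ hl ht).symm
  rw [← Multiset.coe_eq_coe, Finset.coe_toList, List.toFinset_val, hl.dedup]

theorem ctrl_empty (t : ℕ) : g.ctrl ∅ t = g.N t :=
  ctrl_eq_ctrlList (l := []) (by simp) (by simp) (by simp)

theorem ctrl_singleton (h : i ≠ t) : g.ctrl {i} t = g.C i t := by
  rw [← ctrlList_one h]
  exact ctrl_eq_ctrlList (by simp) (by simpa using h.symm) (by simp)

theorem ctrl_pair (hij : i ≠ j) (hi : i ≠ t) (hj : j ≠ t) : g.ctrl {i, j} t = g.T i j t := by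
  rw [g.T_symm hij hi hj, ← ctrlList_two hij hi hj]
  exact ctrl_eq_ctrlList (by simpa using hij) (by simp [hi.symm, hj.symm]) (by simp)

theorem ctrl_sq (h : t ∉ S) : g.ctrl S t * g.ctrl S t = 1 := (good _).sq (by simpa using h)

theorem ctrl_copy {a : ℕ} (ha : a ∉ S) (ht : t ∉ S) (h : a ≠ t) :
    g.ctrl S a * g.C a t * g.ctrl S a = g.ctrl S t * g.C a t :=
  (good _).copy (by simpa using ha) (by simpa using ht) h

theorem Acts.comm_ctrl {x : M} {F K : Finset ℕ} (hx : g.Acts x F K) (htF : t ∉ F) (ht : t ∉ S)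
    (hK : ∀ k ∈ K, k ∉ S) : Commute x (g.ctrl S t) :=
  (good _).comm hx htF (by simpa using ht) (by simpa using hK)

theorem acts_ctrl (ht : t ∉ S) : g.Acts (g.ctrl S t) S {t} := by
  have := (good (g := g) S.toList).acts (t := t) (by simpa using ht)
  rwa [Finset.toList_toFinset] at this

theorem ctrl_comm_ctrl (ht : t ∉ S) (hs : s ∉ S') (h : s ∉ S) (h' : t ∉ S') :
    Commute (g.ctrl S t) (g.ctrl S' s) :=
  (acts_ctrl ht).comm_ctrl h hs (by simpa using h')

theorem T_comm_ctrl {a b : ℕ} (hab : a ≠ b) (hac : a ≠ c) (hbc : b ≠ c) (ht : t ∉ S) (hat : t ≠ a)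
    (hbt : t ≠ b) (hc : c ∉ S) : Commute (g.T a b c) (g.ctrl S t) :=
  (acts_T hab hac hbc).comm_ctrl (by simp [hat, hbt]) ht (by simpa using hc)

theorem C_comm_ctrl {a : ℕ} (hac : a ≠ c) (ht : t ∉ S) (hat : t ≠ a) (hc : c ∉ S) :
    Commute (g.C a c) (g.ctrl S t) :=
  (acts_C hac).comm_ctrl (by simp [hat]) ht (by simpa using hc)

theorem N_comm_ctrl (ht : t ∉ S) (hc : c ∉ S) : Commute (g.N c) (g.ctrl S t) :=
  (acts_N c).comm_ctrl (by simp) ht (by simpa using hc)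

theorem E_comm_ctrl (ht : t ∉ S) (hit : t ≠ i) : Commute (g.E i) (g.ctrl S t) :=
  (acts_E i).comm_ctrl (by simpa using hit) ht (by simp)

theorem Z_comm_ctrl (ht : t ∉ S) (hit : t ≠ i) : Commute (g.Z i) (g.ctrl S t) :=
  (acts_Z i).comm_ctrl (by simpa using hit) ht (by simp)

theorem ctrl_mem {x : ℕ} (ht : t ∉ S) (hx : x ∉ S) (hxt : x ≠ t) : g.ctrl S t ∈ g.free x :=
  ctrlList_mem S.nodup_toList (by simpa using ht) (by simpa using hx) hxt

theorem ctrl_conj_of_notMem (hi : i ∉ S) (ht : t ∉ S) (hc : c ∉ S) (hit : i ≠ t) (hci : c ≠ i)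
    (hct : c ≠ t) : g.ctrl S c * g.T c i t * g.ctrl S c = g.ctrl (insert i S) t * g.T c i t := by
  have := (good (g := g) S.toList).conj (by simpa using ht) (by simpa using hc) hit hci hct
  rw [← ctrl_eq_ctrlList (l := i :: S.toList) (S := insert i S) (by simp [hi, S.nodup_toList])
    (by simp [hit.symm, ht]) (by simp)] at this
  exact this

theorem ctrl_insert (hi : i ∉ S) (ht : t ∉ S) (hc : c ∉ S) (hit : i ≠ t) (hci : c ≠ i)
    (hct : c ≠ t) : g.ctrl (insert i S) t =
      g.ctrl S c * g.T c i t * (g.ctrl S c * g.T c i t) := by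
  rw [← mul_assoc, ctrl_conj_of_notMem hi ht hc hit hci hct, mul_assoc, g.T_sq hci hct hit, mul_one]

/-- Reversing the factors of the commutator gives its inverse, which is the same element because the
gate is an involution. -/
theorem ctrl_insert' (hi : i ∉ S) (ht : t ∉ S) (hc : c ∉ S) (hit : i ≠ t) (hci : c ≠ i)
    (hct : c ≠ t) : g.ctrl (insert i S) t =
      g.T c i t * g.ctrl S c * (g.T c i t * g.ctrl S c) := by
  have h1 := ctrl_insert (g := g) hi ht hc hit hci hct
  have h2 := ctrl_sq (g := g) (t := t) (S := insert i S) (by simp [hit.symm, ht])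
  have hT := g.T_sq hci hct hit
  have hv := ctrl_sq (g := g) hc
  set w := g.ctrl (insert i S) t
  set T := g.T c i t
  set v := g.ctrl S c
  have : w * (T * v * (T * v)) = 1 := by
    rw [h1]
    calc _ = v * (T * (v * (T * T) * v) * T) * v := by simp only [mul_assoc]
      _ = 1 := by rw [hT, mul_one, hv, mul_one, hT, mul_one, hv]
  calc w = w * (w * (T * v * (T * v))) := by rw [this, mul_one]
    _ = _ := by rw [← mul_assoc, h2, one_mul]

/-- Beyond `ctrl_conj_of_notMem` this covers `i ∈ S`, where a repeated control has to be absorbed.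
The gate on `c` is expanded through an auxiliary wire `f`, with `i` as the separate control;
`T_T_T`, that is `tof13`, then merges the two occurrences of `i`. -/
theorem ctrl_conj (ht : t ∉ S) (hc : c ∉ S) (hit : i ≠ t) (hci : c ≠ i)
    (hct : c ≠ t) : g.ctrl S c * g.T c i t * g.ctrl S c = g.ctrl (insert i S) t * g.T c i t := by
  by_cases hi : i ∉ S
  · exact ctrl_conj_of_notMem hi ht hc hit hci hct
  rw [not_not] at hi
  obtain ⟨L, hL, rfl⟩ : ∃ L, i ∉ L ∧ insert i L = S := ⟨S.erase i, by simp, Finset.insert_erase hi⟩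
  rw [Finset.insert_idem]
  simp only [Finset.mem_insert, not_or] at ht hc
  obtain ⟨f, hf⟩ := exists_fresh (L ∪ {i, t, c})
  simp only [Finset.mem_union, Finset.mem_insert, Finset.mem_singleton, not_or] at hf
  obtain ⟨f1, f2, f3, f4⟩ := hf
  have hb := ctrl_insert (g := g) hL hc.2 f1 (Ne.symm hci) f2 f4
  have hb' := ctrl_insert' (g := g) hL hc.2 f1 (Ne.symm hci) f2 f4
  have hB := ctrl_conj_of_notMem (g := g) hL ht.2 f1 hit f2 f3
  have hT := g.T_T_T f2 f4 f3 (Ne.symm hci) hit hct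
  rw [g.T_symm (Ne.symm hci) hit hct] at hT
  have hT' := g.T_sq f2 f3 hit
  have hy := ctrl_sq (g := g) f1
  have c1 : Commute (g.T c i t) (g.ctrl L f) := T_comm_ctrl hci hct hit f1 f4 f2 ht.2
  have c2 : Commute (g.T f i c) (g.ctrl (insert i L) t) :=
    T_comm_ctrl f2 f4 (Ne.symm hci) (by simp [hit.symm, ht.2]) (Ne.symm f3) hit.symm (by simp [hci, hc.2])
  have c3 : Commute (g.T f i c) (g.T f i t) :=
    g.T_comm f2 f4 hci.symm f2 f3 hit (Ne.symm f4) hci (Ne.symm f3) hit.symm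
  have c4 : Commute (g.T f i t) (g.ctrl (insert i L) t) :=
    T_comm_ctrl f2 f3 hit (by simp [hit.symm, ht.2]) (Ne.symm f3) hit.symm (by simp [hit.symm, ht.2])
  have c5 : Commute (g.ctrl L f) (g.ctrl (insert i L) t) :=
    ctrl_comm_ctrl f1 (by simp [hit.symm, ht.2]) ht.2 (by simp [f1, f2])
  have c6 : Commute (g.T c i t) (g.ctrl (insert i L) t) :=
    T_comm_ctrl hci hct hit (by simp [hit.symm, ht.2]) (Ne.symm hct) hit.symm (by simp [hit.symm, ht.2])
  set b := g.ctrl (insert i L) c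
  set B := g.ctrl (insert i L) t
  set y := g.ctrl L f
  set τ := g.T f i c
  set T := g.T c i t
  set T' := g.T f i t
  have hτT : τ * T * τ = T * T' := by
    rw [hT]; exact (g.T_comm f2 f3 hit hci hct hit hct.symm hit.symm (Ne.symm f3) hit.symm).eq
  calc b * T * b = (y * τ * (y * τ)) * T * (τ * y * (τ * y)) := by rw [← hb', ← hb]
    _ = y * τ * y * (τ * T * τ) * y * τ * y := by simp only [mul_assoc]
    _ = y * τ * (y * T) * T' * y * τ * y := by rw [hτT]; simp only [mul_assoc]
    _ = y * τ * T * (y * T' * y) * τ * y := by rw [← c1.eq]; simp only [mul_assoc]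
    _ = y * τ * T * B * (T' * τ) * y := by rw [hB]; simp only [mul_assoc]
    _ = y * τ * T * (B * τ) * T' * y := by rw [← c3.eq]; simp only [mul_assoc]
    _ = y * (τ * T * τ) * B * T' * y := by rw [← c2.eq]; simp only [mul_assoc]
    _ = (y * T) * T' * (B * T') * y := by rw [hτT]; simp only [mul_assoc]
    _ = T * y * (T' * T') * (B * y) := by rw [← c1.eq, ← c4.eq]; simp only [mul_assoc]
    _ = T * (y * y) * B := by rw [hT', mul_one, ← c5.eq]; simp only [mul_assoc]
    _ = B * T := by rw [hy, mul_one, c6.eq]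

/-- Flipping the control `c` when `e` and `i` are true adds the monomial in which `c` is replaced by
`e` and `i`. The case `L = ∅` is `T_C_T`. A further control `j` is split off through an auxiliary
wire `d`, and the induction hypothesis is used with target `d`. -/
theorem T_ctrl_T {e : ℕ} (hei : e ≠ i) (hec : e ≠ c) (hes : e ≠ s) (hic : i ≠ c) (his : i ≠ s)
    (hcs : c ≠ s) (hcL : c ∉ L) (hsL : s ∉ L) (heL : e ∉ L) :
    g.T e i c * g.ctrl (insert c L) s * g.T e i c =
      g.ctrl (insert c L) s * g.ctrl (insert e (insert i L)) s := by
  induction L using Finset.induction generalizing s with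
  | empty =>
    have e0 := g.T_C_T hei hec hes hic his hcs
    rw [insert_empty_eq, insert_empty_eq, ctrl_singleton hcs, ctrl_pair hei hes his, e0]
    exact (C_comm_T hcs hei hes his hes.symm his.symm hcs.symm |>.eq).symm
  | insert j L hj ih =>
    simp only [Finset.mem_insert, not_or] at hcL hsL heL
    obtain ⟨d, hd⟩ := exists_fresh (L ∪ {e, i, c, s, j})
    simp only [Finset.mem_union, Finset.mem_insert, Finset.mem_singleton, not_or] at hd
    obtain ⟨d1, d2, d3, d4, d5, d6⟩ := hd
    have h1 := ih (s := d) (Ne.symm d2) (Ne.symm d3) (Ne.symm d4) hcL.2 d1 heL.2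
    have h2 := ctrl_conj (g := g) (S := insert c L) (t := s) (c := d) (i := j)
      (by simp [hcs.symm, hsL]) (by simp [d4, d1]) (Ne.symm hsL.1) d6 d5
    -- The case `j = i` is not excluded; the version of the conjugation rule without the assumption
    -- that the control is new is needed here.
    have h3 := ctrl_conj (g := g) (S := insert e (insert i L)) (t := s) (c := d) (i := j)
      (by simp [hes.symm, his.symm, hsL]) (by simp [d1, d2, d3]) (Ne.symm hsL.1) d6 d5
    rw [show insert c (insert j L) = insert j (insert c L) from Finset.insert_comm _ _ _,
      show insert e (insert i (insert j L)) = insert j (insert e (insert i L)) by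
        rw [Finset.insert_comm i j, Finset.insert_comm e j]]
    have hT := g.T_sq d6 d5 (Ne.symm hsL.1)
    have hτ := g.T_sq hei hec hic
    have c1 : Commute (g.T e i c) (g.T d j s) :=
      g.T_comm hei hec hic d6 d5 (Ne.symm hsL.1) (Ne.symm d4) hcL.1 hes.symm his.symm
    have c2 : Commute (g.ctrl (insert c L) d) (g.ctrl (insert j (insert e (insert i L))) s) :=
      ctrl_comm_ctrl (by simp [d4, d1]) (by simp [hes.symm, his.symm, hsL])
        (by simp [hcs.symm, hsL]) (by simp [d1, d2, d3, d6])
    have c3 : Commute (g.ctrl (insert j (insert c L)) s)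
        (g.ctrl (insert j (insert e (insert i L))) s) :=
      ctrl_comm_ctrl (by simp [hcs.symm, hsL]) (by simp [hes.symm, his.symm, hsL])
        (by simp [hcs.symm, hsL]) (by simp [hes.symm, his.symm, hsL])
    have c4 : Commute (g.ctrl (insert c L) d) (g.ctrl (insert e (insert i L)) d) :=
      ctrl_comm_ctrl (by simp [d4, d1]) (by simp [d1, d2, d3])
        (by simp [d4, d1]) (by simp [d1, d2, d3])
    set τ := g.T e i c
    set T := g.T d j s
    set a := g.ctrl (insert c L) d
    set b := g.ctrl (insert e (insert i L)) d
    set X := g.ctrl (insert j (insert c L)) s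
    set Y := g.ctrl (insert j (insert e (insert i L))) s
    have hX : X = a * T * a * T := by rw [h2, mul_assoc, hT, mul_one]
    calc τ * X * τ = τ * a * (τ * τ) * T * a * (T * τ) := by
          rw [hX, hτ, mul_one]; simp only [mul_assoc]
      _ = τ * a * τ * (τ * T) * a * (T * τ) := by simp only [mul_assoc]
      _ = (τ * a * τ) * T * (τ * a * τ) * T := by
          conv_lhs => arg 2; rw [← c1.eq]
          conv_lhs => arg 1; arg 1; arg 2; rw [c1.eq]
          simp only [mul_assoc]
      _ = a * (b * T * b) * a * T := by
          rw [h1]; conv_lhs => arg 1; arg 2; rw [c4.eq]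
          simp only [mul_assoc]
      _ = (a * Y) * T * a * T := by rw [h3]; simp only [mul_assoc]
      _ = Y * (a * T * a) * T := by rw [c2.eq]; simp only [mul_assoc]
      _ = X * Y := by rw [h2, mul_assoc, mul_assoc, hT, mul_one, c3.eq]

/-- Conjugation of a multiply controlled negation by another one, which negates a control. -/
theorem ctrl_ctrl_ctrl (hcS : c ∉ S) (hcL : c ∉ L) (hsS : s ∉ S) (hsL : s ∉ L) (hcs : c ≠ s) :
    g.ctrl S c * g.ctrl (insert c L) s * g.ctrl S c =
      g.ctrl (insert c L) s * g.ctrl (S ∪ L) s := by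
  induction S using Finset.induction generalizing c L with
  | empty =>
    obtain ⟨d, hd⟩ := exists_fresh (L ∪ {c, s})
    simp only [Finset.mem_union, Finset.mem_insert, Finset.mem_singleton, not_or] at hd
    obtain ⟨d1, d2, d3⟩ := hd
    rw [ctrl_empty, Finset.empty_union]
    have h1 := ctrl_conj (g := g) hsL d1 hcs d2 d3
    -- Once the negated control `c` occurs only in a Toffoli gate with auxiliary control `d`, the
    -- empty case reduces to the negation of one control of a Toffoli gate.
    have h2 := N_T_N (g := g) (Ne.symm d2) hcs d3
    rw [g.T_symm (Ne.symm d2) hcs d3] at h2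
    have h3 := ctrl_copy (g := g) d1 hsL d3
    have hN := g.N_N c
    have hu := ctrl_sq (g := g) d1
    have hT := g.T_sq d2 d3 hcs
    have hC := C_sq (g := g) d3
    have c1 : Commute (g.N c) (g.ctrl L d) := N_comm_ctrl d1 hcL
    have c2 : Commute (g.C d s) (g.ctrl (insert c L) s) :=
      C_comm_ctrl d3 (by simp [hcs.symm, hsL]) (Ne.symm d3) (by simp [hcs.symm, hsL])
    have c3 : Commute (g.ctrl L s) (g.ctrl (insert c L) s) :=
      ctrl_comm_ctrl hsL (by simp [hcs.symm, hsL]) hsL (by simp [hcs.symm, hsL])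
    have c4 : Commute (g.C d s) (g.T d c s) :=
      C_comm_T d3 d2 d3 hcs (Ne.symm d3) hcs.symm (Ne.symm d3)
    set N := g.N c
    set u := g.ctrl L d
    set X := g.ctrl (insert c L) s
    set Y := g.ctrl L s
    set T := g.T d c s
    set C := g.C d s
    have hCT : C * T * (C * T) = 1 := by
      conv_lhs => arg 1; rw [c4.eq]
      rw [mul_assoc, ← mul_assoc C, hC, one_mul, hT]
    have hX : X = u * T * u * T := by rw [h1, mul_assoc, hT, mul_one]
    calc N * X * N = (N * u) * T * u * T * N := by rw [hX]; simp only [mul_assoc]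
      _ = u * (N * T * (N * N) * u * T * N) := by rw [c1.eq, hN]; simp only [mul_assoc, one_mul]
      _ = u * ((N * T * N) * (N * u) * T * N) := by simp only [mul_assoc]
      _ = u * ((N * T * N) * u * (N * T * N)) := by rw [c1.eq]; simp only [mul_assoc]
      _ = u * C * 1 * T * u * (C * T) := by rw [h2]; simp only [mul_assoc, one_mul]
      _ = (u * C * u) * (u * T * u) * (C * T) := by rw [← hu]; simp only [mul_assoc]
      _ = Y * (C * X) * (T * (C * T)) := by rw [h3, h1]; simp only [mul_assoc]
      _ = Y * X * (C * T * (C * T)) := by rw [c2.eq]; simp only [mul_assoc]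
      _ = X * Y := by rw [hCT, mul_one, c3.eq]
  | insert i S hi ih =>
    simp only [Finset.mem_insert, not_or] at hcS hsS
    obtain ⟨e, he⟩ := exists_fresh (S ∪ L ∪ {i, c, s})
    simp only [Finset.mem_union, Finset.mem_insert, Finset.mem_singleton, not_or] at he
    obtain ⟨⟨e1, e2⟩, e3, e4, e5⟩ := he
    have hci := hcS.1
    have his := Ne.symm hsS.1
    have w1 := ctrl_insert (g := g) hi hcS.2 e1 (Ne.symm hci) e3 e4
    have w2 := ctrl_insert' (g := g) hi hcS.2 e1 (Ne.symm hci) e3 e4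
    have h1 := T_ctrl_T (g := g) e3 e4 e5 (Ne.symm hci) his hcs hcL hsL e2
    -- The conjugating gate is the commutator of a Toffoli gate `T` and a smaller gate `y` with
    -- target `e`. By `T_ctrl_T`, conjugating with `T` creates a gate `A` controlled by `e` and `i`;
    -- this is in the scope of the induction hypothesis for `y`, with `i` added to the other
    -- controls. In the end the two occurrences of `A` cancel.
    have h2 := ih (c := e) (L := insert i L) e1 (by simp [e3, e2]) hsS.2 (by simp [his.symm, hsL]) e5
    rw [show insert i S ∪ L = S ∪ insert i L by simp]
    have sB : s ∉ S ∪ insert i L := by simp [hsS, hsL]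
    have sA : s ∉ insert e (insert i L) := by simp [Ne.symm e5, hsS.1, hsL]
    have sX : s ∉ insert c L := by simp [hcs.symm, hsL]
    have hy := ctrl_sq (g := g) e1
    have hT := g.T_sq e3 e4 (Ne.symm hci)
    have hA := ctrl_sq (g := g) sA
    have c1 : Commute (g.ctrl S e) (g.ctrl (insert c L) s) :=
      ctrl_comm_ctrl e1 sX hsS.2 (by simp [e4, e2])
    have c2 : Commute (g.T e i c) (g.ctrl (insert e (insert i L)) s) :=
      T_comm_ctrl e3 e4 (Ne.symm hci) sA (Ne.symm e5) hsS.1 (by simp [hci, Ne.symm e4, hcL])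
    have c3 : Commute (g.T e i c) (g.ctrl (S ∪ insert i L) s) :=
      T_comm_ctrl e3 e4 (Ne.symm hci) sB (Ne.symm e5) hsS.1 (by simp [hci, hcS.2, hcL])
    have c4 : Commute (g.ctrl S e) (g.ctrl (S ∪ insert i L) s) :=
      ctrl_comm_ctrl e1 sB hsS.2 (by simp [e1, e2, e3])
    set w := g.ctrl (insert i S) c
    set y := g.ctrl S e
    set X := g.ctrl (insert c L) s
    set A := g.ctrl (insert e (insert i L)) s
    set B := g.ctrl (S ∪ insert i L) s
    set T := g.T e i c
    calc w * X * w = y * T * (y * T) * X * (T * y * (T * y)) := by rw [← w1, ← w2]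
      _ = y * T * y * (T * X * T) * y * T * y := by simp only [mul_assoc]
      _ = y * T * (y * X) * A * y * T * y := by rw [h1]; simp only [mul_assoc]
      _ = y * T * X * (y * A * y) * T * y := by rw [c1.eq]; simp only [mul_assoc]
      _ = y * T * X * A * (B * T) * y := by rw [h2]; simp only [mul_assoc]
      _ = y * T * X * (A * T) * (B * y) := by rw [← c3.eq]; simp only [mul_assoc]
      _ = y * (T * X * T) * A * (B * y) := by rw [← c2.eq]; simp only [mul_assoc]
      _ = (y * X) * (A * A) * (B * y) := by rw [h1]; simp only [mul_assoc]
      _ = X * y * (y * B) := by rw [hA, mul_one, c1.eq, c4.eq]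
      _ = X * B := by rw [mul_assoc, ← mul_assoc y, hy, one_mul]

/-- Under the projection of `i` to `1`, the Toffoli gates of the commutator become the `cnot` from
`c` to `t`, and `ctrl_copy` evaluates the result. -/
theorem E_ctrl_insert (hi : i ∉ S) (ht : t ∉ S) (hit : i ≠ t) :
    g.E i * g.ctrl (insert i S) t = g.E i * g.ctrl S t := by
  obtain ⟨c, hc⟩ := exists_fresh (S ∪ {i, t})
  simp only [Finset.mem_union, Finset.mem_insert, Finset.mem_singleton, not_or] at hc
  obtain ⟨c1, c2, c3⟩ := hc
  have h2 := g.E_T (Ne.symm c2) hit c3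
  rw [g.T_symm (Ne.symm c2) hit c3] at h2
  have h3 := ctrl_copy (g := g) c1 ht c3
  have k1 : Commute (g.E i) (g.ctrl S c) := E_comm_ctrl c1 c2
  have hC := C_sq (g := g) c3
  have k3 : Commute (g.C c t) (g.T c i t) := C_comm_T c3 c2 c3 hit (Ne.symm c3) hit.symm (Ne.symm c3)
  have k4 : g.E i * g.T c i t * g.C c t = g.E i := by rw [h2, mul_assoc, hC, mul_one]
  calc _ = (g.E i * g.ctrl S c) * g.T c i t * g.ctrl S c * g.T c i t := by
        rw [ctrl_insert hi ht c1 hit c2 c3]; simp only [mul_assoc]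
    _ = g.ctrl S c * (g.E i * g.T c i t) * g.ctrl S c * g.T c i t := by
        rw [k1.eq]; simp only [mul_assoc]
    _ = (g.ctrl S c * g.E i) * g.C c t * g.ctrl S c * g.T c i t := by
        rw [h2]; simp only [mul_assoc]
    _ = g.E i * (g.ctrl S c * g.C c t * g.ctrl S c) * g.T c i t := by
        rw [← k1.eq]; simp only [mul_assoc]
    _ = (g.E i * g.ctrl S t) * (g.C c t * g.T c i t) := by rw [h3]; simp only [mul_assoc]
    _ = g.ctrl S t * (g.E i * g.T c i t * g.C c t) := by
        rw [(E_comm_ctrl (g := g) ht hit.symm).eq, k3.eq]; simp only [mul_assoc]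
    _ = _ := by rw [k4, (E_comm_ctrl (g := g) ht hit.symm).eq]

/-- Under the projection of `i` to `0`, the Toffoli gates of the commutator disappear and the two
remaining factors cancel. -/
theorem Z_ctrl_insert (hi : i ∉ S) (ht : t ∉ S) (hit : i ≠ t) :
    g.Z i * g.ctrl (insert i S) t = g.Z i := by
  obtain ⟨c, hc⟩ := exists_fresh (S ∪ {i, t})
  simp only [Finset.mem_union, Finset.mem_insert, Finset.mem_singleton, not_or] at hc
  obtain ⟨c1, c2, c3⟩ := hc
  have h2 : g.Z i * g.T i c t = g.Z i := g.Z_T (Ne.symm c2) hit c3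
  rw [g.T_symm (Ne.symm c2) hit c3] at h2
  have k1 : Commute (g.Z i) (g.ctrl S c) := Z_comm_ctrl c1 c2
  calc _ = (g.Z i * g.ctrl S c) * g.T c i t * g.ctrl S c * g.T c i t := by
        rw [ctrl_insert hi ht c1 hit c2 c3]; simp only [mul_assoc]
    _ = g.ctrl S c * (g.Z i * g.T c i t) * g.ctrl S c * g.T c i t := by
        rw [k1.eq]; simp only [mul_assoc]
    _ = g.Z i * (g.ctrl S c * g.ctrl S c) * g.T c i t := by
        rw [h2, ← k1.eq, mul_assoc (g.Z i)]
    _ = _ := by rw [ctrl_sq c1, mul_one, h2]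

theorem Z_ctrl (hi : i ∈ S) (ht : t ∉ S) : g.Z i * g.ctrl S t = g.Z i := by
  obtain ⟨L, hL, rfl⟩ : ∃ L, i ∉ L ∧ insert i L = S := ⟨S.erase i, by simp, Finset.insert_erase hi⟩
  simp only [Finset.mem_insert, not_or] at ht
  exact Z_ctrl_insert hL ht.2 (Ne.symm ht.1)

theorem swap_ctrl {a b : ℕ} (hab : a ≠ b) (ht : t ∉ S) :
    g.swap a b * g.ctrl S t =
      g.ctrl (S.map (_root_.Equiv.swap a b).toEmbedding) (_root_.Equiv.swap a b t) * g.swap a b := by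
  induction S using Finset.induction generalizing t with
  | empty => rw [Finset.map_empty, ctrl_empty, ctrl_empty, swap_N hab]
  | insert i S hi ih =>
    obtain ⟨c, hc⟩ := exists_fresh (S ∪ {i, t, a, b})
    simp only [Finset.mem_union, Finset.mem_insert, Finset.mem_singleton, not_or] at hc ht
    obtain ⟨c1, c2, c3, c4, c5⟩ := hc
    have inj := (_root_.Equiv.swap a b).injective
    have hit := Ne.symm ht.1
    rw [Finset.map_insert, ctrl_insert hi ht.2 c1 hit c2 c3, Equiv.toEmbedding_apply,
      ctrl_insert (c := _root_.Equiv.swap a b c) (by simpa using hi) (by simpa using ht.2)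
        (by simpa using c1) (inj.ne hit) (inj.ne c2) (inj.ne c3)]
    have e1 := ih c1
    have e2 := g.swap_T hab c2 c3 hit
    have e3 := SemiconjBy.mul_right e1 e2
    exact (e3.mul_right e3).eq

end GateSystem


/-! ### Algebraic normal forms and oracles -/

/-- The monomial with the variables in `S`. -/
def monomial (S : Finset ℕ) (b : ℕ → Bool) : Bool := decide (∀ i ∈ S, b i = true)

/-- The Boolean function given by its algebraic normal form, a sum of monomials. -/
def polynomial (l : List (Finset ℕ)) (b : ℕ → Bool) : Bool :=
  l.foldr (fun S c => xor (monomial S b) c) false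

/-- Adding `p` to the value of wire `t`. -/
def addTo (p : (ℕ → Bool) → Bool) (t : ℕ) (b : ℕ → Bool) : ℕ → Bool :=
  Function.update b t (xor (b t) (p b))

theorem polynomial_cons (S : Finset ℕ) (l : List (Finset ℕ)) (b : ℕ → Bool) :
    polynomial (S :: l) b = xor (monomial S b) (polynomial l b) := rfl

theorem polynomial_append (l l' : List (Finset ℕ)) (b : ℕ → Bool) :
    polynomial (l ++ l') b = xor (polynomial l b) (polynomial l' b) := by
  induction l with
  | nil => simp [polynomial]
  | cons S l ih => rw [List.cons_append, polynomial_cons, polynomial_cons, ih, Bool.xor_assoc]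

theorem monomial_insert (i : ℕ) (S : Finset ℕ) (b : ℕ → Bool) :
    monomial (insert i S) b = (b i && monomial S b) := by
  simp [monomial, Bool.decide_and]

theorem monomial_union (S S' : Finset ℕ) (b : ℕ → Bool) :
    monomial (S ∪ S') b = (monomial S b && monomial S' b) := by
  simp [monomial, ← Bool.decide_and, or_imp, forall_and]

theorem monomial_congr {S : Finset ℕ} {b b' : ℕ → Bool} (h : ∀ i ∈ S, b i = b' i) :
    monomial S b = monomial S b' := by
  simp only [monomial]
  congr 1
  exact propext (forall₂_congr fun i hi => by rw [h i hi])

theorem monomial_update {S : Finset ℕ} {t : ℕ} (h : t ∉ S) (b : ℕ → Bool) (c : Bool) :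
    monomial S (Function.update b t c) = monomial S b :=
  monomial_congr fun i hi => Function.update_of_ne (fun e => h (by rw [← e]; exact hi)) _ _

theorem polynomial_congr {l : List (Finset ℕ)} {J : Finset ℕ} (hl : ∀ S ∈ l, S ⊆ J)
    {b b' : ℕ → Bool} (h : ∀ i ∈ J, b i = b' i) : polynomial l b = polynomial l b' := by
  induction l with
  | nil => rfl
  | cons S l ih =>
    rw [polynomial_cons, polynomial_cons, ih fun S h => hl S (List.mem_cons_of_mem _ h),
      monomial_congr fun i hi => h i (hl S List.mem_cons_self hi)]

theorem polynomial_map_insert (i : ℕ) (l : List (Finset ℕ)) (b : ℕ → Bool) :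
    polynomial (l.map (insert i)) b = (b i && polynomial l b) := by
  induction l with
  | nil => simp [polynomial]
  | cons S l ih =>
    rw [List.map_cons, polynomial_cons, polynomial_cons, ih, monomial_insert]
    cases b i <;> simp

namespace GateSystem

variable {M : Type*} [Monoid M] (g : GateSystem M)

/-- The gate which adds the polynomial `l` to wire `t`. -/
noncomputable def oracle (l : List (Finset ℕ)) (t : ℕ) : M := (l.map fun S => g.ctrl S t).prod

variable {g} {l l' : List (Finset ℕ)} {J K : Finset ℕ} {t s i c : ℕ}

theorem oracle_cons (S : Finset ℕ) (l : List (Finset ℕ)) (t : ℕ) :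
    g.oracle (S :: l) t = g.ctrl S t * g.oracle l t := by simp [oracle]

theorem oracle_append (l l' : List (Finset ℕ)) (t : ℕ) :
    g.oracle (l ++ l') t = g.oracle l t * g.oracle l' t := by simp [oracle]

theorem commute_oracle {x : M} (h : ∀ S ∈ l, Commute x (g.ctrl S t)) :
    Commute x (g.oracle l t) := by
  refine Commute.list_prod_right _ _ fun y hy => ?_
  obtain ⟨S, hS, rfl⟩ := List.mem_map.1 hy
  exact h S hS

theorem ctrl_comm_oracle (hl : ∀ S ∈ l, S ⊆ J) (ht : t ∉ J) {S : Finset ℕ} (hS : S ⊆ K)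
    (hs : s ∉ K) (hsJ : s ∉ J) (htK : t ∉ K) : Commute (g.ctrl S s) (g.oracle l t) :=
  commute_oracle fun S' hS' => ctrl_comm_ctrl (fun h => hs (hS h)) (fun h => ht (hl S' hS' h))
    (fun h => htK (hS h)) (fun h => hsJ (hl S' hS' h))

theorem oracle_comm_oracle (hl : ∀ S ∈ l, S ⊆ J) (ht : t ∉ J) (hl' : ∀ S ∈ l', S ⊆ K)
    (hs : s ∉ K) (hsJ : s ∉ J) (htK : t ∉ K) : Commute (g.oracle l t) (g.oracle l' s) :=
  commute_oracle fun S hS => (ctrl_comm_oracle hl ht (hl' S hS) hs hsJ htK).symm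

theorem oracle_sq (hl : ∀ S ∈ l, S ⊆ J) (ht : t ∉ J) : g.oracle l t * g.oracle l t = 1 := by
  induction l with
  | nil => simp [oracle]
  | cons S l ih =>
    have hl' := fun S h => hl S (List.mem_cons_of_mem _ h)
    have hS := hl S List.mem_cons_self
    rw [oracle_cons, mul_assoc, ← mul_assoc (g.oracle l t),
      ← (ctrl_comm_oracle hl' ht hS ht ht ht).eq, mul_assoc, ih hl', mul_one,
      ctrl_sq fun h => ht (hS h)]

theorem Z_comm_oracle (hl : ∀ S ∈ l, S ⊆ J) (ht : t ∉ J) (hit : t ≠ i) :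
    Commute (g.Z i) (g.oracle l t) :=
  commute_oracle fun S hS => Z_comm_ctrl (fun h => ht (hl S hS h)) hit

theorem E_comm_oracle (hl : ∀ S ∈ l, S ⊆ J) (ht : t ∉ J) (hit : t ≠ i) :
    Commute (g.E i) (g.oracle l t) :=
  commute_oracle fun S hS => E_comm_ctrl (fun h => ht (hl S hS h)) hit

theorem oracle_mem {x : ℕ} (hl : ∀ S ∈ l, S ⊆ J) (ht : t ∉ J) (hx : x ∉ J) (hxt : x ≠ t) :
    g.oracle l t ∈ g.free x := by
  refine list_prod_mem fun y hy => ?_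
  obtain ⟨S, hS, rfl⟩ := List.mem_map.1 hy
  exact ctrl_mem (fun h => ht (hl S hS h)) (fun h => hx (hl S hS h)) hxt

/-! ### The polynomial determines the gate -/

/-- All factors have the same target, so they commute and can be regrouped. The set `R` collects the
controls already split off in the induction of `prod_ctrl_eq_one`. -/
theorem prod_ctrl_filter (R : Finset ℕ) (ht : t ∉ J) (hR : t ∉ R) (hl : ∀ S ∈ l, S ⊆ J) (i : ℕ) :
    (l.map fun S => g.ctrl (R ∪ S) t).prod =
      ((l.filter (i ∉ ·)).map fun S => g.ctrl (R ∪ S) t).prod *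
        ((l.filter (i ∈ ·)).map fun S => g.ctrl (R ∪ S) t).prod := by
  induction l with
  | nil => simp
  | cons S l ih =>
    have hS : t ∉ R ∪ S := by
      simp only [Finset.mem_union, not_or]; exact ⟨hR, fun h => ht (hl S List.mem_cons_self h)⟩
    have ih := ih fun S h => hl S (List.mem_cons_of_mem _ h)
    by_cases h : i ∈ S
    · have : Commute (g.ctrl (R ∪ S) t)
          ((l.filter (i ∉ ·)).map fun S => g.ctrl (R ∪ S) t).prod := by
        refine Commute.list_prod_right _ _ fun y hy => ?_
        obtain ⟨S', hS', rfl⟩ := List.mem_map.1 hy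
        have : t ∉ R ∪ S' := by
          simp only [Finset.mem_union, not_or]
          exact ⟨hR, fun h => ht (hl S' (List.mem_cons_of_mem _ (List.mem_of_mem_filter hS')) h)⟩
        exact ctrl_comm_ctrl hS this hS this
      simp only [List.map_cons, List.prod_cons, ih, List.filter_cons, h, not_true_eq_false,
        decide_false, decide_true, if_true, Bool.false_eq_true, if_false]
      rw [← mul_assoc, this.eq, mul_assoc]
    · simp only [List.map_cons, List.prod_cons, ih, List.filter_cons, h, not_false_eq_true,
        decide_false, decide_true, if_true, Bool.false_eq_true, if_false, mul_assoc]

end GateSystem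

theorem polynomial_filter (l : List (Finset ℕ)) (i : ℕ) (b : ℕ → Bool) :
    polynomial l b = xor (polynomial (l.filter (i ∉ ·)) b) (polynomial (l.filter (i ∈ ·)) b) := by
  induction l with
  | nil => simp [polynomial]
  | cons S l ih =>
    by_cases h : i ∈ S
    · simp [h, polynomial_cons, ih, Bool.xor_left_comm]
    · simp [h, polynomial_cons, ih]

theorem polynomial_eq_false {l : List (Finset ℕ)} {i : ℕ} {b : ℕ → Bool} (h : ∀ S ∈ l, i ∈ S)
    (hb : b i = false) : polynomial l b = false := by
  induction l with
  | nil => rfl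
  | cons S l ih =>
    rw [polynomial_cons, ih fun S hS => h S (List.mem_cons_of_mem _ hS), monomial]
    simp only [Bool.xor_false, decide_eq_false_iff_not, not_forall]
    exact ⟨i, h S List.mem_cons_self, by simp [hb]⟩

theorem polynomial_map_erase {l : List (Finset ℕ)} {i : ℕ} (h : ∀ S ∈ l, i ∈ S)
    (b : ℕ → Bool) : polynomial (l.map fun S => S.erase i) b =
      polynomial l (Function.update b i true) := by
  induction l with
  | nil => rfl
  | cons S l ih =>
    rw [List.map_cons, polynomial_cons, polynomial_cons,
      ih fun S hS => h S (List.mem_cons_of_mem _ hS)]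
    congr 1
    conv_rhs => rw [← Finset.insert_erase (h S List.mem_cons_self), monomial_insert]
    rw [monomial_update (by simp)]
    simp

namespace GateSystem

variable {M : Type*} [Monoid M] {g : GateSystem M}
  {l l' : List (Finset ℕ)} {J K : Finset ℕ} {t s i c : ℕ}

/-- A polynomial which vanishes as a function contains each monomial an even number of times. By
induction on the variables: putting `i` to `0` shows that the part without `i` vanishes, then
putting `i` to `1` that the cofactor of `i` vanishes. When no variable is left, the value is the
parity of the number of factors, and equal factors cancel in pairs. -/
theorem prod_ctrl_eq_one (R : Finset ℕ) (ht : t ∉ J) (hR : t ∉ R) (hl : ∀ S ∈ l, S ⊆ J)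
    (h : ∀ b, polynomial l b = false) : (l.map fun S => g.ctrl (R ∪ S) t).prod = 1 := by
  induction J using Finset.induction generalizing l R with
  | empty =>
    have hl' : ∀ S ∈ l, S = ∅ := fun S hS => Finset.subset_empty.1 (hl S hS)
    obtain ⟨n, rfl⟩ : ∃ n, l = List.replicate n ∅ := ⟨_, List.eq_replicate_of_mem hl'⟩
    have key : ∀ n, polynomial (List.replicate n ∅) (fun _ => false) = decide (Odd n) := by
      intro n
      induction n with
      | zero => simp [polynomial]
      | succ n ih =>
        rw [List.replicate_succ, polynomial_cons, ih]
        have : (Odd (n + 1)) ↔ ¬ Odd n := by simp [Nat.odd_add_one]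
        by_cases h : Odd n <;> simp [monomial, h, this]
    have hn := (key n).symm.trans (h _)
    rw [decide_eq_false_iff_not, Nat.not_odd_iff_even] at hn
    obtain ⟨k, rfl⟩ := hn
    rw [List.map_replicate, List.prod_replicate, Finset.union_empty, pow_add,
      ← (Commute.refl _).mul_pow, ctrl_sq hR, one_pow]
  | insert i J hi ih =>
    simp only [Finset.mem_insert, not_or] at ht
    have h0 : ∀ b, polynomial (l.filter (i ∉ ·)) b = false := by
      intro b
      have h1 := h (Function.update b i false)
      rw [polynomial_filter l i, polynomial_eq_false (l := l.filter (i ∈ ·)) (i := i)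
        (by simp) (by simp), Bool.xor_false] at h1
      rw [← h1]
      have : ∀ S ∈ l.filter (i ∉ ·), S ⊆ J := by
        intro S hS
        simp only [List.mem_filter, decide_eq_true_eq] at hS
        exact (Finset.subset_insert_iff_of_notMem hS.2).1 (hl S hS.1)
      exact polynomial_congr this fun j hj =>
        (Function.update_of_ne (fun e => hi (by rw [← e]; exact hj)) _ _).symm
    have h1 : ∀ b, polynomial ((l.filter (i ∈ ·)).map fun S => S.erase i) b = false := by
      intro b
      rw [polynomial_map_erase (by simp)]
      have := h (Function.update b i true)
      rwa [polynomial_filter l i, h0, Bool.false_xor] at this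
    have e0 := ih R ht.2 hR (fun S hS => by
      simp only [List.mem_filter, decide_eq_true_eq] at hS
      exact (Finset.subset_insert_iff_of_notMem hS.2).1 (hl S hS.1)) h0
    have e1 := ih (insert i R) ht.2 (by simp [ht.1, hR]) (fun S hS => by
      simp only [List.mem_map, List.mem_filter, decide_eq_true_eq] at hS
      obtain ⟨S', hS', rfl⟩ := hS
      exact Finset.subset_insert_iff.1 (hl S' hS'.1)) h1
    rw [prod_ctrl_filter R (J := insert i J) (by simp [ht]) hR hl i, e0, one_mul]
    rw [List.map_map] at e1
    rw [← e1]
    congr 1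
    refine List.map_congr_left fun S hS => ?_
    simp only [List.mem_filter, decide_eq_true_eq] at hS
    rw [Function.comp, Finset.insert_union, ← Finset.union_insert, Finset.insert_erase hS.2]

/-- The concatenation of the two lists vanishes as a function, and oracles are involutions. -/
theorem oracle_ext (ht : t ∉ J) (hl : ∀ S ∈ l, S ⊆ J) (hl' : ∀ S ∈ l', S ⊆ J)
    (h : ∀ b, polynomial l b = polynomial l' b) : g.oracle l t = g.oracle l' t := by
  have hll : ∀ S ∈ l ++ l', S ⊆ J := fun S hS => (List.mem_append.1 hS).elim (hl S) (hl' S)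
  have h1 := prod_ctrl_eq_one (g := g) (l := l ++ l') ∅ ht (by simp) hll fun b => by
    rw [polynomial_append, h, Bool.xor_self]
  simp only [Finset.empty_union] at h1
  change g.oracle (l ++ l') t = 1 at h1
  rw [oracle_append] at h1
  calc g.oracle l t = g.oracle l t * (g.oracle l' t * g.oracle l' t) := by
        rw [oracle_sq hl' ht, mul_one]
    _ = g.oracle l' t := by rw [← mul_assoc, h1, one_mul]

end GateSystem


/-! ### Reversible words -/

/-- A list of controlled negations (given by controls and target) on the wires in `K`. -/
def IsWord (K : Finset ℕ) (u : List (Finset ℕ × ℕ)) : Prop :=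
  ∀ p ∈ u, p.1 ⊆ K ∧ p.2 ∈ K ∧ p.2 ∉ p.1

/-- The permutation of bit assignments computed by a list of controlled negations. -/
def act : List (Finset ℕ × ℕ) → (ℕ → Bool) → (ℕ → Bool)
  | [], b => b
  | p :: u, b => act u (addTo (monomial p.1) p.2 b)

theorem act_append (u u' : List (Finset ℕ × ℕ)) (b : ℕ → Bool) :
    act (u ++ u') b = act u' (act u b) := by
  induction u generalizing b with
  | nil => rfl
  | cons p u ih => exact ih _

theorem addTo_monomial_self {S : Finset ℕ} {t : ℕ} (h : t ∉ S) (b : ℕ → Bool) :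
    addTo (monomial S) t (addTo (monomial S) t b) = b := by
  simp [addTo, monomial_update h]

theorem act_reverse {K : Finset ℕ} {u : List (Finset ℕ × ℕ)} (hu : IsWord K u) (b : ℕ → Bool) :
    act u.reverse (act u b) = b := by
  induction u generalizing b with
  | nil => rfl
  | cons p u ih =>
    rw [List.reverse_cons, act_append, act.eq_2 b p u, ih fun q hq => hu q (List.mem_cons_of_mem _ hq)]
    exact addTo_monomial_self (hu p List.mem_cons_self).2.2 b

theorem IsWord.cons {K : Finset ℕ} {p : Finset ℕ × ℕ} {u : List (Finset ℕ × ℕ)} :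
    IsWord K (p :: u) ↔ (p.1 ⊆ K ∧ p.2 ∈ K ∧ p.2 ∉ p.1) ∧ IsWord K u := List.forall_mem_cons

theorem IsWord.append {K : Finset ℕ} {u u' : List (Finset ℕ × ℕ)} (h : IsWord K u)
    (h' : IsWord K u') : IsWord K (u ++ u') :=
  fun p hp => (List.mem_append.1 hp).elim (h p) (h' p)

theorem IsWord.reverse {K : Finset ℕ} {u : List (Finset ℕ × ℕ)} (h : IsWord K u) :
    IsWord K u.reverse := fun p hp => h p (List.mem_reverse.1 hp)

theorem polynomial_update {l : List (Finset ℕ)} {t : ℕ} (hl : ∀ S ∈ l, t ∉ S) (b : ℕ → Bool)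
    (c : Bool) : polynomial l (Function.update b t c) = polynomial l b := by
  induction l with
  | nil => rfl
  | cons S l ih =>
    rw [polynomial_cons, polynomial_cons, ih fun S h => hl S (List.mem_cons_of_mem _ h),
      monomial_update (hl S List.mem_cons_self)]

theorem act_target {l : List (Finset ℕ)} {t : ℕ} (hl : ∀ S ∈ l, t ∉ S) (b : ℕ → Bool) :
    act (l.map fun S => (S, t)) b = addTo (polynomial l) t b := by
  induction l generalizing b with
  | nil => simp [act, addTo, polynomial]
  | cons S l ih =>
    have hl' := fun S h => hl S (List.mem_cons_of_mem _ h)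
    have e : polynomial l (addTo (monomial S) t b) = polynomial l b := polynomial_update hl' _ _
    rw [List.map_cons, act, ih hl']
    simp only [addTo] at e ⊢
    rw [e]
    simp [polynomial_cons]

namespace GateSystem

variable {M : Type*} [Monoid M] (g : GateSystem M)

/-- The product of a list of controlled negations. -/
noncomputable def run (u : List (Finset ℕ × ℕ)) : M := (u.map fun p => g.ctrl p.1 p.2).prod

variable {g} {l l' : List (Finset ℕ)} {u u' : List (Finset ℕ × ℕ)} {J K : Finset ℕ}
  {t s i c m k : ℕ}

theorem run_cons (p : Finset ℕ × ℕ) (u : List (Finset ℕ × ℕ)) :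
    g.run (p :: u) = g.ctrl p.1 p.2 * g.run u := by simp [run]

theorem run_append (u u' : List (Finset ℕ × ℕ)) :
    g.run (u ++ u') = g.run u * g.run u' := by simp [run]

theorem run_mul_reverse (hu : IsWord K u) : g.run u * g.run u.reverse = 1 := by
  induction u with
  | nil => simp [run]
  | cons p u ih =>
    rw [IsWord.cons] at hu
    rw [List.reverse_cons, run_append, run_cons, run_cons p [], mul_assoc,
      ← mul_assoc (g.run u), ih hu.2, one_mul, run, List.map_nil, List.prod_nil, mul_one,
      ctrl_sq hu.1.2.2]

theorem reverse_mul_run (hu : IsWord K u) : g.run u.reverse * g.run u = 1 := by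
  have := run_mul_reverse (g := g) hu.reverse
  rwa [List.reverse_reverse] at this

theorem commute_run {x : M} (h : ∀ p ∈ u, Commute x (g.ctrl p.1 p.2)) :
    Commute x (g.run u) := by
  refine Commute.list_prod_right _ _ fun y hy => ?_
  obtain ⟨p, hp, rfl⟩ := List.mem_map.1 hy
  exact h p hp

theorem Z_comm_run (hu : IsWord K u) (hi : i ∉ K) : Commute (g.Z i) (g.run u) :=
  commute_run fun p hp => Z_comm_ctrl (hu p hp).2.2 fun e => hi (e ▸ (hu p hp).2.1)

theorem run_mem (hu : IsWord K u) (hi : i ∉ K) : g.run u ∈ g.free i := by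
  refine list_prod_mem fun y hy => ?_
  obtain ⟨p, hp, rfl⟩ := List.mem_map.1 hy
  exact ctrl_mem (hu p hp).2.2 (fun h => hi ((hu p hp).1 h)) fun e => hi (e ▸ (hu p hp).2.1)

/-! ### Conjugation of oracles by gates -/

/-- If `t ∈ S'`, replacing the variable `t` by `t` plus the monomial of `S` splits the monomial of
`S'` into two; this is `ctrl_ctrl_ctrl`. Otherwise the gates commute. The target `s` lies outside
`K`, so it plays no part in the substitution. -/
theorem ctrl_conj_ctrl {S S' : Finset ℕ} (hS : S ⊆ K) (ht : t ∈ K) (htS : t ∉ S) (hS' : S' ⊆ K)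
    (hs : s ∉ K) : ∃ l : List (Finset ℕ), (∀ R ∈ l, R ⊆ K) ∧
      g.ctrl S t * g.ctrl S' s * g.ctrl S t = g.oracle l s ∧
      ∀ b, polynomial l b = monomial S' (addTo (monomial S) t b) := by
  by_cases h : t ∈ S'
  · refine ⟨[S', S ∪ S'.erase t], ?_, ?_, ?_⟩
    · simp only [List.mem_cons, List.not_mem_nil, or_false, forall_eq_or_imp, forall_eq]
      exact ⟨hS', Finset.union_subset hS ((Finset.erase_subset _ _).trans hS')⟩
    · have := ctrl_ctrl_ctrl (g := g) (S := S) (c := t) (L := S'.erase t) (s := s) htS (by simp)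
        (fun h => hs (hS h)) (fun h => hs (hS' (Finset.erase_subset _ _ h)))
        (fun e => hs (e ▸ ht))
      rw [Finset.insert_erase h] at this
      rw [this, oracle_cons, oracle_cons]
      simp [oracle]
    · intro b
      have e : monomial S' = fun b => b t && monomial (S'.erase t) b := by
        funext b; rw [← monomial_insert, Finset.insert_erase h]
      simp only [polynomial_cons, monomial_union, e, addTo, Function.update_self]
      rw [monomial_update (by simp)]
      cases b t <;> cases monomial S b <;> simp [polynomial]
  · refine ⟨[S'], by simpa using hS', ?_, ?_⟩
    · have hsS : s ∉ S' := fun h => hs (hS' h)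
      have := (ctrl_comm_ctrl (g := g) htS hsS (fun h => hs (hS h)) h)
      rw [this.eq, mul_assoc, ctrl_sq htS, mul_one]
      simp [oracle]
    · intro b
      rw [polynomial_cons, addTo, monomial_update h]
      simp [polynomial]

theorem ctrl_conj_oracle {S : Finset ℕ} (hS : S ⊆ K) (ht : t ∈ K) (htS : t ∉ S)
    (hl : ∀ R ∈ l, R ⊆ K) (hs : s ∉ K) : ∃ l' : List (Finset ℕ), (∀ R ∈ l', R ⊆ K) ∧
      g.ctrl S t * g.oracle l s * g.ctrl S t = g.oracle l' s ∧
      ∀ b, polynomial l' b = polynomial l (addTo (monomial S) t b) := by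
  induction l with
  | nil => exact ⟨[], by simp, by simp [oracle, ctrl_sq htS], fun b => rfl⟩
  | cons R l ih =>
    obtain ⟨l1, h1, e1, p1⟩ := ih fun S h => hl S (List.mem_cons_of_mem _ h)
    obtain ⟨l2, h2, e2, p2⟩ := ctrl_conj_ctrl (g := g) hS ht htS (hl R List.mem_cons_self) hs
    refine ⟨l2 ++ l1, fun S h => (List.mem_append.1 h).elim (h2 S) (h1 S), ?_, fun b => ?_⟩
    · rw [oracle_append, ← e1, ← e2, oracle_cons]
      simp only [mul_assoc]
      rw [← mul_assoc (g.ctrl S t) (g.ctrl S t), ctrl_sq htS, one_mul]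
    · rw [polynomial_append, polynomial_cons, p1, p2]

/-- Conjugation acts on polynomials by substitution. With `oracle_ext` this reduces identities
between conjugated oracles to identities between Boolean functions. -/
theorem run_conj_oracle (hu : IsWord K u) (hl : ∀ R ∈ l, R ⊆ K) (hs : s ∉ K) :
    ∃ l' : List (Finset ℕ), (∀ R ∈ l', R ⊆ K) ∧
      g.run u * g.oracle l s * g.run u.reverse = g.oracle l' s ∧
      ∀ b, polynomial l' b = polynomial l (act u b) := by
  induction u with
  | nil => exact ⟨l, hl, by simp [run], fun b => rfl⟩
  | cons p u ih =>
    rw [IsWord.cons] at hu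
    obtain ⟨l1, h1, e1, p1⟩ := ih hu.2
    obtain ⟨l2, h2, e2, p2⟩ := ctrl_conj_oracle (g := g) hu.1.1 hu.1.2.1 hu.1.2.2 h1 hs
    refine ⟨l2, h2, ?_, fun b => ?_⟩
    · rw [← e2, ← e1, List.reverse_cons, run_append, run_cons, run_cons p []]
      simp only [mul_assoc]
      simp [run]
    · rw [p2, p1, act]

theorem oracle_eq_run (l : List (Finset ℕ)) (t : ℕ) :
    g.oracle l t = g.run (l.map fun S => (S, t)) := by
  rw [oracle, run, List.map_map]; rfl

/-! ### Domains -/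

theorem Z_oracle_insert (hl : ∀ S ∈ l, S ⊆ J) (hs : s ∉ J) (hst : s ≠ t) :
    g.Z t * g.oracle (l.map (insert t)) s = g.Z t := by
  induction l with
  | nil => simp [oracle]
  | cons S l ih =>
    rw [List.map_cons, oracle_cons, ← mul_assoc, Z_ctrl (by simp), ih fun S h =>
      hl S (List.mem_cons_of_mem _ h)]
    simp only [Finset.mem_insert, not_or]
    exact ⟨hst, fun h => hs (hl S List.mem_cons_self h)⟩

theorem map_insert_subset (hl : ∀ S ∈ l, S ⊆ J) : ∀ S ∈ l.map (insert t), S ⊆ insert t J := by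
  intro S hS
  obtain ⟨R, hR, rfl⟩ := List.mem_map.1 hS
  exact Finset.insert_subset_insert _ (hl R hR)

/-- Oracles which vanish on the domain can be omitted. -/
theorem domain_oracle_of_eq_false (hl : ∀ S ∈ l, S ⊆ J) (hl' : ∀ S ∈ l', S ⊆ J) (ht : t ∉ J)
    (hs : s ∉ J) (hts : t ≠ s) (h : ∀ b, polynomial l b = false → polynomial l' b = false) :
    g.Z t * g.oracle l t * g.Z t * g.oracle l' s = g.Z t * g.oracle l t * g.Z t := by
  set v := g.oracle l t with hv
  set w := g.oracle l' s with hw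
  set W := g.oracle (l'.map (insert t)) s with hW
  have hs' : s ∉ insert t J := by simp [hs, hts.symm]
  have hJ : J ⊆ insert t J := Finset.subset_insert _ _
  have hu : IsWord (insert t J) (l.map fun S => (S, t)) := by
    intro p hp
    obtain ⟨S, hS, rfl⟩ := List.mem_map.1 hp
    exact ⟨(hl S hS).trans hJ, by simp, fun h => ht (hl S hS h)⟩
  obtain ⟨r, hr, e, p⟩ := run_conj_oracle (g := g) hu (map_insert_subset (t := t) hl') hs'
  have hvv : v * v = 1 := oracle_sq hl ht
  have hWW : W * W = 1 := oracle_sq (map_insert_subset hl') hs'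
  have hrev : g.run (l.map fun S => (S, t)).reverse = v := by
    have := run_mul_reverse (g := g) hu
    rw [← oracle_eq_run] at this
    calc _ = v * v * g.run (l.map fun S => (S, t)).reverse := by rw [hvv, one_mul]
      _ = v := by rw [mul_assoc, this, mul_one]
  -- Let `p`, `q` be the polynomials of `l`, `l'`. Conjugation by `v` turns `t q` into `(t + p) q =
  -- t q + p q`, and `p q = q` since `q` vanishes where `p` does. As the projection of `t` to `0`
  -- absorbs `W`, the gate `w` is absorbed by the domain.
  have hvW : v * W * v = W * w := by
    rw [hrev, ← oracle_eq_run] at e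
    rw [hW, hw, ← oracle_append, e]
    refine oracle_ext hs' hr ?_ fun b => ?_
    · exact fun S hS => (List.mem_append.1 hS).elim (map_insert_subset hl' S)
        fun h => (hl' S h).trans hJ
    · rw [p, act_target fun S hS h => ht (hl S hS h), polynomial_append, polynomial_map_insert,
        polynomial_map_insert, addTo, Function.update_self,
        polynomial_update fun S hS h => ht (hl' S hS h)]
      have := h b
      cases e1 : polynomial l b <;> cases e2 : polynomial l' b <;> simp_all
  have hwW : w = W * (v * W * v) := by rw [hvW, ← mul_assoc, hWW, one_mul]
  have hvw : Commute v w := oracle_comm_oracle hl ht hl' hs hs ht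
  have hZW : g.Z t * W = g.Z t := Z_oracle_insert hl' hs hts.symm
  have hWZ : W * g.Z t = g.Z t := by
    rw [← (Z_comm_oracle (map_insert_subset hl') hs' hts.symm).eq, hZW]
  have hZw : Commute (g.Z t) w := Z_comm_oracle hl' hs hts.symm
  calc g.Z t * v * g.Z t * w = g.Z t * (v * w) * g.Z t := by
        simp only [mul_assoc]; rw [hZw.eq]
    _ = g.Z t * W * v * (W * (v * v * g.Z t)) := by
        rw [hvw.eq, hwW]; simp only [mul_assoc]
    _ = g.Z t * v * g.Z t := by rw [hZW, hvv, one_mul, hWZ]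

/-- The sum of `l'` and `r` vanishes on the domain, so the concatenated oracle can be omitted. -/
theorem domain_oracle_congr {r : List (Finset ℕ)} (hl : ∀ S ∈ l, S ⊆ J) (hl' : ∀ S ∈ l', S ⊆ J)
    (hr : ∀ S ∈ r, S ⊆ J) (ht : t ∉ J) (hs : s ∉ J) (hts : t ≠ s)
    (h : ∀ b, polynomial l b = false → polynomial l' b = polynomial r b) :
    g.Z t * g.oracle l t * g.Z t * g.oracle l' s = g.Z t * g.oracle l t * g.Z t * g.oracle r s := by
  have := domain_oracle_of_eq_false (g := g) (l' := l' ++ r) hl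
    (fun S hS => (List.mem_append.1 hS).elim (hl' S) (hr S)) ht hs hts fun b hb => by
      rw [polynomial_append, h b hb, Bool.xor_self]
  rw [oracle_append, ← mul_assoc] at this
  calc _ = g.Z t * g.oracle l t * g.Z t * g.oracle l' s * (g.oracle r s * g.oracle r s) := by
        rw [oracle_sq hr hs, mul_one]
    _ = _ := by rw [← mul_assoc, this]

/-- The conjugation rule of one gate is applied to each monomial; the monomials may already contain
`i`, which is the reason for the general form of `ctrl_conj`. -/
theorem oracle_T_oracle (hl : ∀ S ∈ l, S ⊆ J) (hc : c ∉ J) (ht : t ∉ J) (hci : c ≠ i)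
    (hct : c ≠ t) (hit : i ≠ t) : g.oracle l c * g.T c i t * g.oracle l c =
      g.oracle (l.map (insert i)) t * g.T c i t := by
  induction l with
  | nil => simp [oracle]
  | cons S l ih =>
    have hS := hl S List.mem_cons_self
    have hl := fun S h => hl S (List.mem_cons_of_mem _ h)
    have h1 : Commute (g.ctrl S c) (g.oracle l c) := ctrl_comm_oracle hl hc hS hc hc hc
    have h2 : Commute (g.ctrl S c) (g.oracle (l.map (insert i)) t) :=
      ctrl_comm_oracle (map_insert_subset hl) (by simp [ht, hit.symm]) hS hc (by simp [hc, hci]) ht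
    have h3 : Commute (g.ctrl (insert i S) t) (g.oracle (l.map (insert i)) t) :=
      ctrl_comm_oracle (K := insert i J) (map_insert_subset hl) (by simp [ht, hit.symm])
        (Finset.insert_subset_insert _ hS) (by simp [ht, hit.symm]) (by simp [ht, hit.symm])
        (by simp [ht, hit.symm])
    rw [List.map_cons, oracle_cons, oracle_cons]
    calc _ = g.ctrl S c * (g.oracle l c * g.T c i t * g.oracle l c) * g.ctrl S c := by
          conv_lhs => rw [h1.eq]
          rw [← h1.eq]
          simp only [mul_assoc]
          rw [h1.eq]
      _ = g.oracle (l.map (insert i)) t * (g.ctrl S c * g.T c i t * g.ctrl S c) := by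
          rw [ih hl, ← mul_assoc (g.ctrl S c), h2.eq]; simp only [mul_assoc]
      _ = _ := by
          rw [ctrl_conj (fun h => ht (hS h)) (fun h => hc (hS h)) hit hci hct, h3.eq, mul_assoc]

theorem E_oracle_insert (hl : ∀ S ∈ l, S ⊆ J) (ht : t ∉ J) (hit : i ≠ t) :
    g.E i * g.oracle (l.map (insert i)) t = g.E i * g.oracle l t := by
  induction l with
  | nil => rfl
  | cons S l ih =>
    have hS : t ∉ S := fun h => ht (hl S List.mem_cons_self h)
    rw [List.map_cons, oracle_cons, oracle_cons, ← mul_assoc, ← mul_assoc]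
    have e : g.E i * g.ctrl (insert i S) t = g.E i * g.ctrl S t := by
      by_cases h : i ∈ S
      · rw [Finset.insert_eq_of_mem h]
      · exact E_ctrl_insert h hS hit
    rw [e, (E_comm_ctrl hS hit.symm).eq, mul_assoc, mul_assoc,
      ih fun S h => hl S (List.mem_cons_of_mem _ h)]

/-- Restriction of the domain to the assignments which are true at `i`. -/
theorem E_domain (hl : ∀ S ∈ l, S ⊆ J) (hi : i ∈ J) (ht : t ∉ J) :
    g.E i * (g.Z t * g.oracle l t * g.Z t) =
      g.Z t * g.oracle (∅ :: (∅ :: l).map (insert i)) t * g.Z t := by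
  have hit : i ≠ t := fun e => ht (e ▸ hi)
  obtain ⟨c, hc⟩ := exists_fresh (insert t J)
  simp only [Finset.mem_insert, not_or] at hc
  obtain ⟨hct, hcJ⟩ := hc
  have hci : c ≠ i := fun e => hcJ (e ▸ hi)
  have hl0 : ∀ S ∈ ∅ :: l, S ⊆ J := by
    simp only [List.mem_cons, forall_eq_or_imp, Finset.empty_subset, true_and]; exact hl
  have hl1 : ∀ S ∈ (∅ :: l).map (insert i), S ⊆ J := fun S hS => by
    have := map_insert_subset hl0 S hS
    rwa [Finset.insert_eq_of_mem hi] at this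
  have hl2 : ∀ S ∈ ∅ :: (∅ :: l).map (insert i), S ⊆ J := fun S hS => by
    rcases List.mem_cons.1 hS with rfl | h
    · exact Finset.empty_subset _
    · exact hl1 S h
  -- With `p` the polynomial of `l`, the gate `Y` adds `1 + p` to the auxiliary wire `c`. The new
  -- polynomial is `1 + i (1 + p)`, which vanishes exactly where `i` is true and `p` is false.
  set Y := g.oracle (∅ :: l) c with hY
  set A := g.oracle ((∅ :: l).map (insert i)) t with hA
  set e := g.Z t * g.oracle (∅ :: (∅ :: l).map (insert i)) t * g.Z t with he
  have hYT : Y * g.T c i t * Y = A * g.T c i t := oracle_T_oracle hl0 hcJ ht hci hct hit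
  have heA : e = g.Z t * (g.N t * A) * g.Z t := by rw [he, oracle_cons, ctrl_empty]
  have hYZ : Commute Y (g.Z t) := (Z_comm_oracle hl0 hcJ hct).symm
  have hYN : Commute Y (g.N t) :=
    (commute_oracle fun S hS => N_comm_ctrl (fun h => hcJ (hl0 S hS h))
      fun h => ht (hl0 S hS h)).symm
  have hEY : Commute (g.E i) Y := E_comm_oracle hl0 hcJ hci
  have hTZ : g.T c i t * (g.Z t * g.Z c) = g.Z t * g.Z c := by
    rw [(Z_comm_Z t c).eq, ← mul_assoc]
    congr 1
    exact g.T_Z hci hct hit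
  have hEZ : ∀ {j}, j ≠ t → Commute (g.E j) (g.Z t) := fun h => (free_Z (g.E_mem h.symm))
  have hEE : Commute (g.E i) (g.E c) := g.free_E (g.E_mem hci)
  have key : e * g.Z c = g.E i * (Y * g.E c * g.Z t * Y * g.Z c) := by
    calc e * g.Z c = g.Z t * g.N t * A * (g.T c i t * (g.Z t * g.Z c)) := by
          rw [heA, hTZ]; simp only [mul_assoc]
      _ = g.Z t * g.N t * (Y * g.T c i t * Y) * (g.Z t * g.Z c) := by
          rw [hYT]; simp only [mul_assoc]
      _ = Y * (g.Z t * g.N t * g.T c i t * g.Z t) * (Y * g.Z c) := by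
          have h1 : Commute Y (g.Z t * g.N t) := hYZ.mul_right hYN
          calc _ = (g.Z t * g.N t * Y) * g.T c i t * (Y * g.Z t) * g.Z c := by
                simp only [mul_assoc]
            _ = _ := by rw [← h1.eq, hYZ.eq]; simp only [mul_assoc]
      _ = Y * (g.E c * g.E i * g.Z t) * (Y * g.Z c) := by
          -- The ancilla `t` is negated and has to return to `0`, so both controls `c` and `i` of
          -- the Toffoli gate are `1`. This is where `E i` comes from.
          have := g.both hci hct hit
          rw [Z, this]
      _ = _ := by
          rw [← hEE.eq, ← mul_assoc, ← mul_assoc, ← mul_assoc, ← hEY.eq]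
          simp only [mul_assoc]
  have hm : e ∈ g.free c := mul_mem (mul_mem (Z_mem hct) (oracle_mem hl2 ht hcJ hct)) (Z_mem hct)
  -- The new projection already forces `i`, so `E i` can be inserted in front of it. There it
  -- removes the control `i` from all monomials, and two negations of `t` cancel.
  have h1 : g.E i * e = e := by
    have m' : g.E i * e ∈ g.free c := mul_mem (g.E_mem hci) hm
    refine cancel_Z m' hm ?_
    rw [← (free_Z m').eq, ← (free_Z hm).eq, mul_assoc, key, ← mul_assoc, g.E_E]
  rw [← h1, heA]
  have h2 : g.E i * A = g.E i * (g.N t * g.oracle l t) := by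
    rw [hA, E_oracle_insert hl0 ht hit, oracle_cons, ctrl_empty]
  have hEN : Commute (g.E i) (g.N t) := (g.free_N (g.E_mem hit.symm))
  calc _ = g.Z t * (g.E i * g.oracle l t) * g.Z t := by
        rw [← mul_assoc, ← mul_assoc, (hEZ hit).eq]; simp only [mul_assoc]
    _ = g.Z t * (g.N t * (g.E i * A)) * g.Z t := by
        rw [h2, ← mul_assoc (g.E i), hEN.eq, mul_assoc (g.N t), ← mul_assoc (g.N t) (g.N t),
          g.N_N, one_mul]
    _ = _ := by
        rw [← mul_assoc (g.N t), ← hEN.eq, ← mul_assoc (g.E i) (g.Z t * _), ← mul_assoc (g.E i),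
          (hEZ hit).eq]
        simp only [mul_assoc]

end GateSystem


/-! ### Copying wires -/

namespace GateSystem

variable {M : Type*} [Monoid M] (g : GateSystem M)

/-- The product over `i < k` of the copying gates from wire `i` to wire `i + m` in state `0`. -/
def copies (m : ℕ) : ℕ → M
  | 0 => 1
  | k + 1 => copies m k * (g.Z (k + m) * g.C k (k + m))

/-- The product over `i < k` of the exchanges of wires `i` and `i + m`. -/
def exchange (m : ℕ) : ℕ → M
  | 0 => 1
  | k + 1 => exchange m k * g.swap k (k + m)

variable {g} {l l' : List (Finset ℕ)} {u u' : List (Finset ℕ × ℕ)} {J K S R : Finset ℕ}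
  {t s i c m k : ℕ}

theorem copy_comm_copy (hi : i < m) (hk : k < m) (h : i ≠ k) :
    Commute (g.Z (i + m) * g.C i (i + m)) (g.Z (k + m) * g.C k (k + m)) := by
  have h1 : Commute (g.C i (i + m)) (g.Z (k + m)) :=
    free_Z (g.C_mem (by omega) (by omega) (by omega))
  have h2 : Commute (g.C k (k + m)) (g.Z (i + m)) :=
    free_Z (g.C_mem (by omega) (by omega) (by omega))
  have h3 : Commute (g.C i (i + m)) (g.C k (k + m)) :=
    C_comm_C (by omega) (by omega) (by omega) (by omega)
  exact ((Z_comm_Z _ _).mul_right h2.symm).mul_left (h1.mul_right h3)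

/-- The copying factors commute, so any one of them can be moved to the end, next to the gate it is
to act on. -/
theorem exists_copies_eq (hk : k ≤ m) (hi : i < k) :
    ∃ x, g.copies m k = x * (g.Z (i + m) * g.C i (i + m)) := by
  induction k with
  | zero => omega
  | succ k ih =>
    rcases Nat.lt_succ_iff_lt_or_eq.1 hi with h | rfl
    · obtain ⟨x, hx⟩ := ih (by omega) h
      refine ⟨x * (g.Z (k + m) * g.C k (k + m)), ?_⟩
      rw [copies, hx, mul_assoc, mul_assoc x,
        (copy_comm_copy (g := g) (by omega) (by omega) (by omega : i ≠ k)).eq]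
    · exact ⟨_, rfl⟩

theorem copies_mem_free (hk : k ≤ c) (hc : c < m) : g.copies m k ∈ g.free (c + m) := by
  induction k with
  | zero => exact one_mem _
  | succ k ih =>
    exact mul_mem (ih (by omega))
      (mul_mem (Z_mem (by omega)) (g.C_mem (by omega) (by omega) (by omega)))

/-! ### Copied wires are interchangeable -/

/-- Conjugation by the `cnot` from `i` to `c` turns the gate controlled by `c` into its product with
the gate controlled by `i`; one of these factors is absorbed by the projection of `c` to `0`. -/
theorem copy_ctrl_insert (hia : i ≠ c) (hc : c ∉ R) (hs : s ∉ R) (his : i ≠ s)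
    (hcs : c ≠ s) : g.Z c * g.C i c * g.ctrl (insert i R) s =
      g.Z c * g.C i c * g.ctrl (insert c R) s := by
  have h := ctrl_ctrl_ctrl (g := g) (S := {i}) (c := c) (L := R) (s := s) (by simpa using hia.symm) hc
    (by simpa using his.symm) hs hcs
  rw [ctrl_singleton hia, Finset.singleton_union] at h
  have hsi : s ∉ insert i R := by simp [hs, his.symm]
  have hsc : s ∉ insert c R := by simp [hs, hcs.symm]
  have h1 : Commute (g.C i c) (g.ctrl (insert i R) s) := C_comm_ctrl hia hsi his.symm
    (by simp [hc, hia.symm])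
  have hC := C_sq (g := g) hia
  calc _ = g.Z c * g.ctrl (insert c R) s * g.ctrl (insert i R) s * g.C i c := by
        rw [Z_ctrl_insert hc hs hcs, mul_assoc, mul_assoc, h1.eq]
    _ = g.Z c * (g.ctrl (insert c R) s * g.ctrl (insert i R) s) * g.C i c := by
        simp only [mul_assoc]
    _ = g.Z c * g.C i c * g.ctrl (insert c R) s := by
        rw [← h]; simp only [mul_assoc]; rw [hC, mul_one]

theorem copies_ctrl_insert (hi : i < m) (hR' : i + m ∉ R) (hs : s ∉ R) (his : i ≠ s)
    (his' : i + m ≠ s) : g.copies m m * g.ctrl (insert i R) s =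
      g.copies m m * g.ctrl (insert (i + m) R) s := by
  obtain ⟨x, hx⟩ := exists_copies_eq (g := g) le_rfl hi
  rw [hx, mul_assoc, mul_assoc x, copy_ctrl_insert (by omega) hR' hs his his']

/-- The controls are moved to the copies one at a time: `R` contains those already moved, `S` those
still to be moved. -/
theorem copies_ctrl (hS : ∀ i ∈ S, i < m) (hR : ∀ i ∈ R, i < m) (hd : Disjoint S R)
    (ht : t < m) (htS : t ∉ S) (htR : t ∉ R) :
    g.copies m m * g.ctrl (S ∪ R.image (· + m)) (t + m) =
      g.copies m m * g.ctrl ((S ∪ R).image (· + m)) (t + m) := by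
  induction S using Finset.induction generalizing R with
  | empty => simp
  | insert i S hi ih =>
    have him := hS i (by simp)
    have hd' := Finset.disjoint_insert_left.1 hd
    rw [Finset.insert_union, copies_ctrl_insert him]
    · have := @ih (insert i R) (fun j hj => hS j (by simp [hj])) ?_ ?_ (fun h => htS (by simp [h])) ?_
      · rw [Finset.image_insert, Finset.union_insert] at this
        rw [this, Finset.insert_union, Finset.union_insert]
      · simp only [Finset.mem_insert, forall_eq_or_imp]; exact ⟨him, hR⟩
      · rw [Finset.disjoint_insert_right]; exact ⟨hi, hd'.2⟩
      · simp only [Finset.mem_insert, not_or] at htS ⊢; exact ⟨htS.1, htR⟩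
    · simp only [Finset.mem_union, Finset.mem_image, not_or, not_exists, not_and]
      refine ⟨fun h => ?_, fun j hj h => ?_⟩
      · have := hS (i + m) (by simp [h]); omega
      · obtain rfl : j = i := by omega
        exact hd'.1 hj
    · simp only [Finset.mem_union, Finset.mem_image, not_or, not_exists, not_and]
      refine ⟨fun h => ?_, fun j hj h => ?_⟩
      · have := hS (t + m) (by simp [h]); omega
      · obtain rfl : j = t := by omega
        exact htR hj
    · omega
    · intro h
      obtain rfl : i = t := by omega
      exact htS (by simp)

theorem copies_ctrl_image (hS : ∀ i ∈ S, i < m) (ht : t < m) (htS : t ∉ S) :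
    g.copies m m * g.ctrl S (t + m) = g.copies m m * g.ctrl (S.image (· + m)) (t + m) := by
  simpa using copies_ctrl (g := g) (R := ∅) hS (by simp) (by simp) ht htS (by simp)

/-- A gate passes the copying of all wires but its target. Passing the copying of its target, it is
duplicated on the copy, by `ctrl_copy`; the controls of the duplicate are still the original wires.
-/
theorem ctrl_copies (hS : ∀ i ∈ S, i < m) (ht : t < m) (htS : t ∉ S) (hk : k ≤ m) :
    g.ctrl S t * g.copies m k =
      g.copies m k * (if t < k then g.ctrl S (t + m) * g.ctrl S t else g.ctrl S t) := by
  have hmem : ∀ i, i + m ∉ S := fun i h => by have := hS _ h; omega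
  induction k with
  | zero => simp [copies]
  | succ k ih =>
    have comm {s : ℕ} (hs : s ∉ S) (h1 : s ≠ k + m) (h2 : s ≠ k) :
        Commute (g.ctrl S s) (g.Z (k + m) * g.C k (k + m)) :=
      ((Z_comm_ctrl hs h1).symm).mul_right (C_comm_ctrl (by omega) hs h2 (hmem k)).symm
    rw [copies, ← mul_assoc, ih (by omega), mul_assoc, mul_assoc]
    congr 1
    rcases lt_trichotomy t k with h | rfl | h
    · rw [if_pos h, if_pos (by omega)]
      exact (comm (hmem t) (by omega) (by omega)).mul_left (comm htS (by omega) (by omega))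
    · rw [if_neg (lt_irrefl _), if_pos (by omega)]
      have h1 := ctrl_copy (g := g) htS (hmem t) (by omega)
      have h2 : Commute (g.ctrl S t) (g.Z (t + m)) := (Z_comm_ctrl htS (by omega)).symm
      have h3 : Commute (g.C t (t + m)) (g.ctrl S (t + m)) :=
        C_comm_ctrl (by omega) (hmem t) (by omega) (hmem t)
      have h4 : g.ctrl S t * g.C t (t + m) = g.C t (t + m) * g.ctrl S (t + m) * g.ctrl S t := by
        rw [h3.eq, ← h1, mul_assoc _ (g.ctrl S t) (g.ctrl S t), ctrl_sq htS, mul_one]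
      rw [← mul_assoc, h2.eq, mul_assoc, h4]
      simp only [mul_assoc]
    · rw [if_neg (by omega), if_neg (by omega)]
      exact comm htS (by omega) (by omega)

variable (m) in
/-- The controlled negations of a list, on the wires with numbers increased by `m`. -/
def shift (u : List (Finset ℕ × ℕ)) : List (Finset ℕ × ℕ) :=
  u.map fun p => (p.1.image (· + m), p.2 + m)

theorem shift_comm_ctrl (hu : IsWord (Finset.range m) u) (hS : ∀ i ∈ S, i < m) (ht : t < m)
    (htS : t ∉ S) : Commute (g.ctrl S t) (g.run (shift m u)) := by
  refine commute_run fun p hp => ?_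
  obtain ⟨q, hq, rfl⟩ := List.mem_map.1 hp
  obtain ⟨h1, h2, h3⟩ := hu q hq
  refine ctrl_comm_ctrl htS ?_ ?_ ?_
  · simp only [Finset.mem_image, not_exists, not_and]
    intro j hj e
    obtain rfl : j = q.2 := by omega
    exact h3 hj
  · exact fun h => by have := hS _ h; omega
  · simp only [Finset.mem_image, not_exists, not_and]
    intro j hj e
    omega

/-- Copying after a word amounts to copying first and then running the word on both sets of wires.
-/
theorem run_copies (hu : IsWord (Finset.range m) u) :
    g.run u * g.copies m m = g.copies m m * g.run (shift m u) * g.run u := by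
  induction u with
  | nil => simp [run, shift]
  | cons p u ih =>
    rw [IsWord.cons] at hu
    obtain ⟨⟨h1, h2, h3⟩, hu⟩ := hu
    have hS : ∀ i ∈ p.1, i < m := fun i hi => Finset.mem_range.1 (h1 hi)
    have ht := Finset.mem_range.1 h2
    have e := ctrl_copies (g := g) hS ht h3 le_rfl
    rw [if_pos ht, ← mul_assoc, copies_ctrl_image hS ht h3] at e
    have e' : g.run (shift m (p :: u)) =
        g.ctrl (p.1.image (· + m)) (p.2 + m) * g.run (shift m u) := run_cons _ _
    rw [run_cons, mul_assoc, ih hu, ← mul_assoc, ← mul_assoc, e, e', mul_assoc _ _ (g.run (shift m u)),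
      (shift_comm_ctrl hu hS ht h3).eq]
    simp only [mul_assoc]

/-- The exchange consists of three `cnot` gates. The first cancels against the copying gate, and the
second, controlled by a wire in state `0`, is absorbed. -/
theorem copies_swap (hi : i < m) : g.copies m m * g.swap i (i + m) = g.copies m m := by
  obtain ⟨x, hx⟩ := exists_copies_eq (g := g) le_rfl hi
  have h : i ≠ i + m := by omega
  rw [hx, mul_assoc, mul_assoc (g.Z _), g.swap_eq h, ← mul_assoc (g.C i _), ← mul_assoc (g.C i _),
    C_sq h, one_mul, ← mul_assoc (g.Z _), Z_C h.symm]

theorem copies_exchange (hk : k ≤ m) : g.copies m m * g.exchange m k = g.copies m m := by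
  induction k with
  | zero => rw [exchange, mul_one]
  | succ k ih => rw [exchange, ← mul_assoc, ih (by omega), copies_swap (by omega)]

theorem exists_exchange_inv (hk : k ≤ m) : ∃ x, g.exchange m k * x = 1 := by
  induction k with
  | zero => exact ⟨1, mul_one _⟩
  | succ k ih =>
    obtain ⟨x, hx⟩ := ih (by omega)
    refine ⟨g.swap k (k + m) * x, ?_⟩
    rw [exchange, mul_assoc, ← mul_assoc (g.swap _ _), swap_sq (by omega), one_mul, hx]

variable (m) in
/-- The permutation which exchanges `i` and `i + m` for `i < k`. -/
def exchangePerm : ℕ → _root_.Equiv.Perm ℕ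
  | 0 => 1
  | k + 1 => exchangePerm k * _root_.Equiv.swap k (k + m)

theorem exchangePerm_of_ne {j : ℕ} (h : ∀ i < k, j ≠ i ∧ j ≠ i + m) : exchangePerm m k j = j := by
  induction k with
  | zero => rfl
  | succ k ih =>
    rw [exchangePerm, _root_.Equiv.Perm.mul_apply,
      _root_.Equiv.swap_apply_of_ne_of_ne (h k (by omega)).1 (h k (by omega)).2,
      ih fun i hi => h i (by omega)]

theorem exchangePerm_add (hi : i < k) (hk : k ≤ m) : exchangePerm m k (i + m) = i := by
  induction k with
  | zero => omega
  | succ k ih =>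
    rw [exchangePerm, _root_.Equiv.Perm.mul_apply]
    rcases Nat.lt_succ_iff_lt_or_eq.1 hi with h | rfl
    · rw [_root_.Equiv.swap_apply_of_ne_of_ne (by omega) (by omega), ih h (by omega)]
    · rw [_root_.Equiv.swap_apply_right, exchangePerm_of_ne fun j hj => by omega]

theorem exchange_ctrl (ht : t ∉ S) (hk : k ≤ m) : g.exchange m k * g.ctrl S t =
    g.ctrl (S.map (exchangePerm m k).toEmbedding) (exchangePerm m k t) * g.exchange m k := by
  induction k generalizing S t with
  | zero =>
    rw [exchange, one_mul, mul_one, exchangePerm]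
    congr 1
    exact (Finset.map_refl (s := S)).symm
  | succ k ih =>
    rw [exchange, mul_assoc, swap_ctrl (by omega) ht, ← mul_assoc, ih (by simpa using ht) (by omega),
      mul_assoc, exchangePerm, Finset.map_map]
    rfl

theorem exchange_run (hu : IsWord (Finset.range m) u) :
    g.exchange m m * g.run (shift m u) = g.run u * g.exchange m m := by
  induction u with
  | nil => simp [run, shift]
  | cons p u ih =>
    rw [IsWord.cons] at hu
    obtain ⟨⟨h1, h2, h3⟩, hu⟩ := hu
    have e' : g.run (shift m (p :: u)) =
        g.ctrl (p.1.image (· + m)) (p.2 + m) * g.run (shift m u) := run_cons _ _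
    rw [e', ← mul_assoc, exchange_ctrl _ le_rfl, mul_assoc, ih hu, ← mul_assoc, run_cons,
      exchangePerm_add (Finset.mem_range.1 h2) le_rfl]
    · congr 3
      rw [Finset.map_eq_image, Finset.image_image]
      refine (Finset.image_congr fun i hi => ?_).trans Finset.image_id
      exact exchangePerm_add (Finset.mem_range.1 (h1 hi)) le_rfl
    · simp only [Finset.mem_image, not_exists, not_and]
      intro j hj e
      obtain rfl : j = p.2 := by omega
      exact h3 hj

/-- The copying factors are peeled off from the last to the first: the `cnot` is invertible, and the
projection of an untouched wire can be cancelled. -/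
theorem copies_cancel {x y : M} (hx : ∀ i < k, x ∈ g.free (i + m)) (hy : ∀ i < k, y ∈ g.free (i + m))
    (hk : k ≤ m) (h : x * g.copies m k = y * g.copies m k) : x = y := by
  induction k with
  | zero => simpa [copies] using h
  | succ k ih =>
    refine ih (fun i hi => hx i (by omega)) (fun i hi => hy i (by omega)) (by omega) ?_
    have hx' := hx k (by omega)
    have hy' := hy k (by omega)
    have hA := copies_mem_free (g := g) le_rfl (by omega : k < m)
    refine cancel_Z (mul_mem hx' hA) (mul_mem hy' hA) ?_
    rw [← (free_Z (mul_mem hx' hA)).eq, ← (free_Z (mul_mem hy' hA)).eq]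
    have h' := congrArg (· * g.C k (k + m)) h
    simp only [copies, mul_assoc] at h'
    rw [C_sq (by omega), mul_one] at h'
    simpa only [mul_assoc] using h'

/-! ### Reversible circuits which are trivial on the domain -/

/-- The conjugate of the copying gate is an oracle which adds bit `k` of `act u b` to the copy. On
the domain this is bit `k` of `b`, so `domain_oracle_congr` applies. -/
theorem domain_conj_copy (hl : ∀ S ∈ l, S ⊆ Finset.range m) (hu : IsWord (Finset.range m) u)
    (ht : m + m ≤ t) (h : ∀ b, polynomial l b = false → act u b = b) (hk : k < m) :
    g.Z t * g.oracle l t * g.Z t * (g.run u * (g.Z (k + m) * g.C k (k + m)) * g.run u.reverse) =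
      g.Z t * g.oracle l t * g.Z t * (g.Z (k + m) * g.C k (k + m)) := by
  have hm : k + m ∉ Finset.range m := by simp
  have htm : t ∉ Finset.range m := by simp; omega
  have hlk : ∀ S ∈ [{k}], S ⊆ Finset.range m := by simpa using hk
  obtain ⟨r, hr, e, p⟩ := run_conj_oracle (g := g) hu hlk hm
  have hC : g.oracle [{k}] (k + m) = g.C k (k + m) := by
    simp [oracle, ctrl_singleton (g := g) (by omega : k ≠ k + m)]
  rw [hC] at e
  have hZ := Z_comm_run (g := g) hu hm
  have hZε : Commute (g.Z t * g.oracle l t * g.Z t) (g.Z (k + m)) :=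
    ((Z_comm_Z _ _).mul_left (Z_comm_oracle hl htm (by omega)).symm).mul_left (Z_comm_Z _ _)
  have := domain_oracle_congr (g := g) (s := k + m) hl hr hlk htm hm (by omega) fun b hb => by
    rw [p, h b hb]
  rw [hC, ← e] at this
  calc _ = g.Z t * g.oracle l t * g.Z t * g.Z (k + m) * (g.run u * g.C k (k + m) * g.run u.reverse) := by
        rw [← mul_assoc (g.run u), ← hZ.eq]; simp only [mul_assoc]
    _ = _ := by
        rw [hZε.eq, mul_assoc, this, ← mul_assoc, ← hZε.eq, mul_assoc]

theorem domain_comm_copy (hl : ∀ S ∈ l, S ⊆ Finset.range m) (ht : m + m ≤ t) (hk : k < m) :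
    Commute (g.Z t * g.oracle l t * g.Z t) (g.Z (k + m) * g.C k (k + m)) := by
  have htm : t ∉ Finset.range m := by simp; omega
  have hm : k + m ∉ Finset.range m := by simp
  have h1 : Commute (g.Z t) (g.C k (k + m)) :=
    (free_Z (g.C_mem (by omega) (by omega) (by omega))).symm
  have h2 : Commute (g.oracle l t) (g.C k (k + m)) := by
    refine (commute_oracle fun S hS => ?_).symm
    exact C_comm_ctrl (by omega) (fun h => htm (hl S hS h)) (by omega) fun h => hm (hl S hS h)
  exact (((Z_comm_Z _ _).mul_left (Z_comm_oracle hl htm (by omega)).symm).mul_left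
    (Z_comm_Z _ _)).mul_right ((h1.mul_left h2).mul_left h1)

theorem domain_conj_copies (hl : ∀ S ∈ l, S ⊆ Finset.range m) (hu : IsWord (Finset.range m) u)
    (ht : m + m ≤ t) (h : ∀ b, polynomial l b = false → act u b = b) (hk : k ≤ m) :
    Commute (g.Z t * g.oracle l t * g.Z t) (g.copies m k) ∧
    g.Z t * g.oracle l t * g.Z t * (g.run u * g.copies m k * g.run u.reverse) =
      g.Z t * g.oracle l t * g.Z t * g.copies m k := by
  induction k with
  | zero => exact ⟨.one_right _, by rw [copies, mul_one, run_mul_reverse hu]⟩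
  | succ k ih =>
    obtain ⟨h1, h2⟩ := ih (by omega)
    have h3 := domain_comm_copy (g := g) hl ht (by omega : k < m)
    have h4 := domain_conj_copy (g := g) hl hu ht h (by omega : k < m)
    refine ⟨h1.mul_right h3, ?_⟩
    have e : g.run u * g.copies m (k + 1) * g.run u.reverse =
        (g.run u * g.copies m k * g.run u.reverse) *
          (g.run u * (g.Z (k + m) * g.C k (k + m)) * g.run u.reverse) := by
      rw [copies]
      simp only [mul_assoc]
      rw [← mul_assoc (g.run u.reverse) (g.run u), reverse_mul_run hu, one_mul]
    rw [e, ← mul_assoc, h2, h1.eq, mul_assoc, h4, ← mul_assoc, ← h1.eq, copies, mul_assoc]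

/-- A word with no effect on the domain has none on a copy of the domain either; exchanging copies
and originals transfers this to the word itself. The assumption `m + m ≤ t` keeps the ancilla of the
domain away from the wires and their copies. -/
theorem domain_run (hl : ∀ S ∈ l, S ⊆ Finset.range m) (hu : IsWord (Finset.range m) u)
    (ht : m + m ≤ t) (h : ∀ b, polynomial l b = false → act u b = b) :
    g.Z t * g.oracle l t * g.Z t * g.run u = g.Z t * g.oracle l t * g.Z t := by
  have htm : t ∉ Finset.range m := by simp; omega
  obtain ⟨-, h2⟩ := domain_conj_copies (g := g) hl hu ht h le_rfl
  set ε := g.Z t * g.oracle l t * g.Z t with hε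
  set U := g.run u with hU
  set A := g.copies m m with hA
  have hi := reverse_mul_run (g := g) hu
  have hi' := run_mul_reverse (g := g) hu
  have hB : ε * U * A = ε * A * U := by
    have := congrArg (· * U) h2
    simp only [mul_assoc] at this
    rw [hi, mul_one] at this
    simpa only [mul_assoc] using this
  have hC := run_copies (g := g) hu
  rw [← hU, ← hA] at hC
  -- Comparing `hB` with `hC`, and cancelling the invertible `U`, shows that the word on the copies
  -- alone is absorbed.
  have hD : ε * A * g.run (shift m u) = ε * A := by
    have h5 : ε * (A * g.run (shift m u) * U) = ε * A * U := by rw [← hC, ← mul_assoc, hB]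
    have := congrArg (· * g.run u.reverse) h5
    simp only [mul_assoc] at this
    rw [hi', mul_one] at this
    simpa only [mul_assoc, mul_one] using this
  have hE : ε * A * U = ε * A := by
    obtain ⟨x, hx⟩ := exists_exchange_inv (g := g) (le_refl m)
    -- The exchange is absorbed by `A` and turns the word on the copies into the word on the
    -- original wires.
    have h6 : ε * A * U * g.exchange m m = ε * A * g.exchange m m := by
      have hAX : A * g.exchange m m = A := copies_exchange le_rfl
      calc _ = ε * (A * g.exchange m m * g.run (shift m u)) := by
            rw [mul_assoc A, exchange_run hu, ← hU]; simp only [mul_assoc]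
        _ = ε * (A * g.exchange m m) := by rw [hAX, ← mul_assoc, hD]
        _ = _ := (mul_assoc _ _ _).symm
    have := congrArg (· * x) h6
    simpa only [mul_assoc, hx, mul_one] using this
  have hεm : ∀ i < m, ε ∈ g.free (i + m) := fun i _ =>
    mul_mem (mul_mem (Z_mem (by omega)) (oracle_mem hl htm (by simp) (by omega))) (Z_mem (by omega))
  refine copies_cancel (fun i hi => mul_mem (hεm i hi) (run_mem hu (by simp))) hεm le_rfl ?_
  rw [hB, hE]

/-! ### Elements with the same semantics are equal -/

variable (g) in
/-- `φ` is the partial map on assignments of bits computed by the product of gates `x`. -/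
inductive Computes : M → ((ℕ → Bool) → Option (ℕ → Bool)) → Prop
  | one : Computes 1 some
  | E_mul (i : ℕ) {x : M} {φ : (ℕ → Bool) → Option (ℕ → Bool)} : Computes x φ →
      Computes (g.E i * x) fun b => if b i then φ b else none
  | ctrl_mul {S : Finset ℕ} {t : ℕ} (h : t ∉ S) {x : M} {φ : (ℕ → Bool) → Option (ℕ → Bool)} :
      Computes x φ → Computes (g.ctrl S t * x) fun b => φ (addTo (monomial S) t b)

variable (g) in
/-- `x` is the composite of the projection to the complement of `l` and of `u`. -/
structure NormalForm (x : M) (φ : (ℕ → Bool) → Option (ℕ → Bool)) (t : ℕ)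
    (l : List (Finset ℕ)) (u : List (Finset ℕ × ℕ)) : Prop where
  mem : x ∈ g.free t
  eq : g.Z t * x = g.Z t * g.oracle l t * g.Z t * g.run u
  map_eq (b : ℕ → Bool) : φ b = if polynomial l b then none else some (act u b)

/-- Induction on the product. A projection in front is merged into the domain by `E_domain`; a gate
in front is pushed through the domain, changing its polynomial by substitution. The statement holds
for all large `m` and all ancillas `t ≥ m`, so that two normal forms can be given the same wires and
the same ancilla. -/
theorem Computes.exists_normalForm {x : M} {φ : (ℕ → Bool) → Option (ℕ → Bool)}
    (h : g.Computes x φ) : ∃ n, ∀ m ≥ n, ∀ t ≥ m, ∃ l u, (∀ S ∈ l, S ⊆ Finset.range m) ∧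
      IsWord (Finset.range m) u ∧ g.NormalForm x φ t l u := by
  induction h with
  | one =>
    refine ⟨0, fun m _ t _ => ⟨[], [], by simp, by simp [IsWord], one_mem _, ?_, fun b => rfl⟩⟩
    simp [oracle, run, Z_Z]
  | @E_mul i x φ _ ih =>
    obtain ⟨n, ih⟩ := ih
    refine ⟨n + i + 1, fun m hm t ht => ?_⟩
    obtain ⟨l, u, hl, hu, h1, h2, h3⟩ := ih m (by omega) t ht
    have him : i ∈ Finset.range m := by simp; omega
    have htm : t ∉ Finset.range m := by simpa using ht
    refine ⟨∅ :: (∅ :: l).map (insert i), u, ?_, hu, mul_mem (g.E_mem (by omega)) h1, ?_,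
      fun b => ?_⟩
    · intro S hS
      simp only [List.mem_cons, List.mem_map, exists_eq_or_imp] at hS
      rcases hS with rfl | rfl | ⟨S, hS, rfl⟩
      · simp
      · simpa using him
      · exact Finset.insert_subset him (hl S hS)
    · rw [← E_domain hl him htm, ← mul_assoc,
        ← (free_Z (g.E_mem (by omega : t ≠ i))).eq, mul_assoc, h2]
      simp only [mul_assoc]
    · have e : monomial ∅ b = true := by simp [monomial]
      rw [polynomial_cons, polynomial_map_insert, polynomial_cons, h3, e]
      cases b i <;> simp
  | @ctrl_mul S s hs x φ _ ih =>
    obtain ⟨n, ih⟩ := ih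
    -- The bound exceeds the target `s` and all controls in `S`.
    refine ⟨n + s + 1 + S.sup id + 1, fun m hm t ht => ?_⟩
    obtain ⟨l, u, hl, hu, h1, h2, h3⟩ := ih m (by omega) t ht
    have hS : S ⊆ Finset.range m := fun i hi => by
      have : i ≤ S.sup id := Finset.le_sup (f := id) hi
      simp; omega
    have hsm : s ∈ Finset.range m := by simp; omega
    have htm : t ∉ Finset.range m := by simpa using ht
    obtain ⟨r, hr, e, p⟩ := ctrl_conj_oracle (g := g) hS hsm hs hl htm
    have hZ : Commute (g.Z t) (g.ctrl S s) := Z_comm_ctrl hs (by omega)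
    refine ⟨r, (S, s) :: u, hr, IsWord.cons.2 ⟨⟨hS, hsm, hs⟩, hu⟩,
      mul_mem (ctrl_mem hs (fun h => htm (hS h)) (by omega)) h1, ?_, fun b => ?_⟩
    · rw [run_cons, ← mul_assoc, hZ.eq, mul_assoc, h2, ← e]
      simp only [← mul_assoc]
      rw [← hZ.eq]
      congr 1
      simp only [mul_assoc]
      rw [hZ.eq, ← mul_assoc (g.ctrl S s) (g.ctrl S s), ctrl_sq hs, one_mul]
    · rw [h3, p, act]

/-- Products of gates which compute the same partial map are equal. -/
theorem Computes.unique {x y : M} {φ : (ℕ → Bool) → Option (ℕ → Bool)} (hx : g.Computes x φ)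
    (hy : g.Computes y φ) : x = y := by
  obtain ⟨n, hx⟩ := hx.exists_normalForm
  obtain ⟨n', hy⟩ := hy.exists_normalForm
  set m := max n n'
  -- The wires from `m` to `m + m - 1` are reserved for the copies in `domain_run`, so the ancilla
  -- is placed at `m + m`.
  obtain ⟨l, u, hl, hu, h1, h2, h3⟩ := hx m (le_max_left _ _) (m + m) (by omega)
  obtain ⟨l', u', hl', hu', h1', h2', h3'⟩ := hy m (le_max_right _ _) (m + m) (by omega)
  refine cancel_Z h1 h1' ?_
  have hp : ∀ b, polynomial l b = polynomial l' b := fun b => by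
    have := (h3 b).symm.trans (h3' b)
    revert this
    cases polynomial l b <;> cases polynomial l' b <;> simp
  have ha : ∀ b, polynomial l b = false → act (u ++ u'.reverse) b = b := fun b hb => by
    have := (h3 b).symm.trans (h3' b)
    rw [← hp, hb] at this
    rw [act_append, Option.some.inj this, act_reverse hu']
  have key := domain_run (g := g) hl (hu.append hu'.reverse) le_rfl ha
  rw [h2, h2', ← oracle_ext (by simp) hl hl' hp]
  calc _ = g.Z (m + m) * g.oracle l (m + m) * g.Z (m + m) * (g.run (u ++ u'.reverse) * g.run u') := by
        rw [run_append, mul_assoc (g.run u), reverse_mul_run hu', mul_one]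
    _ = _ := by rw [← mul_assoc, key]

end GateSystem


/-! ### Germs of circuits on infinitely many wires -/

namespace Circuit.Mor

instance (n : ℕ) : Monoid (Mor n n) where
  mul f g := f ∘> g
  one := one n
  mul_assoc f g h := assoc f g h
  one_mul f := one_comp f
  mul_one f := comp_one f

theorem mul_def {n : ℕ} (f g : Mor n n) : f * g = f ∘> g := rfl

/-- No transport is needed for a wire added at the bottom, since `n + (m + 1)` and `n + m + 1` agree
by definition. -/
theorem tensor_one_assoc {a a' b b' : ℕ} (f : Mor a a') (g : Mor b b') :
    (f ⊗> g) ⊗> one 1 = f ⊗> (g ⊗> one 1) := tensor_assoc f g (one 1)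

theorem tensor_one_succ {a a' : ℕ} (f : Mor a a') (n : ℕ) :
    f ⊗> one (n + 1) = (f ⊗> one n) ⊗> one 1 := by
  rw [tensor_one_assoc, one_tensor]

theorem cast_cast {a b a' b' a'' b'' : ℕ} (ha : a = a') (hb : b = b') (ha' : a' = a'')
    (hb' : b' = b'') (f : Mor a b) :
    cast ha' hb' (cast ha hb f) = cast (ha.trans ha') (hb.trans hb') f := by
  subst ha hb ha' hb'; rfl

theorem cast_injective {a b a' b' : ℕ} {ha : a = a'} {hb : b = b'} {f g : Mor a b}
    (h : cast ha hb f = cast ha hb g) : f = g := by subst ha hb; exact h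

/-- Families of morphisms on any number of wires are identified if they eventually agree. -/
def eventuallyEq : Con (∀ n, Mor n n) where
  r x y := ∀ᶠ n in Filter.atTop, x n = y n
  iseqv :=
    { refl := fun x => .of_forall fun n => rfl
      symm := fun h => h.mono fun n h => h.symm
      trans := fun h h' => (h.and h').mono fun n h => h.1.trans h.2 }
  mul' h h' := (h.and h').mono fun n h => by rw [Pi.mul_apply, Pi.mul_apply, h.1, h.2]

end Circuit.Mor

open Circuit Circuit.Mor in
/-- Circuits on infinitely many wires, almost all of which are not touched. The wires are numbered
from the bottom. -/
abbrev Germ : Type := eventuallyEq.Quotient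

namespace Germ

open Circuit.Mor

/-- The germ of a family of morphisms. -/
def of : (∀ n, Circuit.Mor n n) →* Germ := eventuallyEq.mk'

theorem of_surjective : Function.Surjective of := Con.mk'_surjective

theorem of_eq {x y : ∀ n, Circuit.Mor n n} : of x = of y ↔ ∀ᶠ n in Filter.atTop, x n = y n :=
  eventuallyEq.eq

theorem germ_ext {x y : ∀ n, Circuit.Mor n n} (k : ℕ) (h : ∀ r, x (r + k) = y (r + k)) : of x = of y :=
  of_eq.2 <| Filter.eventually_atTop.2 ⟨k, fun n hn => by
    obtain ⟨r, rfl⟩ := Nat.exists_eq_add_of_le' hn; exact h r⟩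

theorem exists_of_germ_eq {x y : ∀ n, Circuit.Mor n n} (h : of x = of y) :
    ∃ k, ∀ n ≥ k, x n = y n := Filter.eventually_atTop.1 (of_eq.1 h)

/-- Adding a wire at the bottom. -/
def shiftFamily : (∀ n, Circuit.Mor n n) →* (∀ n, Circuit.Mor n n) where
  toFun x n := match n with
    | 0 => one 0
    | n + 1 => x n ⊗> one 1
  map_one' := by
    funext n
    cases n with
    | zero => rfl
    | succ n => exact one_tensor n 1
  map_mul' x y := by
    funext n
    cases n with
    | zero => exact (one_comp _).symm
    | succ n =>
      change (x n ∘> y n) ⊗> one 1 = (x n ⊗> one 1) ∘> (y n ⊗> one 1)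
      rw [tensor_comp, one_comp]

/-- The germ in which the numbers of all wires are increased by one. -/
def shift : Germ →* Germ := eventuallyEq.lift (of.comp shiftFamily) fun x y h => by
  obtain ⟨k, hk⟩ := Filter.eventually_atTop.1 (h : ∀ᶠ n in Filter.atTop, x n = y n)
  refine germ_ext (k + 1) fun r => ?_
  exact congrArg (· ⊗> one 1) (hk (r + k) (by omega))

theorem shift_of (x : ∀ n, Circuit.Mor n n) : shift (of x) = of (shiftFamily x) := rfl

/-- The family of morphisms which act as `f` on the last wires. -/
def stabFamily {n m : ℕ} (h : n = m) (f : Circuit.Mor n m) (k : ℕ) : Circuit.Mor k k :=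
  if hk : n ≤ k then cast (Nat.sub_add_cancel hk) (by rw [← h, Nat.sub_add_cancel hk])
    (one (k - n) ⊗> f) else one k

theorem stabFamily_add {n m : ℕ} (h : n = m) (f : Circuit.Mor n m) (r : ℕ) :
    stabFamily h f (r + n) = cast rfl (by rw [h]) (one r ⊗> f) := by
  have key : ∀ k (e : r + n = k), stabFamily h f k = cast e (by rw [← h, e]) (one r ⊗> f) := by
    intro k e
    have hr : r = k - n := by omega
    subst hr
    rw [stabFamily, dif_pos (by omega)]
  exact key _ rfl

theorem stabFamily_add_self {n : ℕ} (f : Circuit.Mor n n) (r : ℕ) :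
    stabFamily rfl f (r + n) = one r ⊗> f := stabFamily_add rfl f r

/-- The germ which acts as `f` on the last wires. -/
def stab {n m : ℕ} (h : n = m) (f : Circuit.Mor n m) : Germ := of (stabFamily h f)

theorem stab_cast {n m n' m' : ℕ} (h : n = m) (hn : n = n') (hm : m = m') (f : Circuit.Mor n m) :
    stab (hn.symm.trans (h.trans hm)) (cast hn hm f) = stab h f := by
  subst hn hm; rfl

theorem stab_comp {n m p : ℕ} (h : n = m) (h' : m = p) (f : Circuit.Mor n m)
    (g : Circuit.Mor m p) : stab h f * stab h' g = stab (h.trans h') (f ∘> g) := by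
  subst h h'
  rw [stab, stab, ← map_mul]
  refine germ_ext n fun r => ?_
  rw [Pi.mul_apply, stabFamily_add_self, stabFamily_add_self, stabFamily_add_self, mul_def,
    tensor_comp, one_comp]

theorem stab_one (n : ℕ) : stab rfl (one n) = 1 := by
  rw [← map_one of]
  refine germ_ext n fun r => ?_
  rw [stabFamily_add_self, one_tensor]; rfl

theorem stab_tensor_one {n m : ℕ} (h : n = m) (f : Circuit.Mor n m) :
    stab (by rw [h]) (f ⊗> one 1) = shift (stab h f) := by
  subst h
  refine germ_ext (n + 1) fun r => ?_
  have e : shiftFamily (stabFamily rfl f) (r + (n + 1)) = stabFamily rfl f (r + n) ⊗> one 1 := rfl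
  rw [e, stabFamily_add_self, stabFamily_add_self, tensor_one_assoc]

/-- A germ does not see how many idle wires there are above the active ones. -/
theorem stab_one_tensor {n m : ℕ} (h : n = m) (k : ℕ) (f : Circuit.Mor n m) :
    stab (by rw [h]) (one k ⊗> f) = stab h f := by
  subst h
  refine germ_ext (k + n) fun r => ?_
  rw [stabFamily_add_self]
  have key : ∀ p (e : r + k + n = p), stabFamily rfl f p = cast e e (one (r + k) ⊗> f) := by
    rintro _ rfl
    exact stabFamily_add_self f _
  rw [key _ (Nat.add_assoc r k n), ← one_tensor r k, tensor_assoc (one r) (one k) f]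

/-- The idle wires on top are removed one by one, by preparing them in state `1` and measuring `1`.
-/
theorem stab_injective {n m : ℕ} (h : n = m) {f g : Circuit.Mor n m}
    (e : stab h f = stab h g) : f = g := by
  subst h
  obtain ⟨k, hk⟩ := exists_of_germ_eq e
  have h := hk (k + n) (by omega)
  rw [stabFamily_add_self, stabFamily_add_self] at h
  clear hk e
  induction k with
  | zero =>
    have := congrArg (cast (Nat.zero_add n) (Nat.zero_add n)) h
    rwa [unit_tensor, unit_tensor] at this
  | succ k ih =>
    refine ih ?_
    have e1 (f : Circuit.Mor n n) : one (k + 1) ⊗> f =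
        cast (by omega) (by omega) (one 1 ⊗> (one k ⊗> f)) := by
      rw [← tensor_assoc, Circuit.Mor.cast_cast, one_tensor]
      have key : ∀ a (e : a = k + 1), one (k + 1) ⊗> f =
          cast (by rw [e]) (by rw [e]) (one a ⊗> f) := by
        rintro _ rfl; rfl
      exact key _ (Nat.add_comm 1 k)
    rw [e1, e1] at h
    have h := congrArg (fun x => (K ⊗> one (k + n)) ∘> x ∘> (B ⊗> one (k + n))) (cast_injective h)
    simp only [tensor_comp, one_comp, comp_one, K_B] at h
    have := congrArg (cast (Nat.zero_add (k + n)) (Nat.zero_add (k + n))) h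
    rwa [unit_tensor, unit_tensor] at this

theorem shift_iterate_family (x : ∀ n, Circuit.Mor n n) (k r : ℕ) :
    (shiftFamily^[k] x) (r + k) = x r ⊗> one k := by
  induction k with
  | zero => exact (tensor_unit _).symm
  | succ k ih =>
    rw [Function.iterate_succ_apply', tensor_one_succ, ← ih]
    rfl

theorem shift_iterate (x : ∀ n, Circuit.Mor n n) (k : ℕ) :
    shift^[k] (of x) = of (shiftFamily^[k] x) := by
  induction k with
  | zero => rfl
  | succ k ih => rw [Function.iterate_succ_apply', ih, Function.iterate_succ_apply', shift_of]

/-- Germs on disjoint sets of wires commute. -/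
theorem stab_comm_shift {n : ℕ} (f : Circuit.Mor n n) (y : Germ) :
    Commute (stab rfl f) (shift^[n] y) := by
  obtain ⟨y, rfl⟩ := of_surjective y
  rw [shift_iterate]
  refine (map_mul of _ _).symm.trans (Eq.trans ?_ (map_mul of _ _))
  refine germ_ext n fun r => ?_
  rw [Pi.mul_apply, Pi.mul_apply, shift_iterate_family, stabFamily_add_self, mul_def, mul_def,
    tensor_comp, tensor_comp, one_comp, one_comp, comp_one, comp_one]

theorem cancel_shift {x y : Germ} (h : stab rfl (B ∘> K) * shift x = stab rfl (B ∘> K) * shift y) :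
    x = y := by
  obtain ⟨x, rfl⟩ := of_surjective x
  obtain ⟨y, rfl⟩ := of_surjective y
  rw [shift_of, shift_of, stab, ← map_mul, ← map_mul] at h
  obtain ⟨k, hk⟩ := exists_of_germ_eq h
  refine germ_ext k fun r => ?_
  have h := hk (r + k + 1) (by omega)
  rw [Pi.mul_apply, Pi.mul_apply, stabFamily_add_self] at h
  have e (x : ∀ n, Circuit.Mor n n) : shiftFamily x (r + k + 1) = x (r + k) ⊗> one 1 := rfl
  rw [e, e, mul_def, mul_def, tensor_comp, tensor_comp, one_comp, comp_one, one_comp] at h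
  have h := congrArg (fun x => (one (r + k) ⊗> K) ∘> x ∘> (one (r + k) ⊗> B)) h
  have e : K ∘> (B ∘> K) ∘> B = one 0 := by rw [assoc, K_B, comp_one, K_B]
  simp only [tensor_comp, one_comp, comp_one, e] at h
  exact (tensor_unit _).symm.trans (h.trans (tensor_unit _))

end Germ


namespace Germ

open Circuit.Mor

/-! ### Permutations of the wires -/

/-- The exchange of the wires `i` and `i + 1`. -/
def adjacent (i : ℕ) : Germ := shift^[i] (stab rfl S)

theorem shift_iterate_mul (k : ℕ) (x y : Germ) :
    shift^[k] (x * y) = shift^[k] x * shift^[k] y := iterate_map_mul shift k x y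

theorem shift_iterate_one (k : ℕ) : shift^[k] (1 : Germ) = 1 := iterate_map_one shift k

theorem adjacent_sq (i : ℕ) : adjacent i * adjacent i = 1 := by
  rw [adjacent, ← shift_iterate_mul, stab_comp, S_S, stab_one, shift_iterate_one]

theorem adjacent_add (i k : ℕ) : adjacent (i + k) = shift^[i] (adjacent k) :=
  Function.iterate_add_apply _ _ _ _

theorem adjacent_comm {i j : ℕ} (h : i + 2 ≤ j) : Commute (adjacent i) (adjacent j) := by
  obtain ⟨k, rfl⟩ := Nat.exists_eq_add_of_le h
  have e : adjacent i = shift^[i] (stab rfl S) := rfl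
  rw [show i + 2 + k = i + (2 + k) by omega, adjacent_add, e]
  have h := stab_comm_shift (n := 2) S (adjacent k)
  rw [← adjacent_add] at h
  rw [Commute, SemiconjBy, ← shift_iterate_mul, ← shift_iterate_mul]
  exact congrArg _ h.eq

/-- This is naturality of the exchange of one wire with two, decomposed by the hexagon. -/
theorem S_braid : (S ⊗> one 1) ∘> (one 1 ⊗> S) ∘> (S ⊗> one 1) =
    (one 1 ⊗> S) ∘> (S ⊗> one 1) ∘> (one 1 ⊗> S) := by
  have hex : mk (Circuit.swap 1 2) = (S ⊗> one 1) ∘> (one 1 ⊗> S) :=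
    Circuit.Mor.mk_eq.2 (Circuit.Equiv.hexagon 1 1 1)
  have h : (one 1 ⊗> S) ∘> mk (Circuit.swap 1 2) = mk (Circuit.swap 1 2) ∘> (S ⊗> one 1) :=
    swap_natural (one 1) S
  rw [hex, assoc] at h
  exact h.symm

theorem adjacent_braid (i : ℕ) : adjacent i * adjacent (i + 1) * adjacent i =
    adjacent (i + 1) * adjacent i * adjacent (i + 1) := by
  have h0 : adjacent 0 = stab rfl (one 1 ⊗> S) := (stab_one_tensor rfl 1 S).symm
  have h1 : adjacent 1 = stab rfl (S ⊗> one 1) := (stab_tensor_one rfl S).symm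
  have e : adjacent i = shift^[i] (adjacent 0) := rfl
  rw [adjacent_add i 1, e]
  simp only [← shift_iterate_mul]
  congr 1
  rw [h0, h1]
  simp only [stab_comp, assoc]
  rw [S_braid]

def adjacentUnit (i : ℕ) : Germˣ := ⟨adjacent i, adjacent i, adjacent_sq i, adjacent_sq i⟩

/-- The exchange of the wires `i` and `i + 1`, together with the corresponding permutation. -/
def generator (i : ℕ) : Germˣ × Equiv.Perm ℕ := (adjacentUnit i, Equiv.swap i (i + 1))

theorem generator_sq (i : ℕ) : generator i * generator i = 1 :=
  Prod.ext (Units.ext (adjacent_sq i)) (Equiv.swap_mul_self _ _)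

theorem generator_inv (i : ℕ) : (generator i)⁻¹ = generator i :=
  inv_eq_of_mul_eq_one_left (generator_sq i)

theorem generator_comm {i j : ℕ} (h : i + 2 ≤ j) :
    Commute (generator i) (generator j) := by
  refine Prod.ext (Units.ext (adjacent_comm h).eq) (Equiv.ext fun a => ?_)
  simp only [generator, Prod.mk_mul_mk, Equiv.Perm.mul_apply, Equiv.swap_apply_def]
  split_ifs <;> omega

theorem generator_braid (i : ℕ) : generator i * generator (i + 1) * generator i =
    generator (i + 1) * generator i * generator (i + 1) := by
  refine Prod.ext (Units.ext (adjacent_braid i)) (Equiv.ext fun a => ?_)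
  simp only [generator, Prod.mk_mul_mk, Equiv.Perm.mul_apply, Equiv.swap_apply_def]
  split_ifs <;> omega

/-- The group of permutations of the wires with numbers at least `k`, given by circuits and by
permutations of the natural numbers. -/
def permutations (k : ℕ) : Subgroup (Germˣ × Equiv.Perm ℕ) :=
  Subgroup.closure {p | ∃ i ≥ k, p = generator i}

theorem generator_mem {i k : ℕ} (h : k ≤ i) : generator i ∈ permutations k :=
  Subgroup.subset_closure ⟨i, h, rfl⟩

theorem permutations_induction {k : ℕ} {motive : Germˣ × Equiv.Perm ℕ → Prop} (one : motive 1)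
    (mul : ∀ i ≥ k, ∀ p, motive p → motive (generator i * p)) {p : Germˣ × Equiv.Perm ℕ}
    (hp : p ∈ permutations k) : motive p := by
  refine Subgroup.closure_induction_left (p := fun x _ => motive x) one ?_ ?_ hp
  · rintro _ ⟨i, hi, rfl⟩ p _ h
    exact mul i hi p h
  · rintro _ ⟨i, hi, rfl⟩ p _ h
    rw [generator_inv]
    exact mul i hi p h

theorem permutations_le {k l : ℕ} (h : k ≤ l) : permutations l ≤ permutations k :=
  Subgroup.closure_mono fun _ ⟨i, hi, e⟩ => ⟨i, h.trans hi, e⟩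

/-- The cyclic permutation which moves `k` to `k + n`. -/
def walk (k : ℕ) : ℕ → Germˣ × Equiv.Perm ℕ
  | 0 => 1
  | n + 1 => generator (k + n) * walk k n

theorem walk_mem (k n : ℕ) : walk k n ∈ permutations k := by
  induction n with
  | zero => exact one_mem _
  | succ n ih => exact mul_mem (generator_mem (by omega)) ih

theorem walk_apply (k n : ℕ) : (walk k n).2 k = k + n := by
  induction n with
  | zero => rfl
  | succ n ih =>
    rw [walk, Prod.snd_mul, Equiv.Perm.mul_apply, ih]
    exact Equiv.swap_apply_left _ _

theorem generator_comm_walk {i k n : ℕ} (h : k + n < i) : Commute (generator i) (walk k n) := by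
  induction n with
  | zero => exact .one_right _
  | succ n ih => exact (generator_comm (by omega)).symm.mul_right (ih (by omega))

/-- A transposition inside the range of the cycle is moved through it by one braid relation, and its
index increases by one. -/
theorem generator_mul_walk {k e n : ℕ} (h : e + 2 ≤ n) :
    generator (k + e) * walk k n = walk k n * generator (k + e + 1) := by
  induction n, h using Nat.le_induction with
  | base =>
    have e1 : walk k (e + 2) = generator (k + e + 1) * (generator (k + e) * walk k e) := rfl
    rw [e1, ← mul_assoc, ← mul_assoc, generator_braid]
    simp only [mul_assoc]
    rw [(generator_comm_walk (by omega)).eq]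
  | succ n hn ih =>
    rw [walk, ← mul_assoc, (generator_comm (by omega)).eq, mul_assoc, ih, mul_assoc]

/-- Coset representatives: multiplying a walk by a generator either lengthens it, shortens it, or
moves the generator to the right with index at least `k + 1`. -/
theorem exists_walk {k : ℕ} {p : Germˣ × Equiv.Perm ℕ} (hp : p ∈ permutations k) :
    ∃ n, ∃ y ∈ permutations (k + 1), p = walk k n * y := by
  refine permutations_induction (motive := fun p => ∃ n, ∃ y ∈ permutations (k + 1),
    p = walk k n * y) ⟨0, 1, one_mem _, (one_mul _).symm⟩ ?_ hp
  rintro i hi _ ⟨n, y, hy, rfl⟩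
  obtain ⟨e, rfl⟩ := Nat.exists_eq_add_of_le hi
  rcases lt_trichotomy e n with h | rfl | h
  · rcases Nat.lt_or_ge (e + 1) n with h' | h'
    · refine ⟨n, generator (k + e + 1) * y, mul_mem (generator_mem (by omega)) hy, ?_⟩
      rw [← mul_assoc, generator_mul_walk h', mul_assoc]
    · obtain rfl : n = e + 1 := by omega
      refine ⟨e, y, hy, ?_⟩
      rw [walk, mul_assoc, ← mul_assoc, generator_sq, one_mul]
  · exact ⟨e + 1, y, hy, by rw [walk, mul_assoc]⟩
  · refine ⟨n, generator (k + e) * y, mul_mem (generator_mem (by omega)) hy, ?_⟩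
    rw [← mul_assoc, (generator_comm_walk (by omega)).eq, mul_assoc]

theorem apply_of_lt {k i : ℕ} (hi : i < k) {p : Germˣ × Equiv.Perm ℕ} (hp : p ∈ permutations k) :
    p.2 i = i := by
  refine permutations_induction (motive := fun p => p.2 i = i) rfl ?_ hp
  intro j hj p h
  rw [Prod.snd_mul, Equiv.Perm.mul_apply, h]
  exact Equiv.swap_apply_of_ne_of_ne (by omega) (by omega)

theorem mem_permutations_succ {k : ℕ} {p : Germˣ × Equiv.Perm ℕ} (hp : p ∈ permutations k)
    (h : p.2 k = k) : p ∈ permutations (k + 1) := by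
  obtain ⟨n, y, hy, rfl⟩ := exists_walk hp
  rw [Prod.snd_mul, Equiv.Perm.mul_apply, apply_of_lt (by omega) hy, walk_apply] at h
  obtain rfl : n = 0 := by omega
  rwa [walk, one_mul]

/-- Fixing `k` forces the walk in the decomposition of `exists_walk` to be empty. This replaces a
presentation of the symmetric groups: it is all that is needed to see that a gate placed on given
wires does not depend on the chosen permutation circuit. -/
theorem mem_permutations {k : ℕ} {p : Germˣ × Equiv.Perm ℕ} (hp : p ∈ permutations 0)
    (h : ∀ i < k, p.2 i = i) : p ∈ permutations k := by
  induction k with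
  | zero => exact hp
  | succ k ih => exact mem_permutations_succ (ih fun i hi => h i (by omega)) (h k (by omega))

theorem exists_shift_eq {k : ℕ} {p : Germˣ × Equiv.Perm ℕ} (hp : p ∈ permutations k) :
    ∃ z, (p.1 : Germ) = shift^[k] z := by
  refine permutations_induction (motive := fun p => ∃ z, (p.1 : Germ) = shift^[k] z)
    ⟨1, (shift_iterate_one k).symm⟩ ?_ hp
  rintro i hi p ⟨z, hz⟩
  obtain ⟨e, rfl⟩ := Nat.exists_eq_add_of_le hi
  exact ⟨adjacent e * z, by
    rw [shift_iterate_mul, ← hz, ← adjacent_add, Prod.fst_mul, Units.val_mul]; rfl⟩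

theorem exists_permutation {k : ℕ} (ι : Fin k → ℕ) (h : Function.Injective ι) :
    ∃ p ∈ permutations 0, ∀ i : Fin k, p.2 i = ι i := by
  induction k with
  | zero => exact ⟨1, one_mem _, fun i => i.elim0⟩
  | succ k ih =>
    obtain ⟨p, hp, e⟩ := ih (fun i => ι i.castSucc) (h.comp (Fin.castSucc_injective k))
    obtain ⟨j, hj⟩ := p.2.surjective (ι (Fin.last k))
    have hk : k ≤ j := by
      by_contra hlt
      have := e ⟨j, by omega⟩
      rw [hj] at this
      have := congrArg Fin.val (h this)
      simp at this; omega
    obtain ⟨n, rfl⟩ := Nat.exists_eq_add_of_le hk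
    refine ⟨p * walk k n, mul_mem hp (permutations_le (by omega) (walk_mem k n)), fun i => ?_⟩
    rw [Prod.snd_mul, Equiv.Perm.mul_apply]
    refine Fin.lastCases ?_ (fun i => ?_) i
    · rw [Fin.val_last, walk_apply, hj]
    · rw [Fin.val_castSucc, apply_of_lt i.2 (walk_mem k n), e]

/-! ### Gates on arbitrary wires -/

/-- Conjugation by an invertible germ. -/
def conj (p : Germˣ) : Germ →* Germ where
  toFun x := p * x * (p⁻¹ : Germˣ)
  map_one' := by simp
  map_mul' x y := by simp [mul_assoc]

theorem conj_mul (p q : Germˣ) (x : Germ) : conj (p * q) x = conj p (conj q x) := by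
  simp [conj, mul_assoc]

theorem conj_one (x : Germ) : conj 1 x = x := by simp [conj]

theorem conj_eq_self {p : Germˣ} {x : Germ} (h : Commute (p : Germ) x) : conj p x = x := by
  change p * x * (p⁻¹ : Germˣ) = x
  rw [h.eq, mul_assoc, Units.mul_inv, mul_one]

/-- The quotient of the two permutations fixes the first `k` wires. Hence it is `k` times shifted,
and commutes with the germ of `f`. -/
theorem conj_stab_congr {k : ℕ} (f : Circuit.Mor k k) {p q : Germˣ × Equiv.Perm ℕ}
    (hp : p ∈ permutations 0) (hq : q ∈ permutations 0) (h : ∀ i < k, p.2 i = q.2 i) :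
    conj p.1 (stab rfl f) = conj q.1 (stab rfl f) := by
  have h1 : q⁻¹ * p ∈ permutations k := mem_permutations (mul_mem (inv_mem hq) hp) fun i hi => by
    rw [Prod.snd_mul, Equiv.Perm.mul_apply, h i hi]
    exact q.2.symm_apply_apply i
  obtain ⟨z, hz⟩ := exists_shift_eq h1
  have h2 : conj (q⁻¹ * p).1 (stab rfl f) = stab rfl f :=
    conj_eq_self (by rw [hz]; exact (stab_comm_shift f z).symm)
  conv_rhs => rw [← h2]
  rw [← conj_mul, ← Prod.fst_mul, mul_inv_cancel_left]

open Classical in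
/-- The germ which acts as `f` on the wires `ι i`. -/
noncomputable def place {k : ℕ} (f : Circuit.Mor k k) (ι : Fin k → ℕ) : Germ :=
  -- For injective `ι` a permutation exists by `exists_permutation`; otherwise `1` is a dummy value.
  if h : ∃ p ∈ permutations 0, ∀ i : Fin k, p.2 i = ι i then conj h.choose.1 (stab rfl f) else 1

theorem place_eq {k : ℕ} (f : Circuit.Mor k k) {ι : Fin k → ℕ} {p : Germˣ × Equiv.Perm ℕ}
    (hp : p ∈ permutations 0) (h : ∀ i : Fin k, p.2 i = ι i) :
    place f ι = conj p.1 (stab rfl f) := by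
  have h' : ∃ p ∈ permutations 0, ∀ i : Fin k, p.2 i = ι i := ⟨p, hp, h⟩
  rw [place, dif_pos h']
  refine conj_stab_congr f h'.choose_spec.1 hp fun i hi => ?_
  rw [h'.choose_spec.2 ⟨i, hi⟩, h ⟨i, hi⟩]

theorem place_id {k : ℕ} (f : Circuit.Mor k k) : place f (fun i => i) = stab rfl f := by
  exact (place_eq f (p := 1) (one_mem _) fun i => rfl).trans (conj_one _)

theorem conj_place {k : ℕ} (f : Circuit.Mor k k) {ι : Fin k → ℕ} (hι : Function.Injective ι)
    {p : Germˣ × Equiv.Perm ℕ} (hp : p ∈ permutations 0) :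
    conj p.1 (place f ι) = place f fun i => p.2 (ι i) := by
  obtain ⟨q, hq, h⟩ := exists_permutation ι hι
  rw [place_eq f hq h, ← conj_mul, ← Prod.fst_mul]
  refine (place_eq f (mul_mem hp hq) fun i => ?_).symm
  rw [Prod.snd_mul, Equiv.Perm.mul_apply, h]

/-- The effect of `shift` on permutations. -/
noncomputable def shiftPerm : Equiv.Perm ℕ →* Equiv.Perm ℕ :=
  Equiv.Perm.viaEmbeddingHom ⟨Nat.succ, Nat.succ_injective⟩

theorem shiftPerm_succ (π : Equiv.Perm ℕ) (i : ℕ) : shiftPerm π (i + 1) = π i + 1 :=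
  Equiv.Perm.viaEmbedding_apply π ⟨Nat.succ, Nat.succ_injective⟩ i

theorem shiftPerm_zero (π : Equiv.Perm ℕ) : shiftPerm π 0 = 0 :=
  Equiv.Perm.viaEmbedding_apply_of_notMem π ⟨Nat.succ, Nat.succ_injective⟩ 0
    fun ⟨_, h⟩ => Nat.succ_ne_zero _ h

theorem shift_mem {k : ℕ} {p : Germˣ × Equiv.Perm ℕ} (hp : p ∈ permutations k) :
    (Units.map shift p.1, shiftPerm p.2) ∈ permutations (k + 1) := by
  refine permutations_induction (motive := fun p =>
    (Units.map shift p.1, shiftPerm p.2) ∈ permutations (k + 1)) ?_ ?_ hp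
  · have e : ((Units.map shift) (1 : Germˣ), shiftPerm 1) = 1 := by rw [map_one, map_one]; rfl
    change ((Units.map shift) (1 : Germˣ), shiftPerm 1) ∈ _
    rw [e]
    exact one_mem _
  · intro i hi p h
    have e : (Units.map shift (generator i).1, shiftPerm (generator i).2) = generator (i + 1) := by
      refine Prod.ext (Units.ext ?_) (Equiv.ext fun a => ?_)
      · exact (Function.iterate_succ_apply' shift i _).symm
      · cases a with
        | zero =>
          rw [shiftPerm_zero]
          exact (Equiv.swap_apply_of_ne_of_ne (by omega) (by omega)).symm
        | succ a =>
          rw [shiftPerm_succ]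
          simp only [generator, Equiv.swap_apply_def]
          split_ifs <;> omega
    have := mul_mem (generator_mem (show k + 1 ≤ i + 1 by omega)) h
    rw [← e] at this
    simpa using this

theorem exists_swap_one (n : ℕ) : ∃ q ∈ permutations 0,
    (q.1 : Germ) = stab (Nat.add_comm 1 n) (mk (Circuit.swap 1 n)) ∧ ∀ i < n, q.2 (i + 1) = i := by
  induction n with
  | zero => exact ⟨1, one_mem _, by rw [swap_one_zero]; exact (stab_one 1).symm, by simp⟩
  | succ n ih =>
    obtain ⟨q, hq, e, h⟩ := ih
    refine ⟨(Units.map shift q.1, shiftPerm q.2) * generator 0,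
      mul_mem (permutations_le (by omega) (shift_mem hq)) (generator_mem le_rfl), ?_, ?_⟩
    · have hex : mk (Circuit.swap 1 (n + 1)) = (mk (Circuit.swap 1 n) ⊗> one 1) ∘> (one n ⊗> S) :=
        Circuit.Mor.mk_eq.2 (Circuit.Equiv.hexagon 1 n 1)
      rw [hex]
      refine Eq.trans ?_ (stab_comp (show 1 + n + 1 = n + 1 + 1 by omega) rfl _ _)
      rw [stab_tensor_one (Nat.add_comm 1 n), ← e]
      exact congrArg (_ * ·) (stab_one_tensor rfl n S).symm
    · intro i hi
      rw [Prod.snd_mul, Equiv.Perm.mul_apply]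
      cases i with
      | zero =>
        have : (generator 0).2 (0 + 1) = 0 := Equiv.swap_apply_right _ _
        rw [this, shiftPerm_zero]
      | succ i =>
        have : (generator 0).2 (i + 1 + 1) = i + 1 + 1 :=
          Equiv.swap_apply_of_ne_of_ne (by omega) (by omega)
        rw [this, shiftPerm_succ, h i (by omega)]

/-- By naturality of the symmetry, moving an idle wire from the top to the bottom conjugates `f`
into its shift. -/
theorem exists_shift_stab (n : ℕ) : ∃ q ∈ permutations 0, (∀ i < n, q.2 i = i + 1) ∧
    ∀ f : Circuit.Mor n n, shift (stab rfl f) = conj q.1 (stab rfl f) := by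
  obtain ⟨q, hq, e, h⟩ := exists_swap_one n
  refine ⟨q⁻¹, inv_mem hq, fun i hi => ?_, fun f => ?_⟩
  · conv_lhs => rw [← h i hi]
    exact q.2.symm_apply_apply _
  · set y := stab (Nat.add_comm n 1) (mk (Circuit.swap n 1)) with hy
    have hyq : y = ((q.1⁻¹ : Germˣ) : Germ) := by
      have h1 : y * q.1 = 1 := by
        rw [e, hy, stab_comp, swap_swap]; exact stab_one _
      exact (Units.mul_eq_one_iff_eq_inv).1 h1
    have h1 := congrArg (stab (Nat.add_comm n 1)) (swap_natural f (one 1))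
    rw [← stab_comp rfl (Nat.add_comm n 1), ← stab_comp (Nat.add_comm n 1) rfl, stab_tensor_one rfl f,
      stab_one_tensor rfl 1 f, ← hy, hyq] at h1
    change _ = ((q.1⁻¹ : Germˣ) : Germ) * stab rfl f * ((q.1⁻¹⁻¹ : Germˣ) : Germ)
    rw [← h1, inv_inv, Units.inv_mul_cancel_right]

theorem shift_conj (p : Germˣ) (x : Germ) : shift (conj p x) = conj (Units.map shift p) (shift x) := by
  change shift (p * x * (p⁻¹ : Germˣ)) = _
  rw [map_mul, map_mul]
  rfl

theorem shift_place {k : ℕ} (f : Circuit.Mor k k) {ι : Fin k → ℕ} (hι : Function.Injective ι) :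
    shift (place f ι) = place f fun i => ι i + 1 := by
  obtain ⟨p, hp, h⟩ := exists_permutation ι hι
  obtain ⟨q, hq, h', e⟩ := exists_shift_stab k
  rw [place_eq f hp h, shift_conj, e, ← conj_mul]
  refine (place_eq f (p := (Units.map shift p.1, shiftPerm p.2) * q)
    (mul_mem (permutations_le (by omega) (shift_mem hp)) hq) fun i => ?_).symm
  rw [Prod.snd_mul, Equiv.Perm.mul_apply, h' i i.2, shiftPerm_succ, h]

end Germ


namespace Germ

open Circuit.Mor

/-! ### The gates -/

theorem stab_mul {n : ℕ} (f g : Circuit.Mor n n) :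
    stab rfl (f ∘> g) = stab rfl f * stab rfl g := (stab_comp rfl rfl f g).symm

theorem stab_tensor_ones {n : ℕ} (f : Circuit.Mor n n) (k : ℕ) :
    stab rfl (f ⊗> one k) = shift^[k] (stab rfl f) := by
  induction k with
  | zero => rw [tensor_unit]; rfl
  | succ k ih => rw [Function.iterate_succ_apply', ← ih, tensor_one_succ]; exact stab_tensor_one rfl _

/-- The list of wires is reversed because germs number wires from the bottom, where the gate has its
target. -/
noncomputable def toffoli (i j k : ℕ) : Germ := place T ![k, j, i]
noncomputable def cnot (i j : ℕ) : Germ := place C ![j, i]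
noncomputable def exch (i j : ℕ) : Germ := place S ![j, i]

/-- The germ which acts as `e` on wire `i`. -/
noncomputable def wire (e : Circuit.Mor 1 1) (i : ℕ) : Germ := place e ![i]

theorem injective_one (a : ℕ) : Function.Injective ![a] := fun i j _ => Subsingleton.elim i j

theorem injective_two {a b : ℕ} (hab : a ≠ b) : Function.Injective ![b, a] := by
  intro i j h
  fin_cases i <;> fin_cases j <;> simp_all

theorem injective_three {a b c : ℕ} (hab : a ≠ b) (hac : a ≠ c) (hbc : b ≠ c) :
    Function.Injective ![c, b, a] := by
  intro i j h
  fin_cases i <;> fin_cases j <;> simp_all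

theorem exists_perm_one (a : ℕ) : ∃ p ∈ permutations 0, p.2 0 = a := by
  obtain ⟨p, hp, h⟩ := exists_permutation ![a] (injective_one a)
  exact ⟨p, hp, h 0⟩

theorem exists_perm_two {a b : ℕ} (hab : a ≠ b) :
    ∃ p ∈ permutations 0, p.2 1 = a ∧ p.2 0 = b := by
  obtain ⟨p, hp, h⟩ := exists_permutation ![b, a] (injective_two hab)
  exact ⟨p, hp, h 1, h 0⟩

theorem exists_perm_three {a b c : ℕ} (hab : a ≠ b) (hac : a ≠ c) (hbc : b ≠ c) :
    ∃ p ∈ permutations 0, p.2 2 = a ∧ p.2 1 = b ∧ p.2 0 = c := by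
  obtain ⟨p, hp, h⟩ := exists_permutation ![c, b, a] (injective_three hab hac hbc)
  exact ⟨p, hp, h 2, h 1, h 0⟩

theorem exists_perm_four {a b c d : ℕ} (hab : a ≠ b) (hac : a ≠ c) (had : a ≠ d) (hbc : b ≠ c)
    (hbd : b ≠ d) (hcd : c ≠ d) :
    ∃ p ∈ permutations 0, p.2 3 = a ∧ p.2 2 = b ∧ p.2 1 = c ∧ p.2 0 = d := by
  obtain ⟨p, hp, h⟩ := exists_permutation ![d, c, b, a] (by
    intro i j h
    fin_cases i <;> fin_cases j <;> simp_all)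
  exact ⟨p, hp, h 3, h 2, h 1, h 0⟩

theorem exists_perm_five {a b c d e : ℕ} (hab : a ≠ b) (hac : a ≠ c) (had : a ≠ d) (hae : a ≠ e)
    (hbc : b ≠ c) (hbd : b ≠ d) (hbe : b ≠ e) (hcd : c ≠ d) (hce : c ≠ e) (hde : d ≠ e) :
    ∃ p ∈ permutations 0, p.2 4 = a ∧ p.2 3 = b ∧ p.2 2 = c ∧ p.2 1 = d ∧ p.2 0 = e := by
  obtain ⟨p, hp, h⟩ := exists_permutation ![e, d, c, b, a] (by
    intro i j h
    fin_cases i <;> fin_cases j <;> simp_all)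
  exact ⟨p, hp, h 4, h 3, h 2, h 1, h 0⟩

theorem exists_perm_six {a b c d e f : ℕ} (hab : a ≠ b) (hac : a ≠ c) (had : a ≠ d) (hae : a ≠ e)
    (haf : a ≠ f) (hbc : b ≠ c) (hbd : b ≠ d) (hbe : b ≠ e) (hbf : b ≠ f) (hcd : c ≠ d)
    (hce : c ≠ e) (hcf : c ≠ f) (hde : d ≠ e) (hdf : d ≠ f) (hef : e ≠ f) :
    ∃ p ∈ permutations 0, p.2 5 = a ∧ p.2 4 = b ∧ p.2 3 = c ∧ p.2 2 = d ∧ p.2 1 = e ∧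
      p.2 0 = f := by
  obtain ⟨p, hp, h⟩ := exists_permutation ![f, e, d, c, b, a] (by
    intro i j h
    fin_cases i <;> fin_cases j <;> simp_all)
  exact ⟨p, hp, h 5, h 4, h 3, h 2, h 1, h 0⟩

variable {p : Germˣ × Equiv.Perm ℕ} {i j k : ℕ}

theorem conj_toffoli (hp : p ∈ permutations 0) (hij : i ≠ j) (hik : i ≠ k) (hjk : j ≠ k) :
    toffoli (p.2 i) (p.2 j) (p.2 k) = conj p.1 (toffoli i j k) := by
  rw [toffoli, toffoli, conj_place T (injective_three hij hik hjk) hp]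
  congr 1; funext x; fin_cases x <;> rfl

theorem conj_cnot (hp : p ∈ permutations 0) (hij : i ≠ j) :
    cnot (p.2 i) (p.2 j) = conj p.1 (cnot i j) := by
  rw [cnot, cnot, conj_place C (injective_two hij) hp]
  congr 1; funext x; fin_cases x <;> rfl

theorem conj_exch (hp : p ∈ permutations 0) (hij : i ≠ j) :
    exch (p.2 i) (p.2 j) = conj p.1 (exch i j) := by
  rw [exch, exch, conj_place S (injective_two hij) hp]
  congr 1; funext x; fin_cases x <;> rfl

theorem conj_wire (e : Circuit.Mor 1 1) (hp : p ∈ permutations 0) (i : ℕ) :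
    wire e (p.2 i) = conj p.1 (wire e i) := by
  rw [wire, wire, conj_place e (injective_one i) hp]
  congr 1; funext x; fin_cases x; rfl

theorem shift_toffoli (hij : i ≠ j) (hik : i ≠ k) (hjk : j ≠ k) :
    shift (toffoli i j k) = toffoli (i + 1) (j + 1) (k + 1) := by
  rw [toffoli, shift_place T (injective_three hij hik hjk), toffoli]
  congr 1; funext x; fin_cases x <;> rfl

theorem shift_cnot (hij : i ≠ j) : shift (cnot i j) = cnot (i + 1) (j + 1) := by
  rw [cnot, shift_place C (injective_two hij), cnot]
  congr 1; funext x; fin_cases x <;> rfl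

theorem shift_wire (e : Circuit.Mor 1 1) (i : ℕ) : shift (wire e i) = wire e (i + 1) := by
  rw [wire, shift_place e (injective_one i), wire]
  congr 1; funext x; fin_cases x; rfl

theorem toffoli_base : toffoli 2 1 0 = stab rfl T := by
  rw [← place_id, toffoli]; congr 1; funext x; fin_cases x <;> rfl

theorem cnot_base : cnot 1 0 = stab rfl C := by
  rw [← place_id, cnot]; congr 1; funext x; fin_cases x <;> rfl

theorem exch_base : exch 1 0 = stab rfl S := by
  rw [← place_id, exch]; congr 1; funext x; fin_cases x <;> rfl

theorem wire_base (e : Circuit.Mor 1 1) : wire e 0 = stab rfl e := by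
  rw [← place_id, wire]; congr 1; funext x; fin_cases x; rfl

theorem wire_eq (e : Circuit.Mor 1 1) (k : ℕ) : wire e k = shift^[k] (stab rfl e) := by
  induction k with
  | zero => exact wire_base e
  | succ k ih => rw [← shift_wire, ih, Function.iterate_succ_apply']

theorem wire_mul (e e' : Circuit.Mor 1 1) (k : ℕ) : wire e k * wire e' k = wire (e ∘> e') k := by
  rw [wire_eq, wire_eq, wire_eq, ← shift_iterate_mul, stab_mul]

theorem wire_one (k : ℕ) : wire (one 1) k = 1 := by
  rw [wire_eq, stab_one, shift_iterate_one]

theorem adjacent_conj (n : ℕ) (x : Germ) :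
    adjacent n * x * adjacent n = conj (generator n).1 x := rfl

/-! ### Elements which do not touch a wire -/

/-- The germs which do not touch wire `c`. -/
def free (c : ℕ) : Submonoid Germ where
  carrier := {x | ∀ p ∈ permutations 0, p.2 0 = c → ∃ y, x = conj p.1 (shift y)}
  one_mem' p _ _ := ⟨1, by rw [map_one, map_one]⟩
  mul_mem' hx hy p hp h := by
    obtain ⟨x, rfl⟩ := hx p hp h
    obtain ⟨y, rfl⟩ := hy p hp h
    exact ⟨x * y, by rw [map_mul, map_mul]⟩

/-- After undoing a permutation which moves `0` to `c`, the gate sits on positive wires, so it is a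
shift of the gate on their predecessors. -/
theorem place_mem_free {n c : ℕ} (f : Circuit.Mor n n) {ι : Fin n → ℕ}
    (hι : Function.Injective ι) (hc : ∀ i, ι i ≠ c) : place f ι ∈ free c := by
  intro p hp h
  have hne : ∀ i, p.2⁻¹ (ι i) ≠ 0 := fun i e => hc i (by
    rw [← h, ← e]; exact (p.2.apply_symm_apply _).symm)
  have hinj : Function.Injective fun i => p.2⁻¹ (ι i) - 1 := fun i j hij => by
    have hi := hne i
    have hj := hne j
    exact hι (p.2⁻¹.injective (show p.2⁻¹ (ι i) = p.2⁻¹ (ι j) by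
      simp only at hij; omega))
  refine ⟨place f fun i => p.2⁻¹ (ι i) - 1, ?_⟩
  rw [shift_place f hinj, conj_place f (fun i j hij => hinj (by simpa using hij)) hp]
  congr 1
  funext i
  rw [Nat.sub_add_cancel (Nat.pos_of_ne_zero (hne i))]
  exact (p.2.apply_symm_apply _).symm

theorem free_comm_wire {x : Germ} {c : ℕ} (hx : x ∈ free c) (e : Circuit.Mor 1 1) :
    Commute x (wire e c) := by
  obtain ⟨p, hp, rfl⟩ := exists_perm_one c
  obtain ⟨y, rfl⟩ := hx p hp rfl
  rw [conj_wire e hp, wire_base]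
  exact (((stab_comm_shift e y).symm).map (conj p.1))

theorem conj_injective (p : Germˣ) : Function.Injective (conj p) := fun x y h => by
  have := congrArg (conj p⁻¹) h
  rwa [← conj_mul, ← conj_mul, inv_mul_cancel, conj_one, conj_one] at this

theorem free_cancel {x y : Germ} {c : ℕ} (hx : x ∈ free c) (hy : y ∈ free c)
    (h : wire (B ∘> K) c * x = wire (B ∘> K) c * y) : x = y := by
  obtain ⟨p, hp, rfl⟩ := exists_perm_one c
  obtain ⟨x, rfl⟩ := hx p hp rfl
  obtain ⟨y, rfl⟩ := hy p hp rfl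
  rw [conj_wire _ hp, ← map_mul, ← map_mul, wire_base] at h
  rw [cancel_shift (conj_injective p.1 h)]

/-! ### The identities on consecutive wires -/

theorem stab_C_one_two : @stab 4 4 rfl (C ⊗> one 2) = cnot 3 2 :=
  (stab_tensor_ones C 2).trans (by
    rw [← cnot_base]; change shift (shift _) = _
    rw [shift_cnot (by decide), shift_cnot (by decide)])

theorem stab_one_T : @stab 4 4 rfl (one 1 ⊗> T) = toffoli 2 1 0 :=
  (stab_one_tensor rfl 1 T).trans toffoli_base.symm

theorem stab_T_one : @stab 4 4 rfl (T ⊗> one 1) = toffoli 3 2 1 :=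
  (stab_tensor_ones T 1).trans (by
    rw [← toffoli_base]; change shift _ = _
    rw [shift_toffoli (by decide) (by decide) (by decide)])

theorem stab_one_two_C : @stab 4 4 rfl (one 2 ⊗> C) = cnot 1 0 :=
  (stab_one_tensor rfl 2 C).trans cnot_base.symm

theorem stab_S_one_two : @stab 4 4 rfl (S ⊗> one 2) = adjacent 2 := stab_tensor_ones S 2

theorem stab_S_one : @stab 3 3 rfl (S ⊗> one 1) = adjacent 1 := stab_tensor_ones S 1

theorem stab_one_S : @stab 3 3 rfl (one 1 ⊗> S) = adjacent 0 := stab_one_tensor rfl 1 S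

theorem stab_one_two_S : @stab 4 4 rfl (one 2 ⊗> S) = adjacent 0 := stab_one_tensor rfl 2 S

theorem stab_tof134 : stab rfl (mk Circuit.tof134) = toffoli 3 1 0 := by
  have h : mk Circuit.tof134 = (S ⊗> one 2) ∘> (one 1 ⊗> T) ∘> (S ⊗> one 2) := rfl
  rw [h, stab_mul, stab_mul, stab_S_one_two, stab_one_T, ← mul_assoc, adjacent_conj,
    ← conj_toffoli (generator_mem (by decide)) (by decide) (by decide) (by decide)]
  rfl

theorem stab_tof124 : stab rfl (mk Circuit.tof124) = toffoli 3 2 0 := by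
  have h : mk Circuit.tof124 = (one 2 ⊗> S) ∘> (T ⊗> one 1) ∘> (one 2 ⊗> S) := rfl
  rw [h, stab_mul, stab_mul, stab_one_two_S, stab_T_one, ← mul_assoc, adjacent_conj,
    ← conj_toffoli (generator_mem (by decide)) (by decide) (by decide) (by decide)]
  rfl

theorem stab_F : stab rfl F = toffoli 0 1 2 := by
  have h : F = ((S ⊗> one 1) ∘> (one 1 ⊗> S) ∘> (S ⊗> one 1)) ∘> T ∘>
    ((S ⊗> one 1) ∘> (one 1 ⊗> S) ∘> (S ⊗> one 1)) := rfl
  rw [h]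
  simp only [stab_mul]
  rw [stab_S_one, stab_one_S, ← toffoli_base]
  have e : adjacent 1 * (adjacent 0 * adjacent 1) * (toffoli 2 1 0 *
      (adjacent 1 * (adjacent 0 * adjacent 1))) =
      adjacent 1 * (adjacent 0 * (adjacent 1 * toffoli 2 1 0 * adjacent 1) * adjacent 0) *
        adjacent 1 := by simp only [mul_assoc]
  rw [e, adjacent_conj, adjacent_conj, adjacent_conj,
    ← conj_toffoli (generator_mem (by decide)) (by decide) (by decide) (by decide),
    ← conj_toffoli (generator_mem (by decide)) (by decide) (by decide) (by decide),
    ← conj_toffoli (generator_mem (by decide)) (by decide) (by decide) (by decide)]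
  rfl

theorem stab_F_one : @stab 4 4 rfl (F ⊗> one 1) = toffoli 1 2 3 :=
  (stab_tensor_ones F 1).trans (by
    rw [stab_F]; change shift _ = _
    rw [shift_toffoli (by decide) (by decide) (by decide)])

theorem stab_F_one_two : @stab 5 5 rfl (F ⊗> one 2) = toffoli 2 3 4 :=
  (stab_tensor_ones F 2).trans (by
    rw [stab_F]; change shift (shift _) = _
    rw [shift_toffoli (by decide) (by decide) (by decide),
      shift_toffoli (by decide) (by decide) (by decide)])

theorem stab_T_one_two : @stab 5 5 rfl (T ⊗> one 2) = toffoli 4 3 2 :=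
  (stab_tensor_ones T 2).trans (by
    rw [← toffoli_base]; change shift (shift _) = _
    rw [shift_toffoli (by decide) (by decide) (by decide),
      shift_toffoli (by decide) (by decide) (by decide)])

theorem stab_one_two_T : @stab 5 5 rfl (one 2 ⊗> T) = toffoli 2 1 0 :=
  (stab_one_tensor rfl 2 T).trans toffoli_base.symm

theorem stab_one_two_F : @stab 5 5 rfl (one 2 ⊗> F) = toffoli 0 1 2 :=
  (stab_one_tensor rfl 2 F).trans stab_F

theorem toffoli_symm_base : toffoli 2 1 0 = toffoli 1 2 0 := by
  have h := congrArg (stab rfl) T_swap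
  rw [stab_mul, stab_mul, stab_S_one, ← toffoli_base, ← mul_assoc, adjacent_conj,
    ← conj_toffoli (generator_mem (by decide)) (by decide) (by decide) (by decide)] at h
  exact h

theorem comm_disjoint_base : Commute (toffoli 5 4 3) (toffoli 2 1 0) := by
  have e : toffoli 5 4 3 = shift^[3] (toffoli 2 1 0) := by
    change _ = shift (shift (shift _))
    rw [shift_toffoli (by decide) (by decide) (by decide),
      shift_toffoli (by decide) (by decide) (by decide),
      shift_toffoli (by decide) (by decide) (by decide)]
  rw [e]
  conv => arg 2; rw [toffoli_base]
  exact (stab_comm_shift T _).symm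

theorem comm_target_base : Commute (toffoli 4 3 2) (toffoli 0 1 2) := by
  have h : (T ⊗> one 2) ∘> (one 2 ⊗> F) = (one 2 ⊗> F) ∘> (T ⊗> one 2) := identity .tof3
  have h := congrArg (@stab 5 5 rfl) h
  rwa [stab_mul, stab_mul, stab_T_one_two, stab_one_two_F] at h

theorem comm_control_base : Commute (toffoli 2 3 4) (toffoli 2 1 0) := by
  have h : (F ⊗> one 2) ∘> (one 2 ⊗> T) = (one 2 ⊗> T) ∘> (F ⊗> one 2) := identity .tof4
  have h := congrArg (@stab 5 5 rfl) h
  rwa [stab_mul, stab_mul, stab_F_one_two, stab_one_two_T] at h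

theorem comm_controls_base : Commute (toffoli 1 2 3) (toffoli 2 1 0) := by
  have h : (F ⊗> one 1) ∘> (one 1 ⊗> T) = (one 1 ⊗> T) ∘> (F ⊗> one 1) := identity .tof5
  have h := congrArg (@stab 4 4 rfl) h
  rwa [stab_mul, stab_mul, stab_F_one, stab_one_T] at h

theorem comm_target_control_base : Commute (toffoli 3 1 0) (toffoli 2 1 0) := by
  have h : mk Circuit.tof134 ∘> (one 1 ⊗> T) = (one 1 ⊗> T) ∘> mk Circuit.tof134 :=
    identity .tof6
  have h := congrArg (@stab 4 4 rfl) h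
  rwa [stab_mul, stab_mul, stab_tof134, stab_one_T] at h

theorem cnot_toffoli_cnot_base :
    cnot 3 2 * toffoli 2 1 0 * cnot 3 2 = toffoli 3 1 0 * toffoli 2 1 0 := by
  have h : (C ⊗> one 2) ∘> (one 1 ⊗> T) ∘> (C ⊗> one 2) =
    mk Circuit.tof134 ∘> (one 1 ⊗> T) := identity .tof12
  have h := congrArg (@stab 4 4 rfl) h
  rwa [stab_mul, stab_mul, stab_mul, stab_tof134, stab_one_T, stab_C_one_two, ← mul_assoc] at h

theorem toffoli_toffoli_toffoli_base :
    toffoli 3 2 1 * toffoli 2 1 0 * toffoli 3 2 1 = toffoli 3 2 0 * toffoli 2 1 0 := by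
  have h : (T ⊗> one 1) ∘> (one 1 ⊗> T) ∘> (T ⊗> one 1) =
    mk Circuit.tof124 ∘> (one 1 ⊗> T) := identity .tof13
  have h := congrArg (@stab 4 4 rfl) h
  rwa [stab_mul, stab_mul, stab_mul, stab_tof124, stab_one_T, stab_T_one, ← mul_assoc] at h

theorem toffoli_cnot_toffoli_base :
    toffoli 3 2 1 * cnot 1 0 * toffoli 3 2 1 = toffoli 3 2 0 * cnot 1 0 := by
  have h : (T ⊗> one 1) ∘> (one 2 ⊗> C) ∘> (T ⊗> one 1) =
    mk Circuit.tof124 ∘> (one 2 ⊗> C) := identity .tof14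
  have h := congrArg (@stab 4 4 rfl) h
  rwa [stab_mul, stab_mul, stab_mul, stab_tof124, stab_one_two_C, stab_T_one, ← mul_assoc] at h

theorem cnotFlip_base : stab rfl (mk Circuit.cnotFlip) = cnot 0 1 := by
  have h : mk Circuit.cnotFlip = S ∘> C ∘> S := rfl
  have e : stab rfl S = adjacent 0 := rfl
  rw [h, stab_mul, stab_mul, ← cnot_base, e, ← mul_assoc, adjacent_conj,
    ← conj_cnot (generator_mem (by decide)) (by decide)]
  rfl

theorem exch_eq_base : exch 1 0 = cnot 1 0 * cnot 0 1 * cnot 1 0 := by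
  have h : C ∘> mk Circuit.cnotFlip ∘> C = S := identity .tof15
  rw [exch_base, ← h, stab_mul, stab_mul, cnotFlip_base, cnot_base, mul_assoc]

end Germ


/-! ### Identities involving states and effects, as identities between endomorphisms -/

namespace Circuit.Mor

theorem T_B' : T ∘> (B' ⊗> one 2) = B' ⊗> one 2 := identity .tof2'

theorem BK_T : ((B ∘> K) ⊗> one 2) ∘> T = (B ∘> K) ⊗> C := by
  have e : (B ∘> K) ⊗> one 2 = (B ⊗> one 2) ∘> (K ⊗> one 2) := by rw [tensor_comp, one_comp]
  have h : (B ⊗> one 2) ∘> (K ⊗> C) = (B ∘> K) ⊗> C := by rw [tensor_comp, one_comp]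
  rw [e, assoc, K_T, h]

theorem T_BK : T ∘> ((B ∘> K) ⊗> one 2) = (B ∘> K) ⊗> C := by
  have e : (B ∘> K) ⊗> one 2 = (B ⊗> one 2) ∘> (K ⊗> one 2) := by rw [tensor_comp, one_comp]
  have h : (B ⊗> C) ∘> (K ⊗> one 2) = (B ∘> K) ⊗> C := by rw [tensor_comp, comp_one]
  rw [e, ← assoc, T_B, h]

theorem BK_C : ((B ∘> K) ⊗> one 1) ∘> C = (B ∘> K) ⊗> N := by
  have e : (B ∘> K) ⊗> one 1 = (B ⊗> one 1) ∘> (K ⊗> one 1) := by rw [tensor_comp, one_comp]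
  have h : (B ⊗> one 1) ∘> (K ⊗> N) = (B ∘> K) ⊗> N := by rw [tensor_comp, one_comp]
  rw [e, assoc, K_C, h]

theorem BK'_T : ((B' ∘> K') ⊗> one 2) ∘> T = (B' ∘> K') ⊗> one 2 := by
  have e : (B' ∘> K') ⊗> one 2 = (B' ⊗> one 2) ∘> (K' ⊗> one 2) := by rw [tensor_comp, one_comp]
  rw [e, assoc, K'_T]

theorem T_BK' : T ∘> ((B' ∘> K') ⊗> one 2) = (B' ∘> K') ⊗> one 2 := by
  have e : (B' ∘> K') ⊗> one 2 = (B' ⊗> one 2) ∘> (K' ⊗> one 2) := by rw [tensor_comp, one_comp]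
  rw [e, ← assoc, T_B']

/-- Copying is cocommutative. -/
theorem copy_swap : ((one 1 ⊗> K') ∘> C) ∘> S = (one 1 ⊗> K') ∘> C := by
  have h : C ∘> (S ∘> C ∘> S) ∘> C = S := identity .tof15
  have h1 : C ∘> S = (S ∘> C ∘> S) ∘> C := by
    conv_lhs => rw [← h]
    rw [← assoc, C_C, one_comp]
  have h2 : (one 1 ⊗> K') ∘> (S ∘> C ∘> S) = one 1 ⊗> K' := by
    rw [← assoc, state_S', ← assoc, K'_C, state_S]
  rw [assoc, h1, ← assoc, h2]

/-- Copy the wire and require the copy to be `1`. As copying is cocommutative, the requirement may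
be imposed on the original instead, where `C_B` evaluates it. -/
theorem probe_eq : probe K B' = B ∘> K := by
  have h : (one 1 ⊗> K') ∘> (B ⊗> N) = B ∘> K := by
    rw [tensor_comp, one_comp, K'_N]
    have h1 := slide B K
    have h2 := slide' B K
    rw [tensor_unit, unit01] at h1
    exact h1.symm
  rw [← probe_flip, probe, ← assoc, ← copy_swap, assoc, S_effect', assoc, C_B, h]

/-- By `tof7` the Toffoli gate with prepared and measured target is a product of two `cnot` gates of
the same kind, and `probe_eq` identifies each with a projection. -/
theorem both_controls : (one 2 ⊗> K) ∘> T ∘> (one 2 ⊗> B') = (B ∘> K) ⊗> (B ∘> K) := by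
  have h : ((one 2 ⊗> K) ∘> mk cnot13 ∘> (one 2 ⊗> B')) ∘>
      ((one 2 ⊗> K) ∘> (one 1 ⊗> C) ∘> (one 2 ⊗> B')) =
      (one 2 ⊗> K) ∘> T ∘> (one 2 ⊗> B') := identity .tof7
  rw [← h, probe1, probe2, probe_eq]
  exact slide _ _

theorem R_effect (b : Mor 1 0) :
    R ∘> (one 1 ⊗> (b ⊗> one 1)) = (one 1 ⊗> (b ⊗> one 1)) ∘> S := by
  have h : (one 1 ⊗> S) ∘> (b ⊗> one 2) = b ⊗> S := slide' b S
  rw [R_def, assoc, assoc, S1_effect', h, ← effect22, ← assoc, S1_effect]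

theorem state_R (k : Mor 0 1) :
    (one 1 ⊗> (k ⊗> one 1)) ∘> R = S ∘> (one 1 ⊗> (k ⊗> one 1)) := by
  have h : (k ⊗> one 2) ∘> (one 1 ⊗> S) = k ⊗> S := slide k S
  have h' := state22 k S
  rw [R_def, ← assoc, state_S1', ← assoc, h, ← h', assoc, state_S1]

theorem middle_effect (b : Mor 1 0) :
    (one 2 ⊗> b) ⊗> one 2 = (one 1 ⊗> (one 1 ⊗> (b ⊗> one 1))) ⊗> one 1 := by
  have h1 : one 2 ⊗> b = one 1 ⊗> (one 1 ⊗> b) := by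
    rw [← one_tensor 1 1]; exact tensor_assoc (one 1) (one 1) b
  have h2 : (one 1 ⊗> (one 1 ⊗> b)) ⊗> one 2 = ((one 1 ⊗> (one 1 ⊗> b)) ⊗> one 1) ⊗> one 1 :=
    tensor_one_succ _ 1
  have h3 : (one 1 ⊗> (one 1 ⊗> b)) ⊗> one 1 = one 1 ⊗> ((one 1 ⊗> b) ⊗> one 1) :=
    tensor_one_assoc _ _
  have h4 : (one 1 ⊗> b) ⊗> one 1 = one 1 ⊗> (b ⊗> one 1) := tensor_one_assoc _ _
  rw [h4] at h3
  rw [h1]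
  exact h2.trans (congrArg (fun x : Mor 4 3 => x ⊗> one 1) h3)

theorem middle_state (k : Mor 0 1) :
    (one 2 ⊗> k) ⊗> one 2 = (one 1 ⊗> (one 1 ⊗> (k ⊗> one 1))) ⊗> one 1 := by
  have h1 : one 2 ⊗> k = one 1 ⊗> (one 1 ⊗> k) := by
    rw [← one_tensor 1 1]; exact tensor_assoc (one 1) (one 1) k
  have h2 : (one 1 ⊗> (one 1 ⊗> k)) ⊗> one 2 = ((one 1 ⊗> (one 1 ⊗> k)) ⊗> one 1) ⊗> one 1 :=
    tensor_one_succ _ 1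
  have h3 : (one 1 ⊗> (one 1 ⊗> k)) ⊗> one 1 = one 1 ⊗> ((one 1 ⊗> k) ⊗> one 1) :=
    tensor_one_assoc _ _
  have h4 : (one 1 ⊗> k) ⊗> one 1 = one 1 ⊗> (k ⊗> one 1) := tensor_one_assoc _ _
  rw [h4] at h3
  rw [h1]
  exact h2.trans (congrArg (fun x : Mor 3 4 => x ⊗> one 1) h3)

abbrev BB : Mor 5 4 := (one 2 ⊗> B') ⊗> one 2
abbrev KK : Mor 4 5 := (one 2 ⊗> K') ⊗> one 2
abbrev RR : Mor 5 5 := (one 1 ⊗> R) ⊗> one 1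
abbrev SS : Mor 4 4 := (one 1 ⊗> S) ⊗> one 1

theorem BB_SS : BB ∘> SS = RR ∘> BB := by
  have h : (one 1 ⊗> (one 1 ⊗> (B' ⊗> one 1))) ∘> (one 1 ⊗> S) =
      (one 1 ⊗> R) ∘> (one 1 ⊗> (one 1 ⊗> (B' ⊗> one 1))) := by
    have h1 := tensor_comp (one 1) (one 1) (one 1 ⊗> (B' ⊗> one 1)) S
    have h2 := tensor_comp (one 1) (one 1) R (one 1 ⊗> (B' ⊗> one 1))
    rw [R_effect] at h2
    exact h1.trans h2.symm
  have e := middle_effect B'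
  have h1 := tensor_comp (one 1 ⊗> (one 1 ⊗> (B' ⊗> one 1))) (one 1 ⊗> S) (one 1) (one 1)
  have h2 := tensor_comp (one 1 ⊗> R) (one 1 ⊗> (one 1 ⊗> (B' ⊗> one 1))) (one 1) (one 1)
  rw [← h] at h2
  unfold BB SS RR
  rw [e]
  exact h1.trans h2.symm

theorem SS_KK : SS ∘> KK = KK ∘> RR := by
  have h : (one 1 ⊗> (one 1 ⊗> (K' ⊗> one 1))) ∘> (one 1 ⊗> R) =
      (one 1 ⊗> S) ∘> (one 1 ⊗> (one 1 ⊗> (K' ⊗> one 1))) := by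
    have h1 := tensor_comp (one 1) (one 1) (one 1 ⊗> (K' ⊗> one 1)) R
    have h2 := tensor_comp (one 1) (one 1) S (one 1 ⊗> (K' ⊗> one 1))
    rw [state_R] at h1
    exact h1.trans h2.symm
  have e := middle_state K'
  have h1 := tensor_comp (one 1 ⊗> (one 1 ⊗> (K' ⊗> one 1))) (one 1 ⊗> R) (one 1) (one 1)
  have h2 := tensor_comp (one 1 ⊗> S) (one 1 ⊗> (one 1 ⊗> (K' ⊗> one 1))) (one 1) (one 1)
  rw [← h] at h2
  unfold KK SS RR
  rw [e]
  exact h2.trans h1.symm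

theorem BB_KK : BB ∘> KK = (one 2 ⊗> (B' ∘> K')) ⊗> one 2 := by
  have h1 := tensor_comp (one 2 ⊗> B') (one 2 ⊗> K') (one 2) (one 2)
  have h2 := tensor_comp (one 2) (one 2) B' K'
  rw [one_comp] at h1 h2
  rw [h2] at h1
  exact h1

/-- `tof17` is surrounded by `BB` and `KK`, so that the hidden zero ancilla becomes a visible wire
projected to `0`. The exchange `SS` of the two neighbours of the ancilla becomes the reversal `RR`
of three wires. -/
theorem triple_identity : (BB ∘> KK) ∘> (T ⊗> one 2) ∘> (one 2 ⊗> T) ∘> (T ⊗> one 2) ∘> (BB ∘> KK) =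
    RR ∘> (BB ∘> KK) ∘> (T ⊗> one 2) ∘> (one 2 ⊗> T) ∘> (T ⊗> one 2) ∘> (BB ∘> KK) ∘> RR := by
  have h : KK ∘> (T ⊗> one 2) ∘> (one 2 ⊗> T) ∘> (T ⊗> one 2) ∘> BB =
      SS ∘> (KK ∘> (T ⊗> one 2) ∘> (one 2 ⊗> T) ∘> (T ⊗> one 2) ∘> BB) ∘> SS := identity .tof17
  have h := congrArg (fun x => BB ∘> x ∘> KK) h
  beta_reduce at h
  simp only [assoc] at h ⊢
  rw [h, ← assoc BB SS, BB_SS, SS_KK]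
  simp only [assoc]

end Circuit.Mor

namespace Germ

open Circuit.Mor

theorem stab_three_top (e : Circuit.Mor 1 1) : @stab 3 3 rfl (e ⊗> one 2) = wire e 2 :=
  (stab_tensor_ones e 2).trans (wire_eq e 2).symm

theorem stab_two_top (e : Circuit.Mor 1 1) : @stab 2 2 rfl (e ⊗> one 1) = wire e 1 :=
  (stab_tensor_ones e 1).trans (wire_eq e 1).symm

theorem stab_two_bottom (e : Circuit.Mor 1 1) : @stab 2 2 rfl (one 1 ⊗> e) = wire e 0 :=
  (stab_one_tensor rfl 1 e).trans (wire_eq e 0).symm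

theorem stab_three_bottom (e : Circuit.Mor 1 1) : @stab 3 3 rfl (one 2 ⊗> e) = wire e 0 :=
  (stab_one_tensor rfl 2 e).trans (wire_eq e 0).symm

theorem wire_toffoli_base : wire (B ∘> K) 2 * toffoli 2 1 0 = wire (B ∘> K) 2 * cnot 1 0 := by
  have e : @stab 3 3 rfl (one 1 ⊗> C) = cnot 1 0 := (stab_one_tensor rfl 1 C).trans cnot_base.symm
  have h : ((B ∘> K) ⊗> one 2) ∘> T = ((B ∘> K) ⊗> one 2) ∘> (one 1 ⊗> C) :=
    BK_T.trans (slide (B ∘> K) C).symm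
  have h := congrArg (@stab 3 3 rfl) h
  rwa [stab_mul, stab_mul, stab_three_top, e, ← toffoli_base] at h

theorem toffoli_wire_base : toffoli 2 1 0 * wire (B ∘> K) 2 = wire (B ∘> K) 2 * cnot 1 0 := by
  have e : @stab 3 3 rfl (one 1 ⊗> C) = cnot 1 0 := (stab_one_tensor rfl 1 C).trans cnot_base.symm
  have h : T ∘> ((B ∘> K) ⊗> one 2) = ((B ∘> K) ⊗> one 2) ∘> (one 1 ⊗> C) :=
    T_BK.trans (slide (B ∘> K) C).symm
  have h := congrArg (@stab 3 3 rfl) h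
  rwa [stab_mul, stab_mul, stab_three_top, e, ← toffoli_base] at h

theorem wire_cnot_base : wire (B ∘> K) 1 * cnot 1 0 = wire (B ∘> K) 1 * wire N 0 := by
  have h : ((B ∘> K) ⊗> one 1) ∘> C = ((B ∘> K) ⊗> one 1) ∘> (one 1 ⊗> N) :=
    BK_C.trans (slide (B ∘> K) N).symm
  have h := congrArg (@stab 2 2 rfl) h
  rwa [stab_mul, stab_mul, stab_two_top, stab_two_bottom, ← cnot_base] at h

theorem zero_toffoli_base : wire (B' ∘> K') 2 * toffoli 2 1 0 = wire (B' ∘> K') 2 := by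
  have h := congrArg (@stab 3 3 rfl) BK'_T
  rwa [stab_mul, stab_three_top, ← toffoli_base] at h

theorem toffoli_zero_base : toffoli 2 1 0 * wire (B' ∘> K') 2 = wire (B' ∘> K') 2 := by
  have h := congrArg (@stab 3 3 rfl) T_BK'
  rwa [stab_mul, stab_three_top, ← toffoli_base] at h

theorem both_base : wire (B' ∘> K) 0 * toffoli 2 1 0 * wire (B' ∘> K') 0 =
    wire (B ∘> K) 2 * wire (B ∘> K) 1 * wire (B' ∘> K') 0 := by
  have e1 (b : Circuit.Mor 1 0) (k : Circuit.Mor 0 1) :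
      one 2 ⊗> (b ∘> k) = (one 2 ⊗> b) ∘> (one 2 ⊗> k) := by rw [tensor_comp, one_comp]
  have h : (one 2 ⊗> (B' ∘> K)) ∘> T ∘> (one 2 ⊗> (B' ∘> K')) =
      (one 2 ⊗> B') ∘> ((B ∘> K) ⊗> (B ∘> K)) ∘> (one 2 ⊗> K') := by
    rw [e1, e1, ← both_controls]
    simp only [assoc]
  have h1 : (one 2 ⊗> B') ∘> ((B ∘> K) ⊗> (B ∘> K)) ∘> (one 2 ⊗> K') =
      ((B ∘> K) ⊗> (B ∘> K)) ⊗> (B' ∘> K') := by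
    have h2 := slide ((B ∘> K) ⊗> (B ∘> K)) K'
    have h3 := tensor_comp (one 2) ((B ∘> K) ⊗> (B ∘> K)) B' K'
    rw [tensor_unit] at h2
    rw [h2]
    refine h3.trans ?_
    rw [show one 2 ∘> ((B ∘> K) ⊗> (B ∘> K)) = (B ∘> K) ⊗> (B ∘> K) from one_comp _]
  have h2 : ((B ∘> K) ⊗> (B ∘> K)) ⊗> (B' ∘> K') =
      (((B ∘> K) ⊗> (B ∘> K)) ⊗> one 1) ∘> (one 2 ⊗> (B' ∘> K')) := (slide _ _).symm
  have h3 : @stab 2 2 rfl ((B ∘> K) ⊗> (B ∘> K)) = wire (B ∘> K) 1 * wire (B ∘> K) 0 := by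
    rw [← slide]
    refine (stab_mul (n := 2) _ _).trans ?_
    rw [stab_two_top, stab_two_bottom]
  have h4 : @stab 3 3 rfl (((B ∘> K) ⊗> (B ∘> K)) ⊗> one 1) =
      wire (B ∘> K) 2 * wire (B ∘> K) 1 := by
    refine (stab_tensor_one (n := 2) rfl _).trans ?_
    rw [h3, map_mul, shift_wire, shift_wire]
  have h := congrArg (@stab 3 3 rfl) ((h.trans h1).trans h2)
  rwa [stab_mul, stab_mul, stab_mul, stab_three_bottom, stab_three_bottom, h4, ← toffoli_base,
    ← mul_assoc] at h

theorem triple_base : wire (B' ∘> K') 2 * toffoli 4 3 2 * toffoli 2 1 0 * toffoli 4 3 2 *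
      wire (B' ∘> K') 2 =
    wire (B' ∘> K') 2 * toffoli 4 1 2 * toffoli 2 3 0 * toffoli 4 1 2 * wire (B' ∘> K') 2 := by
  have hZ : @stab 5 5 rfl (BB ∘> KK) = wire (B' ∘> K') 2 := by
    rw [BB_KK]
    refine (stab_tensor_ones (n := 3) _ 2).trans ?_
    rw [stab_three_bottom]
    change shift (shift _) = _
    rw [shift_wire, shift_wire]
  have hR : @stab 5 5 rfl RR = adjacent 2 * adjacent 1 * adjacent 2 := by
    refine (stab_tensor_one (n := 4) rfl (one 1 ⊗> R)).trans ?_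
    have h : @stab 4 4 rfl (one 1 ⊗> R) = adjacent 1 * adjacent 0 * adjacent 1 := by
      refine (stab_one_tensor rfl 1 R).trans ?_
      rw [R_def, stab_mul, stab_mul, stab_S_one, stab_one_S, mul_assoc]
    rw [h, map_mul, map_mul]
    rfl
  have h := triple_identity
  generalize BB ∘> KK = Q at h hZ
  have h := congrArg (@stab 5 5 rfl) h
  simp only [stab_mul] at h
  rw [hZ, hR, stab_T_one_two, stab_one_two_T] at h
  have e : adjacent 2 * adjacent 1 * adjacent 2 * (wire (B' ∘> K') 2 * (toffoli 4 3 2 *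
      (toffoli 2 1 0 * (toffoli 4 3 2 * (wire (B' ∘> K') 2 *
        (adjacent 2 * adjacent 1 * adjacent 2)))))) =
      adjacent 2 * (adjacent 1 * (adjacent 2 * (wire (B' ∘> K') 2 * toffoli 4 3 2 *
        toffoli 2 1 0 * toffoli 4 3 2 * wire (B' ∘> K') 2) * adjacent 2) * adjacent 1) *
          adjacent 2 := by simp only [mul_assoc]
  rw [e, adjacent_conj, adjacent_conj, adjacent_conj] at h
  have m (i : ℕ) : generator i ∈ permutations 0 := generator_mem (Nat.zero_le i)
  simp only [map_mul] at h
  rw [← conj_wire _ (m 2), ← conj_wire _ (m 1), ← conj_wire _ (m 2),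
    ← conj_toffoli (m 2) (by decide) (by decide) (by decide),
    ← conj_toffoli (m 2) (by decide) (by decide) (by decide),
    ← conj_toffoli (m 1) (by decide) (by decide) (by decide),
    ← conj_toffoli (m 1) (by decide) (by decide) (by decide),
    ← conj_toffoli (m 2) (by decide) (by decide) (by decide),
    ← conj_toffoli (m 2) (by decide) (by decide) (by decide)] at h
  simp only [← mul_assoc] at h
  exact h

end Germ


namespace Germ

open Circuit.Mor

/-! ### The identities on arbitrary wires -/

variable {a b c d e f i j k : ℕ}

theorem toffoli_symm (hij : i ≠ j) (hik : i ≠ k) (hjk : j ≠ k) : toffoli i j k = toffoli j i k := by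
  obtain ⟨p, hp, rfl, rfl, rfl⟩ := exists_perm_three hij hik hjk
  rw [conj_toffoli hp (by decide) (by decide) (by decide), toffoli_symm_base,
    ← conj_toffoli hp (by decide) (by decide) (by decide)]

theorem toffoli_sq (hij : i ≠ j) (hik : i ≠ k) (hjk : j ≠ k) : toffoli i j k * toffoli i j k = 1 := by
  obtain ⟨p, hp, rfl, rfl, rfl⟩ := exists_perm_three hij hik hjk
  rw [conj_toffoli hp (by decide) (by decide) (by decide), toffoli_base, ← map_mul, ← stab_mul, T_T,
    stab_one, map_one]

theorem comm_disjoint (hab : a ≠ b) (hac : a ≠ c) (had : a ≠ d) (hae : a ≠ e)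
    (haf : a ≠ f) (hbc : b ≠ c) (hbd : b ≠ d) (hbe : b ≠ e) (hbf : b ≠ f) (hcd : c ≠ d)
    (hce : c ≠ e) (hcf : c ≠ f) (hde : d ≠ e) (hdf : d ≠ f) (hef : e ≠ f) :
    Commute (toffoli a b c) (toffoli d e f) := by
  obtain ⟨p, hp, rfl, rfl, rfl, rfl, rfl, rfl⟩ :=
    exists_perm_six hab hac had hae haf hbc hbd hbe hbf hcd hce hcf hde hdf hef
  rw [conj_toffoli hp (by decide) (by decide) (by decide),
    conj_toffoli hp (by decide) (by decide) (by decide)]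
  exact comm_disjoint_base.map _

theorem comm_target (hab : a ≠ b) (hac : a ≠ c) (had : a ≠ d) (hae : a ≠ e)
    (hbc : b ≠ c) (hbd : b ≠ d) (hbe : b ≠ e) (hcd : c ≠ d) (hce : c ≠ e) (hde : d ≠ e) :
    Commute (toffoli a b c) (toffoli e d c) := by
  obtain ⟨p, hp, rfl, rfl, rfl, rfl, rfl⟩ :=
    exists_perm_five hab hac had hae hbc hbd hbe hcd hce hde
  rw [conj_toffoli hp (by decide) (by decide) (by decide),
    conj_toffoli hp (by decide) (by decide) (by decide)]
  exact comm_target_base.map _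

theorem comm_control (hab : a ≠ b) (hac : a ≠ c) (had : a ≠ d) (hae : a ≠ e)
    (hbc : b ≠ c) (hbd : b ≠ d) (hbe : b ≠ e) (hcd : c ≠ d) (hce : c ≠ e) (hde : d ≠ e) :
    Commute (toffoli c b a) (toffoli c d e) := by
  obtain ⟨p, hp, rfl, rfl, rfl, rfl, rfl⟩ :=
    exists_perm_five hab hac had hae hbc hbd hbe hcd hce hde
  rw [conj_toffoli hp (by decide) (by decide) (by decide),
    conj_toffoli hp (by decide) (by decide) (by decide)]
  exact comm_control_base.map _

theorem comm_controls (hab : a ≠ b) (hac : a ≠ c) (had : a ≠ d) (hbc : b ≠ c)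
    (hbd : b ≠ d) (hcd : c ≠ d) : Commute (toffoli c b a) (toffoli b c d) := by
  obtain ⟨p, hp, rfl, rfl, rfl, rfl⟩ := exists_perm_four hab hac had hbc hbd hcd
  rw [conj_toffoli hp (by decide) (by decide) (by decide),
    conj_toffoli hp (by decide) (by decide) (by decide)]
  exact comm_controls_base.map _

theorem comm_target_control (hab : a ≠ b) (hac : a ≠ c) (had : a ≠ d) (hbc : b ≠ c)
    (hbd : b ≠ d) (hcd : c ≠ d) : Commute (toffoli a c d) (toffoli b c d) := by
  obtain ⟨p, hp, rfl, rfl, rfl, rfl⟩ := exists_perm_four hab hac had hbc hbd hcd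
  rw [conj_toffoli hp (by decide) (by decide) (by decide),
    conj_toffoli hp (by decide) (by decide) (by decide)]
  exact comm_target_control_base.map _

theorem toffoli_comm_of_eq (hij : i ≠ j) (hik : i ≠ k) (hjk : j ≠ k) (hab : a ≠ b)
    (hac : a ≠ c) (hbc : b ≠ c) (hka : k ≠ a) (hkb : k ≠ b) (hci : c ≠ i) (hcj : c ≠ j)
    (h : j = b) : Commute (toffoli i j k) (toffoli a b c) := by
  subst h
  rcases eq_or_ne i a with rfl | hia
  · rcases eq_or_ne k c with rfl | hkc
    · exact .refl _
    · rw [toffoli_symm hab hac hbc]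
      exact (comm_controls hjk.symm hik.symm hkc hij.symm hbc hac).symm.symm
  · rcases eq_or_ne k c with rfl | hkc
    · exact comm_target_control hia hij hik hab.symm.symm hac hjk
    · rw [toffoli_symm hij hik hjk, toffoli_symm hab hac hbc]
      exact comm_control hik.symm hjk.symm hka hkc hij hia hci.symm hab.symm hbc hac

/-- The identities give commutation for a common target, one common control, two common controls,
and common target and control; disjoint wires are covered by the monoidal structure. Up to
exchanging the controls of a gate, these and the equality of the two gates are all configurations in
which no target is a control. -/
theorem toffoli_comm (hij : i ≠ j) (hik : i ≠ k) (hjk : j ≠ k) (hab : a ≠ b)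
    (hac : a ≠ c) (hbc : b ≠ c) (hka : k ≠ a) (hkb : k ≠ b) (hci : c ≠ i) (hcj : c ≠ j) :
    Commute (toffoli i j k) (toffoli a b c) := by
  rcases eq_or_ne j b with h | hjb
  · exact toffoli_comm_of_eq hij hik hjk hab hac hbc hka hkb hci hcj h
  rcases eq_or_ne j a with h | hja
  · rw [toffoli_symm hab hac hbc]
    exact toffoli_comm_of_eq hij hik hjk hab.symm hbc hac hkb hka hci hcj h
  rcases eq_or_ne i b with h | hib
  · rw [toffoli_symm hij hik hjk]
    exact toffoli_comm_of_eq hij.symm hjk hik hab hac hbc hka hkb hcj hci h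
  rcases eq_or_ne i a with h | hia
  · rw [toffoli_symm hij hik hjk, toffoli_symm hab hac hbc]
    exact toffoli_comm_of_eq hij.symm hjk hik hab.symm hbc hac hkb hka hcj hci h
  rcases eq_or_ne k c with rfl | hkc
  · exact comm_target hij hik hib hia hjk hjb hja hkb hka hab.symm
  · exact comm_disjoint hij hik hia hib hci.symm hjk hja hjb hcj.symm hka hkb hkc hab hac hbc

theorem zero_eq (i : ℕ) :
    wire N i * wire (B ∘> K) i * wire N i = wire (B' ∘> K') i := by
  rw [wire_mul, wire_mul, B'_def, K'_def]
  simp only [assoc]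

theorem zero_neg (i : ℕ) : wire (B' ∘> K') i * wire N i = wire (B' ∘> K) i := by
  rw [wire_mul, assoc, K'_N]

/-- The gates of `TOF` on infinitely many wires. -/
noncomputable def gates : GateSystem Germ where
  T := toffoli
  C := cnot
  N := wire N
  E := wire (B ∘> K)
  swap := exch
  free := free
  T_symm := toffoli_symm
  T_sq := toffoli_sq
  T_comm := toffoli_comm
  C_T_C h1 h2 h3 h4 h5 h6 := by
    obtain ⟨p, hp, rfl, rfl, rfl, rfl⟩ := exists_perm_four h1 h2 h3 h4 h5 h6
    rw [conj_cnot hp (by decide), conj_toffoli hp (by decide) (by decide) (by decide),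
      conj_toffoli hp (by decide) (by decide) (by decide), ← map_mul, ← map_mul, ← map_mul,
      cnot_toffoli_cnot_base]
  T_T_T h1 h2 h3 h4 h5 h6 := by
    obtain ⟨p, hp, rfl, rfl, rfl, rfl⟩ := exists_perm_four h1 h2 h3 h4 h5 h6
    rw [conj_toffoli hp (by decide) (by decide) (by decide),
      conj_toffoli hp (by decide) (by decide) (by decide),
      conj_toffoli hp (by decide) (by decide) (by decide), ← map_mul, ← map_mul, ← map_mul,
      toffoli_toffoli_toffoli_base]
  T_C_T h1 h2 h3 h4 h5 h6 := by
    obtain ⟨p, hp, rfl, rfl, rfl, rfl⟩ := exists_perm_four h1 h2 h3 h4 h5 h6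
    rw [conj_cnot hp (by decide), conj_toffoli hp (by decide) (by decide) (by decide),
      conj_toffoli hp (by decide) (by decide) (by decide), ← map_mul, ← map_mul, ← map_mul,
      toffoli_cnot_toffoli_base]
  triple_symm h1 h2 h3 h4 h5 h6 h7 h8 h9 h10 := by
    obtain ⟨p, hp, rfl, rfl, rfl, rfl, rfl⟩ := exists_perm_five h1 h2 h3 h4 h5 h6 h7 h8 h9 h10
    rw [zero_eq, conj_wire _ hp, conj_toffoli hp (by decide) (by decide) (by decide),
      conj_toffoli hp (by decide) (by decide) (by decide),
      conj_toffoli hp (by decide) (by decide) (by decide),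
      conj_toffoli hp (by decide) (by decide) (by decide)]
    simp only [← map_mul]
    rw [triple_base]
  E_E i := by rw [wire_mul, assoc, ← assoc K, K_B, one_comp]
  E_T h1 h2 h3 := by
    obtain ⟨p, hp, rfl, rfl, rfl⟩ := exists_perm_three h1 h2 h3
    rw [conj_cnot hp (by decide), conj_wire _ hp,
      conj_toffoli hp (by decide) (by decide) (by decide), ← map_mul, wire_toffoli_base, map_mul]
  T_E h1 h2 h3 := by
    obtain ⟨p, hp, rfl, rfl, rfl⟩ := exists_perm_three h1 h2 h3
    rw [conj_cnot hp (by decide), conj_wire _ hp,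
      conj_toffoli hp (by decide) (by decide) (by decide), ← map_mul, toffoli_wire_base, map_mul]
  E_C h := by
    obtain ⟨p, hp, rfl, rfl⟩ := exists_perm_two h
    rw [conj_cnot hp (by decide), conj_wire _ hp, conj_wire _ hp, ← map_mul, wire_cnot_base, map_mul]
  N_N i := by rw [wire_mul, N_N, wire_one]
  Z_T h1 h2 h3 := by
    obtain ⟨p, hp, rfl, rfl, rfl⟩ := exists_perm_three h1 h2 h3
    rw [zero_eq, conj_wire _ hp, conj_toffoli hp (by decide) (by decide) (by decide), ← map_mul,
      zero_toffoli_base]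
  T_Z h1 h2 h3 := by
    obtain ⟨p, hp, rfl, rfl, rfl⟩ := exists_perm_three h1 h2 h3
    rw [zero_eq, conj_wire _ hp, conj_toffoli hp (by decide) (by decide) (by decide), ← map_mul,
      toffoli_zero_base]
  both h1 h2 h3 := by
    obtain ⟨p, hp, rfl, rfl, rfl⟩ := exists_perm_three h1 h2 h3
    rw [zero_eq, zero_neg, conj_wire _ hp, conj_wire _ hp, conj_wire _ hp, conj_wire _ hp,
      conj_toffoli hp (by decide) (by decide) (by decide)]
    simp only [← map_mul]
    rw [both_base]
  T_mem {i j k c} h1 h2 h3 h4 h5 h6 := place_mem_free T (injective_three h1 h2 h3) fun x => by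
    fin_cases x
    · exact h6.symm
    · exact h5.symm
    · exact h4.symm
  C_mem h1 h2 h3 := place_mem_free C (injective_two h1) fun x => by
    fin_cases x
    · exact h3.symm
    · exact h2.symm
  N_mem h := place_mem_free N (injective_one _) fun x => by fin_cases x; exact h.symm
  E_mem h := place_mem_free (B ∘> K) (injective_one _) fun x => by fin_cases x; exact h.symm
  free_E h := free_comm_wire h _
  free_N h := free_comm_wire h _
  cancel := free_cancel
  swap_eq h := by
    obtain ⟨p, hp, rfl, rfl⟩ := exists_perm_two h
    rw [conj_cnot hp (by decide), conj_cnot hp (by decide), conj_exch hp (by decide), ← map_mul,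
      ← map_mul, exch_eq_base]
  swap_T {i j a b c} h h1 h2 h3 := by
    obtain ⟨p, hp, rfl, rfl⟩ := exists_perm_two h
    -- The exchange is the circuit of a permutation, a conjugate of `generator 0`, so conjugating by
    -- it relabels gates.
    have hq : p * generator 0 * p⁻¹ ∈ permutations 0 :=
      mul_mem (mul_mem hp (generator_mem le_rfl)) (inv_mem hp)
    have e1 : ((p * generator 0 * p⁻¹).1 : Germ) = exch (p.2 1) (p.2 0) := by
      rw [conj_exch hp (by decide), exch_base]
      rfl
    have e2 : (p * generator 0 * p⁻¹).2 = Equiv.swap (p.2 1) (p.2 0) := by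
      rw [Equiv.swap_comm, Equiv.swap_apply_apply]
      rfl
    have := conj_toffoli hq h1 h2 h3
    rw [e2] at this
    rw [this, ← e1]
    exact (Units.inv_mul_cancel_right _ _).symm

end Germ


/-! ### Evaluation of germs -/

namespace Circuit.Mor

/-- Evaluation of a morphism on bit strings. -/
def ev {n m : ℕ} : Mor n m → List Bool → Option (List Bool) :=
  -- Strings of the wrong length are excluded because equivalent circuits are only known to agree on
  -- strings of length `n`.
  Quotient.lift (fun f l => if l.length = n then f.eval l else none) fun f g h => by
    funext l
    split_ifs with e
    · exact eval_equiv h e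
    · rfl

theorem ev_mk {n m : ℕ} (f : Circuit n m) {l : List Bool} (h : l.length = n) :
    ev (mk f) l = f.eval l := if_pos h

theorem ev_of_ne {n m : ℕ} (f : Mor n m) {l : List Bool} (h : l.length ≠ n) : ev f l = none :=
  Quotient.inductionOn f fun _ => if_neg h

theorem ev_one {n : ℕ} {l : List Bool} (h : l.length = n) : ev (one n) l = some l := ev_mk _ h

theorem ev_comp {n m p : ℕ} (f : Mor n m) (g : Mor m p) (l : List Bool) :
    ev (f ∘> g) l = (ev f l).bind (ev g) := by
  by_cases h : l.length = n
  · refine Quotient.inductionOn₂ f g fun f g => ?_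
    change ev (mk (f ⨾ g)) l = (ev (mk f) l).bind (ev (mk g))
    rw [ev_mk _ h, ev_mk _ h, eval]
    refine Option.bind_congr fun k hk => ?_
    exact (ev_mk g (eval_length f h hk)).symm
  · rw [ev_of_ne _ h, ev_of_ne _ h]; rfl

theorem ev_tensor {a b c d : ℕ} (f : Mor a b) (g : Mor c d) (l : List Bool) :
    ev (f ⊗> g) l = if l.length = a + c then
      (ev f (l.take a)).bind fun x => (ev g (l.drop a)).map fun y => x ++ y else none := by
  split_ifs with h
  · refine Quotient.inductionOn₂ f g fun f g => ?_
    change ev (mk (f ⊠ g)) l = (ev (mk f) _).bind fun x => (ev (mk g) _).map _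
    rw [ev_mk _ h, ev_mk _ (by simp [h]), ev_mk _ (by simp [h]), eval]
  · exact ev_of_ne _ h

theorem ev_append {a b c d : ℕ} (f : Mor a b) (g : Mor c d) {l k : List Bool} (hl : l.length = a)
    (hk : k.length = c) :
    ev (f ⊗> g) (l ++ k) = (ev f l).bind fun x => (ev g k).map fun y => x ++ y := by
  rw [ev_tensor, if_pos (by simp [hl, hk]), List.take_left' hl, List.drop_left' hl]

theorem ev_cast {n m n' m' : ℕ} (hn : n = n') (hm : m = m') (f : Mor n m) :
    ev (cast hn hm f) = ev f := by
  subst hn hm; rfl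

end Circuit.Mor

/-- The values of `b` on the wires with numbers below `n`, from top to bottom. -/
def bits : ℕ → (ℕ → Bool) → List Bool
  | 0, _ => []
  | n + 1, b => bits n (fun i => b (i + 1)) ++ [b 0]

theorem bits_length (n : ℕ) (b : ℕ → Bool) : (bits n b).length = n := by
  induction n generalizing b with
  | zero => rfl
  | succ n ih => simp [bits, ih]

theorem bits_add (r n : ℕ) (b : ℕ → Bool) :
    bits (r + n) b = bits r (fun i => b (i + n)) ++ bits n b := by
  induction n generalizing b with
  | zero => simp [bits]
  | succ n ih =>
    change bits (r + n) _ ++ [b 0] = _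
    rw [ih, bits, List.append_assoc]
    rfl

theorem eq_of_bits_eq {n i : ℕ} (hi : i < n) {b b' : ℕ → Bool} (h : bits n b = bits n b') :
    b i = b' i := by
  induction n generalizing i b b' with
  | zero => omega
  | succ n ih =>
    obtain ⟨h1, h2⟩ := List.append_inj h (by simp [bits_length])
    cases i with
    | zero => simpa using h2
    | succ i => exact ih (b := fun i => b (i + 1)) (b' := fun i => b' (i + 1)) (by omega) h1

namespace Germ

open Circuit.Mor

/-- `x` acts on bit assignments as `φ`. -/
def Evaluates (x : Germ) (φ : (ℕ → Bool) → Option (ℕ → Bool)) : Prop :=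
  ∃ y, of y = x ∧ ∃ k, ∀ n ≥ k, ∀ b, ev (y n) (bits n b) = (φ b).map (bits n)

theorem Evaluates.mul {x y : Germ} {φ ψ : (ℕ → Bool) → Option (ℕ → Bool)} (hx : Evaluates x φ)
    (hy : Evaluates y ψ) : Evaluates (x * y) fun b => (φ b).bind ψ := by
  obtain ⟨x, rfl, k, hx⟩ := hx
  obtain ⟨y, rfl, k', hy⟩ := hy
  refine ⟨x * y, map_mul of x y, max k k', fun n hn b => ?_⟩
  rw [Pi.mul_apply, mul_def, ev_comp, hx n (le_of_max_le_left hn)]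
  cases e : φ b with
  | none => simp [e]
  | some c => simpa [e] using hy n (le_of_max_le_right hn) c

theorem evaluates_one : Evaluates 1 some :=
  ⟨1, map_one of, 0, fun n _ b => ev_one (bits_length n b)⟩

/-- The second hypothesis records that `φ` leaves the wires above the first `n` unchanged, as the
germ does. -/
theorem evaluates_stab {n : ℕ} (f : Circuit.Mor n n) {φ : (ℕ → Bool) → Option (ℕ → Bool)}
    (h : ∀ b, ev f (bits n b) = (φ b).map (bits n))
    (h' : ∀ b, ∀ c ∈ φ b, ∀ i, c (i + n) = b (i + n)) : Evaluates (stab rfl f) φ := by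
  refine ⟨_, rfl, n, fun m hm b => ?_⟩
  obtain ⟨r, rfl⟩ := Nat.exists_eq_add_of_le' hm
  rw [stabFamily_add_self, bits_add, ev_append _ _ (bits_length _ _) (bits_length _ _), h,
    ev_one (bits_length _ _), Option.bind_some]
  cases e : φ b with
  | none => rfl
  | some c =>
    simp only [Option.map_some, Option.some.injEq]
    rw [bits_add]
    congr 2
    funext i
    exact (h' b c e i).symm

/-- The value on each wire is seen in bit strings of sufficient length, so a map on infinite
assignments is determined by its truncations of all large lengths. -/
theorem Evaluates.unique {x y : ∀ n, Circuit.Mor n n} (h : ∀ n, ev (x n) = ev (y n))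
    {φ ψ : (ℕ → Bool) → Option (ℕ → Bool)} (hx : Evaluates (of x) φ) (hy : Evaluates (of y) ψ) :
    φ = ψ := by
  obtain ⟨x', ex, k, hx⟩ := hx
  obtain ⟨y', ey, k', hy⟩ := hy
  obtain ⟨l, hl⟩ := exists_of_germ_eq ex
  obtain ⟨l', hl'⟩ := exists_of_germ_eq ey
  funext b
  have key : ∀ n ≥ k + k' + l + l', (φ b).map (bits n) = (ψ b).map (bits n) := fun n hn => by
    rw [← hx n (by omega), ← hy n (by omega), hl n (by omega), hl' n (by omega), h]
  have h0 := key _ le_rfl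
  cases e : φ b with
  | none => cases e' : ψ b with
    | none => rfl
    | some c => simp [e, e'] at h0
  | some c => cases e' : ψ b with
    | none => simp [e, e'] at h0
    | some c' =>
      congr 1
      funext i
      have := key (k + k' + l + l' + i + 1) (by omega)
      rw [e, e'] at this
      exact eq_of_bits_eq (by omega) (Option.some.inj this)

theorem evaluates_generator (i : ℕ) :
    Evaluates (adjacent i) fun b => some (b ∘ Equiv.swap i (i + 1)) := by
  rw [adjacent, ← stab_tensor_ones]
  refine evaluates_stab _ (fun b => ?_) ?_
  · rw [bits_add, ev_append _ _ (bits_length _ _) (bits_length _ _), ev_one (bits_length _ _),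
      ev_mk _ (bits_length _ _), Option.map_some (f := bits _), bits_add]
    have h1 : bits i (b ∘ Equiv.swap i (i + 1)) = bits i b := by
      have key : ∀ n, ∀ c c' : ℕ → Bool, (∀ j < n, c j = c' j) → bits n c = bits n c' := by
        intro n
        induction n with
        | zero => intros; rfl
        | succ n ih =>
          intro c c' h
          rw [bits, bits, h 0 (by omega), ih _ _ fun j hj => h (j + 1) (by omega)]
      refine key _ _ _ fun j hj => ?_
      rw [Function.comp, Equiv.swap_apply_of_ne_of_ne (by omega) (by omega)]
    rw [h1]
    simp [bits, Circuit.eval, Nat.add_comm 1 i]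
  · rintro b _ ⟨⟩ j
    exact congrArg b (Equiv.swap_apply_of_ne_of_ne (by omega) (by omega))

theorem evaluates_permutation {p : Germˣ × Equiv.Perm ℕ} (hp : p ∈ permutations 0) :
    Evaluates p.1 fun b => some (b ∘ p.2) := by
  refine permutations_induction (motive := fun p => Evaluates p.1 fun b => some (b ∘ p.2))
    evaluates_one ?_ hp
  intro i _ p h
  exact (evaluates_generator i).mul h

theorem Evaluates.conj {x : Germ} {φ : (ℕ → Bool) → Option (ℕ → Bool)} (h : Evaluates x φ)
    {p : Germˣ × Equiv.Perm ℕ} (hp : p ∈ permutations 0) :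
    Evaluates (conj p.1 x) fun b => (φ (b ∘ p.2)).map (· ∘ p.2.symm) := by
  have := ((evaluates_permutation hp).mul h).mul (evaluates_permutation (inv_mem hp))
  convert this using 2
  · rfl
  · rw [Option.bind_some, Option.map_eq_bind]; rfl

theorem evaluates_toffoli {i j k : ℕ} (hij : i ≠ j) (hik : i ≠ k) (hjk : j ≠ k) :
    Evaluates (toffoli i j k) fun b => some (addTo (monomial {i, j}) k b) := by
  obtain ⟨p, hp, rfl, rfl, rfl⟩ := exists_perm_three hij hik hjk
  have h0 : Evaluates (stab rfl T) fun b => some (addTo (monomial {2, 1}) 0 b) := by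
    refine evaluates_stab _ (fun b => ?_) ?_
    · rw [ev_mk _ (bits_length _ _)]
      simp [bits, Circuit.eval, addTo, monomial]
    · rintro b _ ⟨⟩ i
      exact Function.update_of_ne (by omega) _ _
  rw [conj_toffoli hp (by decide) (by decide) (by decide), toffoli_base]
  convert h0.conj hp using 2 with b
  simp only [Option.map_some, addTo, Option.some.injEq]
  rw [Function.update_comp_equiv]
  simp [monomial, Function.comp_assoc]

theorem evaluates_cnot {i j : ℕ} (hij : i ≠ j) :
    Evaluates (cnot i j) fun b => some (addTo (monomial {i}) j b) := by
  obtain ⟨p, hp, rfl, rfl⟩ := exists_perm_two hij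
  have h0 : Evaluates (stab rfl C) fun b => some (addTo (monomial {1}) 0 b) := by
    refine evaluates_stab _ (fun b => ?_) ?_
    · rw [ev_mk _ (bits_length _ _)]
      have : ∀ x y : Bool, Circuit.cnot.eval [x, y] = some [x, xor y x] := by decide
      simp [bits, this, addTo, monomial]
    · rintro b _ ⟨⟩ i
      exact Function.update_of_ne (by omega) _ _
  rw [conj_cnot hp (by decide), cnot_base]
  convert h0.conj hp using 2 with b
  simp only [Option.map_some, addTo, Option.some.injEq]
  rw [Function.update_comp_equiv]
  simp [monomial, Function.comp_assoc]

theorem evaluates_neg (i : ℕ) :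
    Evaluates (wire N i) fun b => some (addTo (monomial ∅) i b) := by
  obtain ⟨p, hp, rfl⟩ := exists_perm_one i
  have h0 : Evaluates (stab rfl N) fun b => some (addTo (monomial ∅) 0 b) := by
    refine evaluates_stab _ (fun b => ?_) ?_
    · rw [ev_mk _ (bits_length _ _)]
      have : ∀ x : Bool, Circuit.not.eval [x] = some [!x] := by decide
      simp [bits, this, addTo, monomial]
    · rintro b _ ⟨⟩ i
      exact Function.update_of_ne (by omega) _ _
  rw [conj_wire _ hp, wire_base]
  convert h0.conj hp using 2 with b
  simp only [Option.map_some, addTo, Option.some.injEq]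
  rw [Function.update_comp_equiv]
  simp [monomial, Function.comp_assoc]

theorem evaluates_proj (i : ℕ) :
    Evaluates (wire (B ∘> K) i) fun b => if b i then some b else none := by
  obtain ⟨p, hp, rfl⟩ := exists_perm_one i
  have h0 : Evaluates (stab rfl (B ∘> K)) fun b => if b 0 then some b else none := by
    refine evaluates_stab _ (fun b => ?_) ?_
    · rw [ev_comp, ev_mk _ (bits_length _ _)]
      cases h : b 0
      · simp [bits, Circuit.eval, h]
      · simp [bits, Circuit.eval, h, ev_mk]
    · intro b c hc i
      cases h : b 0 <;> simp [h] at hc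
      rw [hc]
  rw [conj_wire _ hp, wire_base]
  convert h0.conj hp using 2 with b
  cases h : b (p.2 0) <;> simp [h, Function.comp_assoc]

end Germ


/-! ### Every circuit is a word in the gates -/

namespace Germ

open Circuit.Mor

/-- The germs generated by the gates and the projections to the state `1`. -/
noncomputable def words : Submonoid Germ :=
  Submonoid.closure ({x | ∃ i, wire (B ∘> K) i = x} ∪ {x | ∃ i, wire N i = x} ∪
    {x | ∃ i j, i ≠ j ∧ cnot i j = x} ∪
    {x | ∃ i j k, i ≠ j ∧ i ≠ k ∧ j ≠ k ∧ toffoli i j k = x})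

theorem proj_mem_words (i : ℕ) : wire (B ∘> K) i ∈ words :=
  Submonoid.subset_closure (.inl (.inl (.inl ⟨i, rfl⟩)))

theorem neg_mem_words (i : ℕ) : wire N i ∈ words :=
  Submonoid.subset_closure (.inl (.inl (.inr ⟨i, rfl⟩)))

theorem cnot_mem_words {i j : ℕ} (h : i ≠ j) : cnot i j ∈ words :=
  Submonoid.subset_closure (.inl (.inr ⟨i, j, h, rfl⟩))

theorem toffoli_mem_words {i j k : ℕ} (hij : i ≠ j) (hik : i ≠ k) (hjk : j ≠ k) :
    toffoli i j k ∈ words :=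
  Submonoid.subset_closure (.inr ⟨i, j, k, hij, hik, hjk, rfl⟩)

theorem shift_mem_words {x : Germ} (hx : x ∈ words) : shift x ∈ words := by
  refine (Submonoid.closure_le (S := words.comap shift)).2 ?_ hx
  rintro _ (((⟨i, rfl⟩ | ⟨i, rfl⟩) | ⟨i, j, h, rfl⟩) | ⟨i, j, k, hij, hik, hjk, rfl⟩) <;>
    rw [SetLike.mem_coe, Submonoid.mem_comap]
  · exact (shift_wire _ i).symm ▸ proj_mem_words (i + 1)
  · exact (shift_wire _ i).symm ▸ neg_mem_words (i + 1)
  · exact (shift_cnot h).symm ▸ cnot_mem_words (by omega)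
  · exact (shift_toffoli hij hik hjk).symm ▸ toffoli_mem_words (by omega) (by omega) (by omega)

theorem shift_iterate_mem_words {x : Germ} (hx : x ∈ words) (n : ℕ) : shift^[n] x ∈ words := by
  induction n with
  | zero => exact hx
  | succ n ih => rw [Function.iterate_succ_apply']; exact shift_mem_words ih

/-- The link between the two semantics: the same `φ` describes a product both formally in the gate
system and by evaluation of circuits. -/
theorem exists_computes {x : Germ} (hx : x ∈ words) :
    ∃ φ, gates.Computes x φ ∧ Evaluates x φ := by
  induction hx using Submonoid.closure_induction_left with
  | one => exact ⟨some, .one, evaluates_one⟩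
  | mul_left x h y _ ih =>
  obtain ⟨φ, h1, h2⟩ := ih
  rcases h with ((⟨i, rfl⟩ | ⟨i, rfl⟩) | ⟨i, j, h, rfl⟩) | ⟨i, j, k, hij, hik, hjk, rfl⟩
  · refine ⟨_, .E_mul i h1, ?_⟩
    convert (evaluates_proj i).mul h2 using 2 with b
    split_ifs <;> rfl
  · refine ⟨_, ?_, (evaluates_neg i).mul h2⟩
    have := h1.ctrl_mul (S := ∅) (t := i) (by simp)
    rwa [GateSystem.ctrl_empty] at this
  · refine ⟨_, ?_, (evaluates_cnot h).mul h2⟩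
    have := h1.ctrl_mul (S := {i}) (t := j) (by simpa using h.symm)
    rwa [GateSystem.ctrl_singleton h] at this
  · refine ⟨_, ?_, (evaluates_toffoli hij hik hjk).mul h2⟩
    have := h1.ctrl_mul (S := {i, j}) (t := k) (by simp [hik.symm, hjk.symm])
    rwa [GateSystem.ctrl_pair hij hik hjk] at this

/-- By `tof15` an exchange of two wires is a product of three `cnot` gates. -/
theorem permutation_mem_words {p : Germˣ × Equiv.Perm ℕ} (hp : p ∈ permutations 0) :
    (p.1 : Germ) ∈ words := by
  refine permutations_induction (motive := fun p => (p.1 : Germ) ∈ words) words.one_mem ?_ hp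
  intro i _ p h
  refine words.mul_mem (shift_iterate_mem_words ?_ i) h
  rw [← exch_base]
  have : exch 1 0 = _ := gates.swap_eq (i := 1) (j := 0) (by decide)
  rw [this]
  exact words.mul_mem (words.mul_mem (cnot_mem_words (by decide)) (cnot_mem_words (by decide)))
    (cnot_mem_words (by decide))

theorem stab_swap_mul (a b : ℕ) : stab (Nat.add_comm a b) (mk (Circuit.swap a b)) *
    stab (Nat.add_comm b a) (mk (Circuit.swap b a)) = 1 := by
  rw [stab_comp, swap_swap, stab_one]

theorem stab_swap_add (a b c : ℕ) : stab (Nat.add_comm a (b + c)) (mk (Circuit.swap a (b + c))) =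
    stab (by omega) (mk (Circuit.swap a b) ⊗> one c) *
      stab (Nat.add_comm a c) (mk (Circuit.swap a c)) := by
  have e : mk (Circuit.swap a (b + c)) = cast _ _ ((mk (Circuit.swap a b) ⊗> one c) ∘>
      cast (Nat.add_assoc b a c).symm rfl (one b ⊗> mk (Circuit.swap a c))) :=
    (mk_eq.2 (Circuit.Equiv.hexagon a b c)).trans
      (by rw [mk_cast, mk_comp, mk_cast, mk_tensor, mk_tensor])
  rw [e, stab_cast (by omega), ← stab_one_tensor (Nat.add_comm a c) b,
    ← stab_cast (by omega) (Nat.add_assoc b a c).symm rfl, stab_comp]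

theorem stab_swap_mem_words (a b : ℕ) :
    stab (Nat.add_comm a b) (mk (Circuit.swap a b)) ∈ words := by
  induction b with
  | zero =>
    have h := stab_swap_add a 0 0
    simp only [tensor_unit] at h
    have h' := stab_swap_mul a 0
    -- The hexagon makes this exchange idempotent; being invertible, it is the identity.
    have : stab (Nat.add_comm a 0) (mk (Circuit.swap a 0)) = 1 := by
      rw [← h']
      conv_rhs => rw [h, mul_assoc, h', mul_one]
    exact this ▸ words.one_mem
  | succ b ih =>
    rw [stab_swap_add, stab_tensor_one (Nat.add_comm a b)]
    refine words.mul_mem (shift_mem_words ih) ?_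
    obtain ⟨q, hq, h, -⟩ := exists_swap_one a
    have e : stab (Nat.add_comm a 1) (mk (Circuit.swap a 1)) = (q⁻¹).1 := by
      have := stab_swap_mul a 1
      rw [← h] at this
      exact eq_comm.1 (Units.inv_eq_of_mul_eq_one_left this)
    rw [e]
    exact permutation_mem_words (inv_mem hq)

end Germ

/-! ### Padding circuits to products of gates -/

namespace Circuit.Mor

def kets : (n : ℕ) → Mor 0 n
  | 0 => one 0
  | n + 1 => kets n ⊗> K

def bras : (n : ℕ) → Mor n 0
  | 0 => one 0
  | n + 1 => bras n ⊗> B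

theorem kets_bras (n : ℕ) : kets n ∘> bras n = one 0 := by
  induction n with
  | zero => exact one_comp _
  | succ n ih =>
    exact (tensor_comp (kets n) (bras n) K B).trans (by rw [ih, K_B]; exact one_tensor 0 0)

/-- The morphism which maps `1, …, 1` to `1, …, 1` and is undefined elsewhere. -/
def collapse (r s : ℕ) : Mor r s := bras r ∘> kets s

theorem collapse_comp (r s t : ℕ) : collapse r s ∘> collapse s t = collapse r t := by
  rw [collapse, collapse, assoc, ← assoc (kets s), kets_bras, one_comp, collapse]

theorem collapse_K (r s : ℕ) : collapse r s ⊗> K = collapse r (s + 1) :=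
  calc collapse r s ⊗> K = collapse r s ⊗> (one 0 ∘> K) := by rw [one_comp]
    _ = (bras r ⊗> one 0) ∘> (kets s ⊗> K) := (tensor_comp _ _ _ _).symm
    _ = collapse r (s + 1) := by rw [tensor_unit]; rfl

theorem collapse_B (r s : ℕ) : collapse r s ⊗> B = collapse (r + 1) s :=
  calc collapse r s ⊗> B = collapse r s ⊗> (B ∘> one 0) := by rw [comp_one]
    _ = (bras r ⊗> B) ∘> (kets s ⊗> one 0) := (tensor_comp _ _ _ _).symm
    _ = collapse (r + 1) s := by rw [tensor_unit]; rfl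

end Circuit.Mor

namespace Germ

open Circuit.Mor

theorem collapse_mem_words (r : ℕ) : stab rfl (collapse r r) ∈ words := by
  induction r with
  | zero =>
    have e : collapse 0 0 = one 0 := one_comp _
    rw [e, stab_one]
    exact words.one_mem
  | succ r ih =>
    have e : collapse (r + 1) (r + 1) = (collapse r r ⊗> one 1) ∘> (one r ⊗> (B ∘> K)) := by
      rw [tensor_comp, comp_one, one_comp]
      exact (tensor_comp (bras r) (kets r) B K)
    rw [e, ← stab_comp rfl rfl, stab_tensor_one rfl, stab_one_tensor rfl, ← wire_base]
    exact words.mul_mem (shift_mem_words ih) (proj_mem_words 0)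

/-- After stabilization with sufficiently many wires in the state `1`, `f` becomes a word in the
gates. -/
def Generated {n m : ℕ} (f : Circuit.Mor n m) : Prop :=
  ∃ k, ∀ r ≥ k, ∀ s (h : r + n = s + m), stab h (collapse r s ⊗> f) ∈ words

theorem Generated.comp {n m p : ℕ} {f : Circuit.Mor n m} {g : Circuit.Mor m p} (hf : Generated f)
    (hg : Generated g) : Generated (f ∘> g) := by
  obtain ⟨k, hf⟩ := hf
  obtain ⟨l, hg⟩ := hg
  -- The intermediate padding has `r + n - m` wires; the bound makes the subtraction exact and the
  -- result at least `l`.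
  refine ⟨k + l + m, fun r hr s h => ?_⟩
  have h1 : r + n = (r + n - m) + m := by omega
  rw [← collapse_comp r (r + n - m) s, ← tensor_comp, ← stab_comp h1 (h1.symm.trans h)]
  exact words.mul_mem (hf r (by omega) _ _) (hg _ (by omega) _ _)

theorem Generated.tensor_one {n m : ℕ} {f : Circuit.Mor n m} (hf : Generated f) (c : ℕ) :
    Generated (f ⊗> one c) := by
  induction c with
  | zero => rwa [tensor_unit]
  | succ c ih =>
    obtain ⟨k, ih⟩ := ih
    refine ⟨k, fun r hr s h => ?_⟩
    rw [tensor_one_succ, ← tensor_one_assoc]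
    have h' : r + (n + c) = s + (m + c) := by omega
    exact (stab_tensor_one h' (collapse r s ⊗> (f ⊗> one c))).symm ▸ shift_mem_words (ih r hr s h')

theorem generated_of_stab {n m : ℕ} {h : n = m} {f : Circuit.Mor n m} (hf : stab h f ∈ words) :
    Generated f := by
  refine ⟨0, fun r _ s h' => ?_⟩
  obtain rfl : r = s := by omega
  have e : collapse r r ⊗> f = (collapse r r ⊗> one n) ∘> (one r ⊗> f) := by
    rw [tensor_comp, comp_one, one_comp]
  rw [e, ← stab_comp rfl h', stab_one_tensor h, stab_tensor_ones]
  exact words.mul_mem (shift_iterate_mem_words (collapse_mem_words r) n) hf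

theorem generated_swap (a b : ℕ) : Generated (mk (Circuit.swap a b)) :=
  generated_of_stab (stab_swap_mem_words a b)

/-- Idle wires on top are moved to the bottom by the symmetry, where the previous case applies. -/
theorem Generated.one_tensor {n m : ℕ} {f : Circuit.Mor n m} (hf : Generated f) (c : ℕ) :
    Generated (one c ⊗> f) := by
  have e : one c ⊗> f = mk (Circuit.swap c n) ∘> (f ⊗> one c) ∘> mk (Circuit.swap m c) := by
    rw [← assoc, ← swap_natural, assoc, swap_swap, comp_one]
  rw [e]
  exact (generated_swap c n).comp ((hf.tensor_one c).comp (generated_swap m c))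

/-- A ket or a bra merges with the padding into a `collapse` with equal numbers of inputs and
outputs, which is a product of projections to `1`. All other generators are reversible and are words
by themselves. -/
theorem generated_mk {n m : ℕ} (f : Circuit n m) : Generated (mk f) := by
  induction f with
  | id n => exact generated_of_stab (h := rfl) ((stab_one n).symm ▸ words.one_mem)
  | comp f g hf hg => exact hf.comp hg
  | @tensor a b c d f g hf hg =>
    have e : mk (f ⊠ g) = (mk f ⊗> one c) ∘> (one b ⊗> mk g) := by
      rw [tensor_comp, comp_one, one_comp]; rfl
    rw [e]
    exact (hf.tensor_one c).comp (hg.one_tensor b)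
  | swap a b => exact generated_swap a b
  | ket1 =>
    refine ⟨0, fun r _ s h => ?_⟩
    obtain rfl : r = s + 1 := h
    exact (collapse_K (s + 1) s).symm ▸ collapse_mem_words (s + 1)
  | bra1 =>
    refine ⟨0, fun r _ s h => ?_⟩
    obtain rfl : r + 1 = s := h
    exact (collapse_B r (r + 1)).symm ▸ collapse_mem_words (r + 1)
  | tof =>
    exact generated_of_stab (h := rfl)
      (toffoli_base ▸ toffoli_mem_words (by decide) (by decide) (by decide))

end Germ


/-! ### Faithfulness -/

namespace Circuit.Mor

/-- The original morphism is recovered from its padding. -/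
theorem kets_collapse_bras {n m : ℕ} (r s : ℕ) (f : Mor n m) :
    (kets r ⊗> one n) ∘> (collapse r s ⊗> f) ∘> (bras s ⊗> one m) = one 0 ⊗> f := by
  rw [tensor_comp, tensor_comp, comp_one, one_comp, collapse, assoc, kets_bras, comp_one,
    kets_bras]

open Germ in
/-- Morphisms which agree on all bit strings are equal. -/
theorem eq_of_ev_eq {n m : ℕ} {f g : Mor n m} (h : ev f = ev g) : f = g := by
  obtain ⟨f', rfl⟩ := Quotient.exists_rep f
  obtain ⟨g', rfl⟩ := Quotient.exists_rep g
  obtain ⟨k, hf⟩ := generated_mk f'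
  obtain ⟨l, hg⟩ := generated_mk g'
  change ev (mk f') = ev (mk g') at h
  change mk f' = mk g'
  -- The paddings exceed both thresholds and balance the numbers of inputs and outputs.
  have hr : (k + l + m) + n = (k + l + n) + m := by omega
  obtain ⟨φ, hφ, hφ'⟩ := exists_computes (hf (k + l + m) (by omega) _ hr)
  obtain ⟨ψ, hψ, hψ'⟩ := exists_computes (hg (k + l + m) (by omega) _ hr)
  have e : φ = ψ := Evaluates.unique (fun N => by
    unfold stabFamily
    split_ifs with hN
    · rw [ev_cast, ev_cast]
      funext l
      simp only [ev_tensor, h]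
    · rfl) hφ' hψ'
  subst e
  have e := congrArg (fun x => (kets _ ⊗> one n) ∘> x ∘> (bras _ ⊗> one m))
    (stab_injective hr (hφ.unique hψ))
  simp only [kets_collapse_bras] at e
  rw [← unit_tensor (mk f'), e, unit_tensor]

end Circuit.Mor

namespace TOF

open Circuit

/-- The kets are total points and exhaust the bit strings of the given length, so equal values on
points give equal evaluations; `Mor.eq_of_ev_eq` concludes. -/
theorem H₀_map_injective {A B : TOF} {f g : A ⟶ B} (h : H₀.map f = H₀.map g) : f = g := by
  have h : ∀ p q, evalPoint f p = some q ↔ evalPoint g p = some q := fun p q => by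
    have : evalPoint f = evalPoint g := congrArg (fun e : PEquiv _ _ => e.toFun) h
    rw [this]
  obtain ⟨f, rfl⟩ := exists_circuit f
  obtain ⟨g, rfl⟩ := exists_circuit g
  have h : ∀ b c, f.eval (List.ofFn b) = some (List.ofFn c) ↔
      g.eval (List.ofFn b) = some (List.ofFn c) := fun b c => by
    rw [← ket_comp_eq_iff, ← ket_comp_eq_iff]
    exact evalPoint_eq_some.symm.trans
      ((h ⟨ket b, isTotal_ket b⟩ ⟨ket c, isTotal_ket c⟩).trans evalPoint_eq_some)
  obtain ⟨n⟩ := A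
  obtain ⟨m⟩ := B
  refine Mor.eq_of_ev_eq (f := Mor.mk f) (g := Mor.mk g) (funext fun l => ?_)
  by_cases hl : l.length = n
  · rw [Mor.ev_mk _ hl, Mor.ev_mk _ hl]
    subst hl
    have h := h l.get
    rw [List.ofFn_get] at h
    refine Option.ext fun k => ?_
    by_cases hk : k.length = m
    · subst hk
      have h := h k.get
      rwa [List.ofFn_get] at h
    · exact ⟨fun e => absurd (eval_length _ rfl e) hk, fun e => absurd (eval_length _ rfl e) hk⟩
  · rw [Mor.ev_of_ne _ hl, Mor.ev_of_ne _ hl]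

end TOF

theorem mainTheorem6 : (TOF.H₀tilde : TOF ⥤ FPinj₂).Faithful := by
  refine ⟨fun {A B f g} h => TOF.H₀_map_injective ?_⟩
  -- The functor is conjugate to `H₀` by isomorphisms, which can be cancelled.
  have h : (TOF.pointsIso A).inv ≫ TOF.H₀.map f ≫ (TOF.pointsIso B).hom =
      (TOF.pointsIso A).inv ≫ TOF.H₀.map g ≫ (TOF.pointsIso B).hom :=
    congrArg (fun x => x.hom) h
  exact (cancel_mono _).1 ((cancel_epi _).1 h)
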